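/- **Setting.** Let $d\in\{1,2,3\}$, let $\Omega\subset\mathbb R^d$ be open, and let $\mathcal T_H=\{K_1,\dots,K_N\}$ be a conforming mesh of $\overline\Omega$: each $K_j$ is the image of the closed unit simplex or unit cube under an injective isoparametric ($P_1$ resp. $Q_1$) map with nonvanishing Jacobian determinant (intervals, triangles, convex quadrilaterals, tetrahedra, hexahedra), the interiors of the elements are pairwise disjoint and contained in $\Omega$, $\bigcup_jK_j=\overline\Omega$, and the nodal basis functions of any two elements agree on their intersection. Let $\eta_{j,k}$ be the Lagrange basis functions of $K_j$ attached to its vertices. Let $\varepsilon>0$ and let $V^\delta:\mathbb R^d\to\mathbb R$ be measurable with $0<V_{\min}\le V^\delta\le V_{\max}$ on $\Omega$. All functions are complex-valued. Put $\tilde\mu=\sum_k\frac12\varepsilon^2|\nabla\eta_{j,k}|^2$ on the interior of $K_j$, $$a(w,v)=\int_\Omega \tfrac12\varepsilon^2\nabla w\cdot\nabla\overline v+V^\delta w\overline v\,dx,\qquad s(w,v)=\int_\Omega\tilde\mu\,w\overline v\,dx,$$ $\|v\|_a^2=a(v,v)$, $\|v\|_s^2=s(v,v)$, and let $a_j,s_j$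 be the same integrals over $K_j$. For each $j$ let $\lambda_j^1\le\lambda_j^2\le\cdots$ be an enumeration, with multiplicity, of all the eigenvalues of the problem $a_j(\phi,v)=\lambda s_j(\phi,v)$ for all $v\in H^1(K_j)$, with corresponding nonzero, mutually $s_j$-orthogonal eigenfunctions $\phi_j^i\in H^1(K_j)$, extended by zero to $\Omega$. Fix integers $l_j\ge0$ and set $$\pi v=\sum_{j=1}^N\sum_{i=1}^{l_j}\frac{s(v,\phi_j^i)}{s(\phi_j^i,\phi_j^i)}\phi_j^i,\qquad \Lambda=\min_{1\le j\le N}\lambda_j^{l_j+1}.$$ Let $K_j^0=K_j$ and let $K_j^{m+1}$ be the union of all elements that intersect an element of $K_j^m$. Let $V=H^1(\Omega)$ and let $V(K_j^m)$ be the set of $v\in V$ that vanish a.e. in $\Omega\setminus K_j^m$. **Theorem.** Let $1\le j\le N$, $1\le i\le l_j$ and $l\ge1$. Let $\psi_j^i\in V$ and $\psi_{j,l}^i\in V(K_j^l)$ satisfy $$a(\psi_j^i,v)+s(\pi\psi_j^i,\pi v)=s(\phi_j^i,\pi v)\quad\forall v\in V,$$ $$a(\psi_{j,l}^i,v)+s(\pi\psi_{j,l}^i,\pi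 v)=s(\phi_j^i,\pi v)\quad\forall v\in V(K_j^l).$$ Then $\Lambda>0$ and $$\|\psi_j^i-\psi_{j,l}^i\|_a^2+\|\pi(\psi_j^i-\psi_{j,l}^i)\|_s^2\le\frac{15}{4}\Big(1+\frac1\Lambda\Big)\theta^l\|\phi_j^i\|_s^2,$$ where $\theta=\tilde c/(1+\tilde c)\in(0,1)$ and $\tilde c=2(1+1/\sqrt\Lambda)$. So the localization error decays exponentially in the number $l$ of layers. -/

import Mathlib

open MeasureTheory Set
open scoped ContDiff ENNReal

noncomputable section

namespace CEM

/-- Points of `ℝ^d` with the Euclidean norm. -/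
abbrev Pt (d : ℕ) : Type := EuclideanSpace ℝ (Fin d)

/-! ### The complex Sobolev space `H¹(U)` -/

/-- `g` is the weak gradient of `u` on `U`: `∫_U (∂ᵢφ) u = - ∫_U φ gᵢ` for every index `i` and
every smooth `φ` with compact support inside `U`. -/
def IsWeakGradient {d : ℕ} (U : Set (Pt d)) (u : Pt d → ℂ)
    (g : Pt d → EuclideanSpace ℂ (Fin d)) : Prop :=
  ∀ φ : Pt d → ℝ, ContDiff ℝ ∞ φ → HasCompactSupport φ → tsupport φ ⊆ U →
    ∀ i : Fin d, ∫ x in U, (fderiv ℝ φ x (EuclideanSpace.single i 1)) • u x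
      = - ∫ x in U, (φ x) • (g x) i

theorem integrable_smul_test {d : ℕ} {U : Set (Pt d)} {f : Pt d → ℂ} {φ : Pt d → ℝ}
    (hf : MemLp f 2 (volume.restrict U)) (hφ : Continuous φ) (hc : HasCompactSupport φ) :
    Integrable (fun x => φ x • f x) (volume.restrict U) := by
  have h2 : MemLp φ 2 (volume.restrict U) := hφ.memLp_of_hasCompactSupport hc
  have h3 : MemLp (fun x => (φ x : ℂ)) 2 (volume.restrict U) := h2.ofReal
  refine (h3.integrable_mul hf).congr (Filter.Eventually.of_forall fun x => ?_)
  simp [Complex.real_smul]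

theorem continuous_test_deriv {d : ℕ} {φ : Pt d → ℝ} (hφ : ContDiff ℝ ∞ φ) (v : Pt d) :
    Continuous (fun x => fderiv ℝ φ x v) :=
  (hφ.continuous_fderiv (by simp)).clm_apply continuous_const

theorem hasCompactSupport_test_deriv {d : ℕ} {φ : Pt d → ℝ} (hc : HasCompactSupport φ)
    (v : Pt d) : HasCompactSupport (fun x => fderiv ℝ φ x v) :=
  hc.fderiv_apply ℝ v

theorem memLp_coord {d : ℕ} {U : Set (Pt d)} {g : Pt d → EuclideanSpace ℂ (Fin d)}
    (hg : MemLp g 2 (volume.restrict U)) (i : Fin d) :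
    MemLp (fun x => (g x) i) 2 (volume.restrict U) :=
  (EuclideanSpace.proj i : EuclideanSpace ℂ (Fin d) →L[ℂ] ℂ).comp_memLp' hg

/-- `H¹(U)`: the pairs `(u, ∇u)` of an `L²(U)` function and its (a.e. unique) weak gradient,
which has to be in `L²(U)` too. -/
def H1 {d : ℕ} (U : Set (Pt d)) :
    Submodule ℂ (Lp ℂ 2 (volume.restrict U) ×
      Lp (EuclideanSpace ℂ (Fin d)) 2 (volume.restrict U)) where
  carrier := {p | IsWeakGradient U p.1 p.2}
  zero_mem' := by
    intro φ _ _ _ i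
    have h1 : (fun x => (fderiv ℝ φ x (EuclideanSpace.single i 1)) •
        ((0 : Lp ℂ 2 (volume.restrict U)) : Pt d → ℂ) x) =ᵐ[volume.restrict U] 0 := by
      filter_upwards [Lp.coeFn_zero ℂ 2 (volume.restrict U)] with x hx
      rw [hx]; simp
    have h2 : (fun x => (φ x) •
        (((0 : Lp (EuclideanSpace ℂ (Fin d)) 2 (volume.restrict U)) :
          Pt d → EuclideanSpace ℂ (Fin d)) x) i) =ᵐ[volume.restrict U] 0 := by
      filter_upwards [Lp.coeFn_zero (EuclideanSpace ℂ (Fin d)) 2 (volume.restrict U)] with x hx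
      rw [hx]; simp
    simp only [Prod.fst_zero, Prod.snd_zero]
    rw [integral_congr_ae h1, integral_congr_ae h2]
    simp
  add_mem' := by
    intro p q hp hq φ hφ hc hs i
    have hd := continuous_test_deriv hφ (EuclideanSpace.single i (1 : ℝ))
    have hdc := hasCompactSupport_test_deriv hc (EuclideanSpace.single i (1 : ℝ))
    have h1 : (fun x => (fderiv ℝ φ x (EuclideanSpace.single i 1)) • ((p + q).1 : Pt d → ℂ) x)
        =ᵐ[volume.restrict U] (fun x => (fderiv ℝ φ x (EuclideanSpace.single i 1)) • p.1 x
          + (fderiv ℝ φ x (EuclideanSpace.single i 1)) • q.1 x) := by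
      filter_upwards [Lp.coeFn_add p.1 q.1] with x hx
      rw [Prod.fst_add, hx, Pi.add_apply, smul_add]
    have h2 : (fun x => (φ x) • (((p + q).2 : Pt d → EuclideanSpace ℂ (Fin d)) x) i)
        =ᵐ[volume.restrict U] (fun x => (φ x) • (p.2 x) i + (φ x) • (q.2 x) i) := by
      filter_upwards [Lp.coeFn_add p.2 q.2] with x hx
      rw [Prod.snd_add, hx, Pi.add_apply, PiLp.add_apply, smul_add]
    rw [integral_congr_ae h1, integral_congr_ae h2,
      integral_add (integrable_smul_test (Lp.memLp p.1) hd hdc)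
        (integrable_smul_test (Lp.memLp q.1) hd hdc),
      integral_add (integrable_smul_test (memLp_coord (Lp.memLp p.2) i) hφ.continuous hc)
        (integrable_smul_test (memLp_coord (Lp.memLp q.2) i) hφ.continuous hc),
      hp φ hφ hc hs i, hq φ hφ hc hs i]
    ring
  smul_mem' := by
    intro c p hp φ hφ hc hs i
    have h1 : (fun x => (fderiv ℝ φ x (EuclideanSpace.single i 1)) • ((c • p).1 : Pt d → ℂ) x)
        =ᵐ[volume.restrict U]
          (fun x => c • ((fderiv ℝ φ x (EuclideanSpace.single i 1)) • p.1 x)) := by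
      filter_upwards [Lp.coeFn_smul c p.1] with x hx
      rw [Prod.smul_fst, hx, Pi.smul_apply, smul_comm]
    have h2 : (fun x => (φ x) • (((c • p).2 : Pt d → EuclideanSpace ℂ (Fin d)) x) i)
        =ᵐ[volume.restrict U] (fun x => c • ((φ x) • (p.2 x) i)) := by
      filter_upwards [Lp.coeFn_smul c p.2] with x hx
      rw [Prod.smul_snd, hx, Pi.smul_apply, PiLp.smul_apply, smul_comm]
    rw [integral_congr_ae h1, integral_congr_ae h2, integral_smul, integral_smul,
      hp φ hφ hc hs i, smul_neg]

/-- The function underlying an element of `H¹(U)`. -/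
def H1.fn {d : ℕ} {U : Set (Pt d)} (v : H1 U) : Pt d → ℂ := v.1.1

/-- The weak gradient of an element of `H¹(U)`. -/
def H1.grad {d : ℕ} {U : Set (Pt d)} (v : H1 U) : Pt d → EuclideanSpace ℂ (Fin d) := v.1.2

/-! ### Coarse elements and coarse meshes -/

/-- The two reference elements: the unit simplex and the unit cube of `ℝ^d`. -/
inductive RefCell
  | simplex
  | cube

/-- Vertices of the reference element: `0, e₁, …, e_d` for the simplex, `{0,1}^d` for the cube. -/
def RefCell.Vertex (d : ℕ) : RefCell → Type
  | .simplex => Option (Fin d)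
  | .cube => Fin d → Bool

instance (d : ℕ) : (k : RefCell) → Fintype (k.Vertex d)
  | .simplex => inferInstanceAs (Fintype (Option (Fin d)))
  | .cube => inferInstanceAs (Fintype (Fin d → Bool))

/-- The closed reference element. -/
def RefCell.closedRef (d : ℕ) : RefCell → Set (Pt d)
  | .simplex => {x | (∀ i, 0 ≤ x i) ∧ ∑ i, x i ≤ 1}
  | .cube => {x | ∀ i, 0 ≤ x i ∧ x i ≤ 1}

/-- The open reference element. -/
def RefCell.openRef (d : ℕ) : RefCell → Set (Pt d)
  | .simplex => {x | (∀ i, 0 < x i) ∧ ∑ i, x i < 1}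
  | .cube => {x | ∀ i, 0 < x i ∧ x i < 1}

/-- The lowest order Lagrange basis on the reference element (`P₁` on the simplex, `Q₁` on the
cube): the function attached to a vertex is `1` there and `0` at all other vertices. -/
def RefCell.shape (d : ℕ) : (k : RefCell) → k.Vertex d → Pt d → ℝ
  | .simplex, none, x => 1 - ∑ i, x i
  | .simplex, some i, x => x i
  | .cube, b, x => ∏ i, if (b i : Bool) = true then x i else 1 - x i

/-- The isoparametric map sending each reference vertex `v` to the point `p v`: affine on the
simplex, multilinear on the cube. -/
def refMap {d : ℕ} (k : RefCell) (p : k.Vertex d → Pt d) (y : Pt d) : Pt d :=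
  ∑ v, k.shape d v y • p v

/-- A coarse element: the image of a reference element under a nondegenerate injective
isoparametric map (intervals, triangles, convex quadrilaterals, tetrahedra, hexahedra, …). -/
structure Cell (d : ℕ) where
  kind : RefCell
  vertex : kind.Vertex d → Pt d
  injOn : InjOn (refMap kind vertex) (kind.closedRef d)
  det_ne_zero : ∀ y ∈ kind.closedRef d, (fderiv ℝ (refMap kind vertex) y).det ≠ 0

namespace Cell

variable {d : ℕ} (K : Cell d)

/-- The closed element. -/
def closedSet : Set (Pt d) := refMap K.kind K.vertex '' K.kind.closedRef d

/-- The interior of the element. -/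
def openSet : Set (Pt d) := refMap K.kind K.vertex '' K.kind.openRef d

/-- The Lagrange basis function of the element attached to its vertex `v` (used on the closed
element only). -/
def lagrange (v : K.kind.Vertex d) (x : Pt d) : ℝ :=
  K.kind.shape d v (Function.invFunOn (refMap K.kind K.vertex) (K.kind.closedRef d) x)

open Classical in
/-- The restriction to the element of the nodal basis function of the point `p`: the Lagrange
basis function of the vertex `p` if `p` is a vertex of the element, and zero otherwise. -/
def nodal (p : Pt d) (x : Pt d) : ℝ :=
  ∑ v, if K.vertex v = p then K.lagrange v x else 0

end Cell

/-- A conforming coarse mesh of `Ω` with `N` elements. The last field says that the nodal basis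
functions are well defined, hence continuous, across element boundaries, i.e. that two elements
meet in a common face, or not at all. -/
structure Mesh {d : ℕ} (Ω : Set (Pt d)) (N : ℕ) where
  cell : Fin N → Cell d
  iUnion_eq : ⋃ j, (cell j).closedSet = closure Ω
  subset : ∀ j, (cell j).openSet ⊆ Ω
  disjoint : ∀ j k, j ≠ k → Disjoint (cell j).openSet (cell k).openSet
  conforming : ∀ j k, ∀ x ∈ (cell j).closedSet ∩ (cell k).closedSet, ∀ p,
    (cell j).nodal p x = (cell k).nodal p x

namespace Mesh

variable {d : ℕ} {Ω : Set (Pt d)} {N : ℕ} (T : Mesh Ω N)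

/-- The indices of the elements of `K_j^m`: start from `K_j` and `m` times add all elements
touching the present region. -/
def layerIdx {d : ℕ} {Ω : Set (Pt d)} {N : ℕ} (T : Mesh Ω N) (j : Fin N) : ℕ → Set (Fin N)
  | 0 => {j}
  | m + 1 => {k | ∃ i ∈ layerIdx T j m, ((T.cell i).closedSet ∩ (T.cell k).closedSet).Nonempty}

/-- The oversampling domain `K_j^m`. -/
def layer (j : Fin N) (m : ℕ) : Set (Pt d) := ⋃ k ∈ T.layerIdx j m, (T.cell k).closedSet

/-- The weight `μ̃ = ∑_k ½ ε² |∇η_{j,k}|²` on the interior of each element `K_j`. The element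
boundaries are null sets, and the value there is irrelevant. -/
def weight (ε : ℝ) (x : Pt d) : ℝ :=
  ∑ j, (T.cell j).openSet.indicator
    (fun x => ∑ v, ε ^ 2 / 2 * ‖gradient ((T.cell j).lagrange v) x‖ ^ 2) x

end Mesh

/-! ### Sesquilinear forms -/

/-- `∫_U ½ ε² ∇w · ∇v̄ + V w v̄`. -/
def aForm {d : ℕ} (ε : ℝ) (V : Pt d → ℝ) {U : Set (Pt d)} (w v : H1 U) : ℂ :=
  ∫ x in U, (((ε ^ 2 / 2 : ℝ) : ℂ) * ∑ i, H1.grad w x i * star (H1.grad v x i)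
    + (V x : ℂ) * H1.fn w x * star (H1.fn v x))

/-- `∫_U μ f ḡ`. -/
def sForm {d : ℕ} (μ : Pt d → ℝ) (U : Set (Pt d)) (f g : Pt d → ℂ) : ℂ :=
  ∫ x in U, (μ x : ℂ) * f x * star (g x)

/-- `‖v‖_a²`. -/
def aNormSq {d : ℕ} (ε : ℝ) (V : Pt d → ℝ) {U : Set (Pt d)} (v : H1 U) : ℝ :=
  (aForm ε V v v).re

/-- `‖f‖_s²`. -/
def sNormSq {d : ℕ} (μ : Pt d → ℝ) (U : Set (Pt d)) (f : Pt d → ℂ) : ℝ :=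
  (sForm μ U f f).re

/-! ### Local spectral problems, auxiliary space, projection -/

/-- The pair `(r, u)` solves the local spectral problem on `K_j` (without demanding `u ≠ 0`). -/
def IsEigenpair {d : ℕ} {Ω : Set (Pt d)} {N : ℕ} (T : Mesh Ω N) (ε : ℝ) (V : Pt d → ℝ)
    (j : Fin N) (r : ℝ) (u : H1 (T.cell j).openSet) : Prop :=
  ∀ v : H1 (T.cell j).openSet,
    aForm ε V u v = (r : ℂ) * sForm (T.weight ε) (T.cell j).openSet (H1.fn u) (H1.fn v)

/-- An enumeration, in ascending order and with multiplicity, of all eigenvalues of the local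
spectral problem on `K_j`, with mutually `s_j`-orthogonal eigenfunctions. Numbering starts at `0`.
The field `exhaustive` says that nothing is left out: each eigenfunction is a linear combination
of listed ones with the same eigenvalue. -/
structure EigenSystem {d : ℕ} {Ω : Set (Pt d)} {N : ℕ} (T : Mesh Ω N) (ε : ℝ) (V : Pt d → ℝ)
    (j : Fin N) where
  eigval : ℕ → ℝ
  eigfun : ℕ → H1 (T.cell j).openSet
  monotone : Monotone eigval
  isEigenpair : ∀ i, IsEigenpair T ε V j (eigval i) (eigfun i)
  ne_zero : ∀ i, eigfun i ≠ 0
  orthogonal : ∀ i k, i ≠ k →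
    sForm (T.weight ε) (T.cell j).openSet (H1.fn (eigfun i)) (H1.fn (eigfun k)) = 0
  exhaustive : ∀ (r : ℝ) (u : H1 (T.cell j).openSet), IsEigenpair T ε V j r u →
    u ∈ Submodule.span ℂ {w | ∃ i, eigval i = r ∧ eigfun i = w}

section Projection

variable {d : ℕ} {Ω : Set (Pt d)} {N : ℕ} {T : Mesh Ω N} {ε : ℝ} {V : Pt d → ℝ}

/-- `φ_j^i`, extended by zero outside `K_j`. -/
def auxFun (S : ∀ j, EigenSystem T ε V j) (j : Fin N) (i : ℕ) : Pt d → ℂ :=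
  (T.cell j).openSet.indicator (H1.fn ((S j).eigfun i))

/-- The projection `π` onto the auxiliary space spanned by the first `L j` eigenfunctions of each
element `K_j`: `π v = ∑_j ∑_{i < L j} s(v, φ_j^i) / s(φ_j^i, φ_j^i) φ_j^i`. -/
def auxProj (S : ∀ j, EigenSystem T ε V j) (L : Fin N → ℕ) (v : Pt d → ℂ) (x : Pt d) : ℂ :=
  ∑ j, ∑ i ∈ Finset.range (L j),
    sForm (T.weight ε) Ω v (auxFun S j i)
      / sForm (T.weight ε) Ω (auxFun S j i) (auxFun S j i) * auxFun S j i x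

/-- `Λ`: the minimum over the elements of the first eigenvalue that is left out. -/
def minLeftOut (S : ∀ j, EigenSystem T ε V j) (L : Fin N → ℕ) : ℝ :=
  ⨅ j, (S j).eigval (L j)

/-- `V(K_j^m)`: the functions in `H¹(Ω)` that vanish outside the oversampling domain. -/
def localSpace (T : Mesh Ω N) (j : Fin N) (m : ℕ) : Set (H1 Ω) :=
  {v | ∀ᵐ x ∂(volume.restrict Ω), x ∉ T.layer j m → H1.fn v x = 0}

/-- `ψ` is the global multiscale basis function attached to `φ_j^i`. -/
def IsGlobalBasis (S : ∀ j, EigenSystem T ε V j) (L : Fin N → ℕ) (j : Fin N) (i : ℕ)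
    (ψ : H1 Ω) : Prop :=
  ∀ v : H1 Ω, aForm ε V ψ v
      + sForm (T.weight ε) Ω (auxProj S L (H1.fn ψ)) (auxProj S L (H1.fn v))
    = sForm (T.weight ε) Ω (auxFun S j i) (auxProj S L (H1.fn v))

/-- `ψ` is the multiscale basis function attached to `φ_j^i`, computed on `K_j^m`. -/
def IsLocalBasis (S : ∀ j, EigenSystem T ε V j) (L : Fin N → ℕ) (j : Fin N) (i m : ℕ)
    (ψ : H1 Ω) : Prop :=
  ψ ∈ localSpace T j m ∧
  ∀ v ∈ localSpace T j m, aForm ε V ψ v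
      + sForm (T.weight ε) Ω (auxProj S L (H1.fn ψ)) (auxProj S L (H1.fn v))
    = sForm (T.weight ε) Ω (auxFun S j i) (auxProj S L (H1.fn v))

end Projection

/-- `c̃ = 2 (1 + 1/√Λ)`. -/
def cTilde (Λ : ℝ) : ℝ := 2 * (1 + 1 / √Λ)

/-- `θ = c̃ / (1 + c̃)`. -/
def theta (Λ : ℝ) : ℝ := cTilde Λ / (1 + cTilde Λ)

end CEM

end

noncomputable section

namespace CEM

open Filter Topology

/-! Write B(u, v) = a(u, v) + s(πu, πv). Each auxiliary function lives on a single element, so B is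
a sum over the elements of forms b_k that see only the restriction to K_k
(`aForm_add_sForm_eq_sum`). Let E_m be the energy of ψ, the sum of b_k(ψ, ψ), over the elements
outside K_j^m (`energyOutside`).

Decay. Let χ be the finite element function that is 1 at the vertices of K_j^m and 0 at all others,
and let w = (1 - χ)ψ. Then w = 0 on K_j^m and w = ψ outside K_j^{m+1}. Tested with w, the equation
of ψ has right-hand side zero, because w vanishes on K_j. Hence E_{m+1} is the sum of -b_k(ψ, w)
over the ring in between. On each element -b_k(ψ, w) ≤ c̃ b_k(ψ, ψ)
(`EigenSystem.neg_re_bSesq_scaled_le`), so E_{m+1} ≤ c̃ (E_m - E_{m+1}), which is E_{m+1} ≤ θ E_m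
(`energyOutside_le_mul`). Testing with ψ itself gives E_0 ≤ ¼ ‖φ‖_s².

Error. For m = l - 1 the function ψ - w belongs to V(K_j^l), so by Galerkin orthogonality the
B-energy of ψ - ψ_l is at most that of w (`sum_re_error_le`). Since b_k(w, w) ≤ 5(1 + 1/Λ) b_k(ψ, ψ)
and w = 0 on K_j^m, this is at most 5(1 + 1/Λ) E_{l-1}. The missing power of θ is paid for by θ ≥
2/3.

Both local bounds rest on two facts. The first is ½ε²|∇χ|² ≤ 2μ̃, because the at most eight Lagrange
gradients on an element add up to zero (`Cell.norm_gradient_partialSum_sq_le`); so a cutoff costs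
only a multiple of s(u, u). The second is s(u, u) ≤ s(πu, πu) + a(u, u)/Λ on each element
(`EigenSystem.le_proj_add`).

The second fact needs the min-max principle (`mul_re_le_of_eigenvalue_gap`), since the eigenvalues
are only assumed to be listed exhaustively: the maximizer of s/a on the orthogonal complement of the
first eigenfunctions exists by compactness, and it is an eigenfunction. Compactness is Rellich's
theorem on an element (`Cell.totallyBounded_fst_H1`), obtained from Poincaré's inequality on small
convex pieces of the reference element. That χψ is again in H¹ follows by extending the definition
of weak gradients to Lipschitz test functions. -/

/-! ### Mollification in L² and interior smooth approximation. -/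

theorem sq_lintegral_le {α : Type*} [MeasurableSpace α] (ν : Measure α) {f : α → ℝ≥0∞}
    (hf : AEMeasurable f ν) : (∫⁻ x, f x ∂ν) ^ 2 ≤ ν univ * ∫⁻ x, f x ^ 2 ∂ν := by
  have h := ENNReal.lintegral_mul_le_Lp_mul_Lq ν Real.HolderConjugate.two_two hf
    (aemeasurable_const (b := (1 : ℝ≥0∞)))
  simp only [Pi.mul_apply, mul_one, ENNReal.one_rpow, lintegral_const, one_mul] at h
  calc (∫⁻ x, f x ∂ν) ^ 2
      ≤ ((∫⁻ x, f x ^ (2 : ℝ) ∂ν) ^ (1 / (2 : ℝ)) * ν univ ^ (1 / (2 : ℝ))) ^ 2 := by gcongr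
    _ = ν univ * ∫⁻ x, f x ^ 2 ∂ν := by
      rw [mul_pow, ← ENNReal.rpow_natCast, ← ENNReal.rpow_natCast, ← ENNReal.rpow_mul,
        ← ENNReal.rpow_mul]
      norm_num
      rw [mul_comm]

/-- Composition with a continuous family of measure preserving maps is continuous in `Lp`; the rest
only rewrites the distance as a lower integral. -/
theorem tendsto_lintegral_translate_sub {d : ℕ} {E : Type*} [NormedAddCommGroup E]
    {f : Pt d → E} (hf : MemLp f 2 volume) :
    Tendsto (fun z : Pt d => ∫⁻ x, ‖f (x - z) - f x‖ₑ ^ 2) (𝓝 0) (𝓝 0) := by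
  let g : Pt d → C(Pt d, Pt d) := fun z => ⟨fun x => x - z, by fun_prop⟩
  have hg : Continuous g := by
    refine ContinuousMap.continuous_of_continuous_uncurry _ ?_
    simp only [g, Function.uncurry_def, ContinuousMap.coe_mk]
    fun_prop
  have hgm : ∀ z, MeasurePreserving (g z) (volume : Measure (Pt d)) volume := fun z =>
    measurePreserving_sub_right volume z
  have h := Continuous.compMeasurePreservingLp (f := fun _ : Pt d => hf.toLp f) continuous_const hg
    hgm (by simp)
  have h0 := (h.tendsto 0).dist (tendsto_const_nhds (x := hf.toLp f))
  have e0 : Lp.compMeasurePreserving (g 0) (hgm 0) (hf.toLp f) = hf.toLp f := by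
    rw [Lp.toLp_compMeasurePreserving]
    congr 1
    ext x; simp [g]
  rw [e0, dist_self] at h0
  have h1 : ∀ z, ENNReal.ofReal
      (dist (Lp.compMeasurePreserving (g z) (hgm z) (hf.toLp f)) (hf.toLp f)) ^ 2
        = ∫⁻ x, ‖f (x - z) - f x‖ₑ ^ 2 := by
    intro z
    rw [Lp.toLp_compMeasurePreserving, ← edist_dist, Lp.edist_toLp_toLp]
    have := eLpNorm_nnreal_pow_eq_lintegral (f := (f ∘ g z - f)) (μ := (volume : Measure (Pt d)))
      (p := 2) (by simp)
    simpa [g] using this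
  simp_rw [← h1]
  have h2 := (ENNReal.continuous_pow 2).tendsto _ |>.comp (ENNReal.tendsto_ofReal h0)
  simpa [Function.comp_def] using h2

/-- The kernel is a probability density, so the error at x is an average of f(x - z) - f(x).
Cauchy–Schwarz for that probability measure moves the square inside the average, and Tonelli
exchanges the integrals. -/
theorem lintegral_convolution_sub_le {d : ℕ} {E : Type*} [NormedAddCommGroup E] [NormedSpace ℝ E]
    [CompleteSpace E] {f : Pt d → E} (hf : MemLp f 2 volume) (φ : ContDiffBump (0 : Pt d)) :
    ∫⁻ x, ‖convolution (φ.normed volume) f (ContinuousLinearMap.lsmul ℝ ℝ) volume x - f x‖ₑ ^ 2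
      ≤ ∫⁻ z, ‖φ.normed volume z‖ₑ * ∫⁻ x, ‖f (x - z) - f x‖ₑ ^ 2 := by
  set ρ := φ.normed (volume : Measure (Pt d)) with hρ
  have hρc : Continuous ρ := φ.continuous_normed
  have hρm : Measurable (fun z => ‖ρ z‖ₑ) := hρc.measurable.enorm
  have hρ1 : ∫⁻ z, ‖ρ z‖ₑ = 1 := by
    rw [← ofReal_integral_norm_eq_lintegral_enorm φ.integrable_normed]
    have : ∀ z, ‖ρ z‖ = ρ z := fun z => by
      rw [Real.norm_eq_abs, abs_of_nonneg (φ.nonneg_normed z)]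
    rw [integral_congr_ae (Eventually.of_forall this), φ.integral_normed]; simp
  have hloc : LocallyIntegrable f volume := hf.locallyIntegrable (by norm_num)
  obtain ⟨f', hf'm, hf'⟩ := hf.1
  have hpt : ∀ x, ‖convolution ρ f (ContinuousLinearMap.lsmul ℝ ℝ) volume x - f x‖ₑ ^ 2
      ≤ ∫⁻ z, ‖ρ z‖ₑ * ‖f (x - z) - f x‖ₑ ^ 2 := by
    intro x
    have hi : Integrable (fun z => ρ z • f (x - z)) volume :=
      (φ.hasCompactSupport_normed.convolutionExists_left
        (ContinuousLinearMap.lsmul ℝ ℝ) hρc hloc x)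
    have hi2 : Integrable (fun z => ρ z • f x) volume := φ.integrable_normed.smul_const _
    have e1 : convolution ρ f (ContinuousLinearMap.lsmul ℝ ℝ) volume x - f x
        = ∫ z, ρ z • (f (x - z) - f x) := by
      simp_rw [smul_sub]
      rw [integral_sub hi hi2, integral_smul_const, φ.integral_normed, one_smul]
      rfl
    rw [e1]
    have hm : AEMeasurable (fun z => ‖f (x - z) - f x‖ₑ) volume := by
      have : AEStronglyMeasurable (fun z => f (x - z)) volume :=
        hf.1.comp_measurePreserving (Measure.measurePreserving_sub_left volume x)
      exact (this.sub aestronglyMeasurable_const).enorm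
    calc ‖∫ z, ρ z • (f (x - z) - f x)‖ₑ ^ 2
        ≤ (∫⁻ z, ‖ρ z • (f (x - z) - f x)‖ₑ) ^ 2 := by
          gcongr; exact enorm_integral_le_lintegral_enorm _
      _ = (∫⁻ z, ‖f (x - z) - f x‖ₑ ∂(volume.withDensity fun z => ‖ρ z‖ₑ)) ^ 2 := by
          rw [lintegral_withDensity_eq_lintegral_mul₀ hρm.aemeasurable hm]
          simp [enorm_smul]
      _ ≤ (volume.withDensity fun z => ‖ρ z‖ₑ) univ *
          ∫⁻ z, ‖f (x - z) - f x‖ₑ ^ 2 ∂(volume.withDensity fun z => ‖ρ z‖ₑ) :=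
          sq_lintegral_le _ (hm.mono_ac (withDensity_absolutelyContinuous _ _))
      _ = ∫⁻ z, ‖ρ z‖ₑ * ‖f (x - z) - f x‖ₑ ^ 2 := by
          rw [withDensity_apply _ MeasurableSet.univ, Measure.restrict_univ, hρ1, one_mul,
            lintegral_withDensity_eq_lintegral_mul₀ hρm.aemeasurable (hm.pow_const 2)]
          rfl
  refine (lintegral_mono hpt).trans (le_of_eq ?_)
  rw [lintegral_lintegral_swap]
  · refine lintegral_congr fun z => ?_
    rw [lintegral_const_mul' _ _ (by simp)]
  · have h1 : AEStronglyMeasurable (fun p : Pt d × Pt d => f (p.1 - p.2))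
        (volume.prod volume) :=
      hf.1.comp_quasiMeasurePreserving (quasiMeasurePreserving_sub volume volume)
    have h2 : AEStronglyMeasurable (fun p : Pt d × Pt d => f p.1) (volume.prod volume) :=
      hf.1.comp_fst
    exact ((hρm.comp measurable_snd).aemeasurable).mul (((h1.sub h2).enorm).pow_const 2)

/-- A sequence of bump functions shrinking to the origin. -/
def bumpSeq (d n : ℕ) : ContDiffBump (0 : Pt d) :=
  ⟨1 / (n + 2), 1 / (n + 1), by positivity, by
    apply one_div_lt_one_div_of_lt <;> [positivity; linarith]⟩

theorem tendsto_bumpSeq_rOut (d : ℕ) : Tendsto (fun n => (bumpSeq d n).rOut) atTop (𝓝 0) :=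
  tendsto_one_div_add_atTop_nhds_zero_nat

/-- The mollification of a function at scale `1 / (n + 1)`. -/
def mollify {d : ℕ} {E : Type*} [NormedAddCommGroup E] [NormedSpace ℝ E] (n : ℕ) (f : Pt d → E) :
    Pt d → E :=
  convolution ((bumpSeq d n).normed volume) f (ContinuousLinearMap.lsmul ℝ ℝ) volume

theorem tendsto_lintegral_mollify_sub {d : ℕ} {E : Type*} [NormedAddCommGroup E] [NormedSpace ℝ E]
    [CompleteSpace E] {f : Pt d → E} (hf : MemLp f 2 volume) :
    Tendsto (fun n => ∫⁻ x, ‖mollify n f x - f x‖ₑ ^ 2) atTop (𝓝 0) := by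
  rw [ENNReal.tendsto_nhds_zero]
  intro ε hε
  have h := (ENNReal.tendsto_nhds_zero.1 (tendsto_lintegral_translate_sub hf)) ε hε
  obtain ⟨δ, hδ, hb⟩ := Metric.eventually_nhds_iff.1 h
  filter_upwards [(tendsto_bumpSeq_rOut d).eventually (gt_mem_nhds hδ)] with n hn
  refine (lintegral_convolution_sub_le hf (bumpSeq d n)).trans ?_
  have hρ1 : ∫⁻ z, ‖(bumpSeq d n).normed (volume : Measure (Pt d)) z‖ₑ = 1 := by
    rw [← ofReal_integral_norm_eq_lintegral_enorm (bumpSeq d n).integrable_normed]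
    have : ∀ z, ‖(bumpSeq d n).normed (volume : Measure (Pt d)) z‖
        = (bumpSeq d n).normed volume z := fun z => by
      rw [Real.norm_eq_abs, abs_of_nonneg ((bumpSeq d n).nonneg_normed z)]
    simp_rw [this]
    rw [(bumpSeq d n).integral_normed]; simp
  calc _ ≤ ∫⁻ z, ‖(bumpSeq d n).normed (volume : Measure (Pt d)) z‖ₑ * ε := by
        refine lintegral_mono fun z => ?_
        -- Inside the support of the kernel the shift z is small enough for the translation error to
        -- be at most ε; outside it the kernel vanishes.
        by_cases hz : z ∈ Metric.ball (0 : Pt d) (bumpSeq d n).rOut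
        · gcongr
          exact hb (lt_trans hz hn)
        · have : (bumpSeq d n).normed (volume : Measure (Pt d)) z = 0 := by
            rw [← (bumpSeq d n).support_normed_eq (μ := volume)] at hz
            simpa using hz
          simp [this]
    _ = ε := by
        rw [lintegral_mul_const _ (by
          exact ((bumpSeq d n).continuous_normed.measurable.enorm)), hρ1, one_mul]

theorem contDiff_mollify {d : ℕ} {E : Type*} [NormedAddCommGroup E] [NormedSpace ℝ E]
    {f : Pt d → E} (hf : LocallyIntegrable f volume) (n : ℕ) : ContDiff ℝ ∞ (mollify n f) :=
  (bumpSeq d n).hasCompactSupport_normed.contDiff_convolution_left _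
    (bumpSeq d n).contDiff_normed hf

/-- The derivative falls on the kernel ρ. As the ball lies in U, the function y ↦ ρ(x - y) is an
admissible test function, and the sign from the reflection cancels the one from the integration by
parts. -/
theorem IsWeakGradient.fderiv_mollify {d : ℕ} {U : Set (Pt d)} (hU : MeasurableSet U)
    {u : Pt d → ℂ} {g : Pt d → EuclideanSpace ℂ (Fin d)} (h : IsWeakGradient U u g)
    (hu : MemLp u 2 (volume.restrict U)) (n : ℕ) (x : Pt d)
    (hx : Metric.closedBall x (bumpSeq d n).rOut ⊆ U) (i : Fin d) :
    fderiv ℝ (mollify n (U.indicator u)) x (EuclideanSpace.single i 1)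
      = mollify n (U.indicator fun y => g y i) x := by
  set ρ := (bumpSeq d n).normed (volume : Measure (Pt d)) with hρ
  have hρs : ContDiff ℝ ∞ ρ := (bumpSeq d n).contDiff_normed
  have hρcs : HasCompactSupport ρ := (bumpSeq d n).hasCompactSupport_normed
  have hu' : MemLp (U.indicator u) 2 volume := (memLp_indicator_iff_restrict hU).2 hu
  have hloc : LocallyIntegrable (U.indicator u) volume := hu'.locallyIntegrable (by norm_num)
  have hd := hρcs.hasFDerivAt_convolution_left (ContinuousLinearMap.lsmul ℝ ℝ)
    (hρs.of_le (by simp)) hloc x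
  have hd' : fderiv ℝ (mollify n (U.indicator u)) x = _ := hd.fderiv
  have hex := (hρcs.fderiv ℝ).convolutionExists_left
    (ContinuousLinearMap.precompL (Pt d) (ContinuousLinearMap.lsmul ℝ ℝ))
    (hρs.continuous_fderiv (by simp)) hloc x
  rw [hd', convolution_def, ContinuousLinearMap.integral_apply hex]
  have hφ : ContDiff ℝ ∞ (fun y => ρ (x - y)) := hρs.comp (contDiff_const.sub contDiff_id)
  have hts : tsupport (fun y => ρ (x - y)) ⊆ Metric.closedBall x (bumpSeq d n).rOut := by
    refine closure_minimal (fun y hy => ?_) Metric.isClosed_closedBall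
    have : x - y ∈ Function.support ρ := hy
    rw [hρ, (bumpSeq d n).support_normed_eq, mem_ball_zero_iff] at this
    rw [Metric.mem_closedBall, dist_comm, dist_eq_norm]
    exact this.le
  have hφc : HasCompactSupport (fun y => ρ (x - y)) :=
    (isCompact_closedBall x _).of_isClosed_subset (isClosed_tsupport _) hts
  have key := h _ hφ hφc (hts.trans hx) i
  have hfd : ∀ y, fderiv ℝ (fun y => ρ (x - y)) y (EuclideanSpace.single i 1)
      = - fderiv ℝ ρ (x - y) (EuclideanSpace.single i 1) := by
    intro y
    have h1 : HasFDerivAt (fun y => x - y) (-ContinuousLinearMap.id ℝ (Pt d)) y :=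
      (hasFDerivAt_id y).const_sub x
    have h2 := ((hρs.differentiable (by simp)) (x - y)).hasFDerivAt.comp y h1
    have h3 : fderiv ℝ (fun y => ρ (x - y)) y = _ := h2.fderiv
    rw [h3]; simp
  calc _ = ∫ t, fderiv ℝ ρ t (EuclideanSpace.single i 1) • U.indicator u (x - t) := rfl
    _ = ∫ y, fderiv ℝ ρ (x - y) (EuclideanSpace.single i 1) • U.indicator u y := by
        rw [← integral_sub_left_eq_self _ volume x]
        simp
    _ = ∫ y in U, fderiv ℝ ρ (x - y) (EuclideanSpace.single i 1) • u y := by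
        rw [← integral_indicator hU]
        congr 1; ext y
        by_cases hy : y ∈ U <;> simp [hy]
    _ = ∫ y in U, ρ (x - y) • g y i := by
        simp_rw [hfd, neg_smul] at key
        rw [integral_neg, neg_inj] at key
        exact key
    _ = ∫ y, ρ (x - y) • U.indicator (fun y => g y i) y := by
        rw [← integral_indicator hU]
        congr 1; ext y
        by_cases hy : y ∈ U <;> simp [hy]
    _ = ∫ t, ρ t • U.indicator (fun y => g y i) (x - t) := by
        rw [← integral_sub_left_eq_self _ volume x]
        simp
    _ = _ := rfl

/-- Interior approximation of an `H¹` function by smooth functions. -/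
theorem IsWeakGradient.exists_smooth_approx {d : ℕ} {U : Set (Pt d)} (hU : IsOpen U)
    {u : Pt d → ℂ} {g : Pt d → EuclideanSpace ℂ (Fin d)} (h : IsWeakGradient U u g)
    (hu : MemLp u 2 (volume.restrict U)) (hg : MemLp g 2 (volume.restrict U))
    {C : Set (Pt d)} (hC : IsCompact C) (hCU : C ⊆ U) :
    ∃ w : ℕ → Pt d → ℂ, (∀ n, ContDiff ℝ ∞ (w n)) ∧
      Tendsto (fun n => ∫⁻ x in C, ‖w n x - u x‖ₑ ^ 2) atTop (𝓝 0) ∧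
      ∀ i, Tendsto (fun n => ∫⁻ x in C,
        ‖fderiv ℝ (w n) x (EuclideanSpace.single i 1) - g x i‖ₑ ^ 2) atTop (𝓝 0) := by
  have hu' : MemLp (U.indicator u) 2 volume := (memLp_indicator_iff_restrict hU.measurableSet).2 hu
  -- A collar of width δ around C inside U: mollifiers of smaller radius never reach the jump of the
  -- zero extension across the boundary of U.
  obtain ⟨δ, hδ, hδU⟩ := hC.exists_cthickening_subset_open hU hCU
  refine ⟨fun n => mollify n (U.indicator u), fun n => contDiff_mollify
    (hu'.locallyIntegrable (by norm_num)) n, ?_, fun i => ?_⟩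
  · refine tendsto_of_tendsto_of_tendsto_of_le_of_le tendsto_const_nhds
      (tendsto_lintegral_mollify_sub hu') (fun _ => zero_le) fun n => ?_
    refine (le_of_eq ?_).trans (setLIntegral_le_lintegral C _)
    refine setLIntegral_congr_fun hC.measurableSet fun x hx => ?_
    simp [hCU hx]
  · have hg' : MemLp (U.indicator fun y => g y i) 2 volume :=
      (memLp_indicator_iff_restrict hU.measurableSet).2 (memLp_coord hg i)
    refine tendsto_of_tendsto_of_tendsto_of_le_of_le' tendsto_const_nhds
      (tendsto_lintegral_mollify_sub hg') (Eventually.of_forall fun _ => zero_le) ?_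
    filter_upwards [(tendsto_bumpSeq_rOut d).eventually (gt_mem_nhds hδ)] with n hn
    refine (le_of_eq ?_).trans (setLIntegral_le_lintegral C _)
    refine setLIntegral_congr_fun hC.measurableSet fun x hx => ?_
    have hx' : Metric.closedBall x (bumpSeq d n).rOut ⊆ U :=
      ((Metric.closedBall_subset_closedBall hn.le).trans
        (Metric.closedBall_subset_cthickening hx δ)).trans hδU
    simp only [h.fderiv_mollify hU.measurableSet hu n x hx' i]
    simp [hCU hx]

/-! ### Poincaré's inequality for double differences, and its pullback to the reference element. -/

theorem enorm_sub_sq_le_lintegral_segment {d : ℕ} {w : Pt d → ℂ} (hw : ContDiff ℝ 1 w)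
    (x y : Pt d) :
    ‖w x - w y‖ₑ ^ 2 ≤ ‖x - y‖ₑ ^ 2 *
      ∫⁻ t in Ioc (0 : ℝ) 1, ‖fderiv ℝ w (y + t • (x - y))‖ₑ ^ 2 := by
  have hc : Continuous (fun t : ℝ => fderiv ℝ w (y + t • (x - y))) :=
    (hw.continuous_fderiv (by simp)).comp (by fun_prop)
  have hd : ∀ t : ℝ, HasDerivAt (fun t : ℝ => w (y + t • (x - y)))
      (fderiv ℝ w (y + t • (x - y)) (x - y)) t := by
    intro t
    have h1 : HasDerivAt (fun t : ℝ => y + t • (x - y)) (x - y) t := by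
      simpa using ((hasDerivAt_id t).smul_const (x - y)).const_add y
    exact ((hw.differentiable (by simp)) _).hasFDerivAt.comp_hasDerivAt t h1
  have hftc := intervalIntegral.integral_eq_sub_of_hasDerivAt (a := 0) (b := 1)
    (fun t _ => hd t) ((hc.clm_apply continuous_const).intervalIntegrable _ _)
  simp only [one_smul, add_sub_cancel, zero_smul, add_zero] at hftc
  rw [← hftc, intervalIntegral.integral_of_le zero_le_one]
  calc ‖∫ t in Ioc (0 : ℝ) 1, fderiv ℝ w (y + t • (x - y)) (x - y)‖ₑ ^ 2
      ≤ (∫⁻ t in Ioc (0 : ℝ) 1, ‖fderiv ℝ w (y + t • (x - y)) (x - y)‖ₑ) ^ 2 := by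
        gcongr; exact enorm_integral_le_lintegral_enorm _
    _ ≤ (∫⁻ t in Ioc (0 : ℝ) 1, ‖x - y‖ₑ * ‖fderiv ℝ w (y + t • (x - y))‖ₑ) ^ 2 := by
        gcongr with t
        rw [mul_comm]
        exact ContinuousLinearMap.le_opENorm _ _
    _ = ‖x - y‖ₑ ^ 2 * (∫⁻ t in Ioc (0 : ℝ) 1, ‖fderiv ℝ w (y + t • (x - y))‖ₑ) ^ 2 := by
        rw [lintegral_const_mul' _ _ (by simp), mul_pow]
    _ ≤ _ := by
        gcongr
        refine (sq_lintegral_le _ hc.enorm.aemeasurable).trans ?_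
        simp

/-- The contraction towards y maps the convex set D into itself, and its Jacobian t^d is at least
2^(-d). -/
theorem setLIntegral_comp_contract_le {d : ℕ} {D : Set (Pt d)} (hD : Convex ℝ D)
    (hDm : MeasurableSet D) (G : Pt d → ℝ≥0∞) {t : ℝ} (ht : 1 / 2 ≤ t) (ht1 : t ≤ 1)
    {y : Pt d} (hy : y ∈ D) :
    ∫⁻ x in D, G (y + t • (x - y)) ≤ 2 ^ d * ∫⁻ x in D, G x := by
  have ht0 : 0 < t := by linarith
  let A : Pt d → Pt d := fun x => y + t • (x - y)
  have hA : ∀ x ∈ D, HasFDerivWithinAt A (t • ContinuousLinearMap.id ℝ (Pt d)) D x := by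
    intro x _
    exact ((((hasFDerivAt_id x).sub_const y).const_smul t).const_add y).hasFDerivWithinAt
  have hinj : InjOn A D := by
    intro a _ b _ hab
    have : t • (a - y) = t • (b - y) := add_left_cancel hab
    have := smul_right_injective _ ht0.ne' this
    simpa using this
  have h := lintegral_image_eq_lintegral_abs_det_fderiv_mul volume hDm hA hinj G
  have hdet : (t • ContinuousLinearMap.id ℝ (Pt d)).det = t ^ d := by
    rw [ContinuousLinearMap.det, ContinuousLinearMap.toLinearMap_smul, LinearMap.det_smul]
    simp
  rw [hdet, abs_of_pos (by positivity), lintegral_const_mul' _ _ (by simp)] at h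
  have hsub : A '' D ⊆ D := by
    rintro _ ⟨x, hx, rfl⟩
    have := hD hy hx (sub_nonneg.2 ht1) ht0.le (by ring)
    convert this using 1
    simp only [A]; module
  have h2 : (2 : ℝ≥0∞) ^ d * ENNReal.ofReal (t ^ d) ≥ 1 := by
    rw [ENNReal.ofReal_pow ht0.le, ← mul_pow]
    refine one_le_pow₀ ?_
    rw [show (2 : ℝ≥0∞) = ENNReal.ofReal 2 by simp, ← ENNReal.ofReal_mul (by norm_num)]
    rw [ENNReal.one_le_ofReal]; linarith
  calc ∫⁻ x in D, G (y + t • (x - y)) = 1 * ∫⁻ x in D, G (A x) := by rw [one_mul]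
    _ ≤ 2 ^ d * ENNReal.ofReal (t ^ d) * ∫⁻ x in D, G (A x) := by gcongr
    _ = 2 ^ d * ∫⁻ x in A '' D, G x := by rw [h, mul_assoc]
    _ ≤ 2 ^ d * ∫⁻ x in D, G x := by gcongr

/-- Poincaré's inequality on a convex set, in the form of a bound for double differences. -/
theorem lintegral_prod_enorm_sub_sq_le {d : ℕ} {D : Set (Pt d)} (hD : Convex ℝ D)
    (hDm : MeasurableSet D) {h : ℝ≥0∞} (hh : ∀ x ∈ D, ∀ y ∈ D, ‖x - y‖ₑ ≤ h) {w : Pt d → ℂ}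
    (hw : ContDiff ℝ 1 w) :
    ∫⁻ p in D ×ˢ D, ‖w p.1 - w p.2‖ₑ ^ 2 ∂(volume.prod volume)
      ≤ h ^ 2 * (2 ^ d * volume D * ∫⁻ x in D, ‖fderiv ℝ w x‖ₑ ^ 2) := by
  set G : Pt d → ℝ≥0∞ := fun x => ‖fderiv ℝ w x‖ₑ ^ 2 with hG
  have hGc : Continuous G :=
    (ENNReal.continuous_pow 2).comp (hw.continuous_fderiv (by simp)).enorm
  have hG3 : Measurable (fun q : (Pt d × Pt d) × ℝ => G (q.1.2 + q.2 • (q.1.1 - q.1.2))) :=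
    (hGc.comp (by fun_prop)).measurable
  have step : ∀ p ∈ D ×ˢ D, ‖w p.1 - w p.2‖ₑ ^ 2
      ≤ h ^ 2 * ∫⁻ t in Ioc (0 : ℝ) 1, G (p.2 + t • (p.1 - p.2)) := by
    intro p hp
    refine (enorm_sub_sq_le_lintegral_segment hw p.1 p.2).trans ?_
    gcongr
    exact hh _ hp.1 _ hp.2
  have slice : ∀ t ∈ Ioc (0 : ℝ) 1,
      ∫⁻ p in D ×ˢ D, G (p.2 + t • (p.1 - p.2)) ∂(volume.prod volume)
        ≤ 2 ^ d * volume D * ∫⁻ x in D, G x := by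
    intro t ht
    have hm : Measurable (fun p : Pt d × Pt d => G (p.2 + t • (p.1 - p.2))) :=
      (hGc.comp (by fun_prop)).measurable
    rw [← Measure.prod_restrict]
    -- For t ≥ 1/2 the point y is frozen and x moves with factor t; otherwise x is frozen and y
    -- moves with factor 1 - t ≥ 1/2. So the Jacobian of the contraction never degenerates.
    by_cases h2 : 1 / 2 ≤ t
    · rw [lintegral_prod_symm' _ hm]
      calc ∫⁻ y in D, ∫⁻ x in D, G (y + t • (x - y))
          ≤ ∫⁻ y in D, 2 ^ d * ∫⁻ x in D, G x := by
            refine setLIntegral_mono' hDm fun y hy => ?_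
            exact setLIntegral_comp_contract_le hD hDm G h2 ht.2 hy
        _ = _ := by rw [setLIntegral_const]; ring
    · rw [lintegral_prod _ hm.aemeasurable]
      calc ∫⁻ x in D, ∫⁻ y in D, G (y + t • (x - y))
          ≤ ∫⁻ x in D, 2 ^ d * ∫⁻ x in D, G x := by
            refine setLIntegral_mono' hDm fun x hx => ?_
            have := setLIntegral_comp_contract_le hD hDm G (t := 1 - t) (by linarith)
              (by linarith [ht.1]) hx
            convert this using 3 with y
            congr 1; module
        _ = _ := by rw [setLIntegral_const]; ring
  calc ∫⁻ p in D ×ˢ D, ‖w p.1 - w p.2‖ₑ ^ 2 ∂(volume.prod volume)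
      ≤ ∫⁻ p in D ×ˢ D, h ^ 2 * (∫⁻ (t : ℝ) in Ioc 0 1, G (p.2 + t • (p.1 - p.2)))
          ∂(volume.prod volume) := setLIntegral_mono' (hDm.prod hDm) step
    _ = h ^ 2 * ∫⁻ p in D ×ˢ D, (∫⁻ (t : ℝ) in Ioc 0 1, G (p.2 + t • (p.1 - p.2)))
          ∂(volume.prod volume) := by
        rw [lintegral_const_mul _ hG3.lintegral_prod_right']
    _ = h ^ 2 * ∫⁻ (t : ℝ) in Ioc 0 1, ∫⁻ p in D ×ˢ D, G (p.2 + t • (p.1 - p.2))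
          ∂(volume.prod volume) := by
        rw [lintegral_lintegral_swap]; exact hG3.aemeasurable
    _ ≤ h ^ 2 * ∫⁻ (t : ℝ) in Ioc 0 1, 2 ^ d * volume D * ∫⁻ x in D, G x := by
        gcongr 1
        exact setLIntegral_mono' measurableSet_Ioc slice
    _ = _ := by simp

theorem enorm_add_sq_le {E : Type*} [NormedAddCommGroup E] (a b : E) :
    ‖a + b‖ₑ ^ 2 ≤ 2 * ‖a‖ₑ ^ 2 + 2 * ‖b‖ₑ ^ 2 := by
  simp only [← ofReal_norm]
  rw [show (2 : ℝ≥0∞) = ENNReal.ofReal 2 by simp, ← ENNReal.ofReal_pow (norm_nonneg _),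
    ← ENNReal.ofReal_pow (norm_nonneg _), ← ENNReal.ofReal_pow (norm_nonneg _),
    ← ENNReal.ofReal_mul (by norm_num), ← ENNReal.ofReal_mul (by norm_num),
    ← ENNReal.ofReal_add (by positivity) (by positivity)]
  refine ENNReal.ofReal_le_ofReal ?_
  have h1 := norm_add_le a b
  nlinarith [norm_nonneg (a + b), norm_nonneg a, norm_nonneg b, sq_nonneg (‖a‖ - ‖b‖)]

theorem continuous_test_deriv_complex {d : ℕ} {φ : Pt d → ℂ} (hφ : ContDiff ℝ ∞ φ) (v : Pt d) :
    Continuous (fun x => fderiv ℝ φ x v) :=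
  (hφ.continuous_fderiv (by simp)).clm_apply continuous_const

theorem enorm_fderiv_sq_le {d : ℕ} (A : Pt d →L[ℝ] ℂ) :
    ‖A‖ₑ ^ 2 ≤ ∑ i, ‖A (EuclideanSpace.single i 1)‖ₑ ^ 2 := by
  simp only [← ofReal_norm, ← ENNReal.ofReal_pow (norm_nonneg _)]
  rw [← ENNReal.ofReal_sum_of_nonneg (fun _ _ => by positivity)]
  refine ENNReal.ofReal_le_ofReal ?_
  set S := ∑ i, ‖A (EuclideanSpace.single i 1)‖ ^ 2
  have hS : 0 ≤ S := by positivity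
  have : ‖A‖ ≤ √S := by
    refine A.opNorm_le_bound (Real.sqrt_nonneg _) fun x => ?_
    have hx : x = ∑ i, x i • EuclideanSpace.single i (1 : ℝ) := by
      ext k; simp [Pi.single_apply]
    calc ‖A x‖ = ‖∑ i, x i • A (EuclideanSpace.single i (1 : ℝ))‖ := by
          conv_lhs => rw [hx]
          simp [map_sum]
      _ ≤ ∑ i, ‖x i‖ * ‖A (EuclideanSpace.single i (1 : ℝ))‖ := by
          refine (norm_sum_le _ _).trans (Finset.sum_le_sum fun i _ => ?_)
          rw [norm_smul]
      _ ≤ √(∑ i, ‖x i‖ ^ 2) * √S := Real.sum_mul_le_sqrt_mul_sqrt _ _ _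
      _ = √S * ‖x‖ := by rw [EuclideanSpace.norm_eq, mul_comm]
  calc ‖A‖ ^ 2 ≤ √S ^ 2 := by gcongr
    _ = S := Real.sq_sqrt hS

theorem lintegral_enorm_add_sq_le {α E : Type*} [MeasurableSpace α] [NormedAddCommGroup E]
    (μ : Measure α) {f g : α → E} (hf : AEStronglyMeasurable f μ) :
    ∫⁻ x, ‖f x + g x‖ₑ ^ 2 ∂μ ≤ 2 * ∫⁻ x, ‖f x‖ₑ ^ 2 ∂μ + 2 * ∫⁻ x, ‖g x‖ₑ ^ 2 ∂μ := by
  rw [← lintegral_const_mul' _ _ (by simp), ← lintegral_const_mul' _ _ (by simp),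
    ← lintegral_add_left' ((hf.enorm.pow_const 2).const_mul _)]
  exact lintegral_mono fun x => enorm_add_sq_le _ _

theorem lintegral_comp_le_of_det {d : ℕ} {F : Pt d → Pt d} {D : Set (Pt d)}
    (hDm : MeasurableSet D) (hF : Differentiable ℝ F) (hinj : InjOn F D) {δ : ℝ} (hδ : 0 < δ)
    (hdet : ∀ x ∈ D, δ ≤ |(fderiv ℝ F x).det|) (f : Pt d → ℝ≥0∞) :
    ∫⁻ x in D, f (F x) ≤ ENNReal.ofReal δ⁻¹ * ∫⁻ x in F '' D, f x := by
  rw [lintegral_image_eq_lintegral_abs_det_fderiv_mul volume hDm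
    (fun x _ => (hF x).hasFDerivAt.hasFDerivWithinAt) hinj, ← lintegral_const_mul' _ _ (by simp)]
  refine setLIntegral_mono' hDm fun x hx => ?_
  rw [← mul_assoc, ← ENNReal.ofReal_mul (by positivity)]
  refine le_mul_of_one_le_left zero_le ?_
  rw [ENNReal.one_le_ofReal]
  calc (1 : ℝ) = δ⁻¹ * δ := by field_simp
    _ ≤ _ := by gcongr; exact hdet x hx

/-- The double difference bound for a pulled back `H¹` function, on a convex set that stays inside
a compact part of the reference domain. -/
theorem IsWeakGradient.lintegral_prod_le_of_compact {d : ℕ} {U : Set (Pt d)} (hU : IsOpen U)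
    {u : Pt d → ℂ} {g : Pt d → EuclideanSpace ℂ (Fin d)} (hug : IsWeakGradient U u g)
    (hu : MemLp u 2 (volume.restrict U)) (hg : MemLp g 2 (volume.restrict U))
    (hum : Measurable u) (hgm : Measurable g)
    {F : Pt d → Pt d} (hF : ContDiff ℝ 1 F) {D C : Set (Pt d)} (hC : IsCompact C)
    (hCU : F '' C ⊆ U) (hDC : D ⊆ C) (hinj : InjOn F D) {δ M : ℝ} (hδ : 0 < δ)
    (hdet : ∀ x ∈ D, δ ≤ |(fderiv ℝ F x).det|) (hFM : ∀ x ∈ D, ‖fderiv ℝ F x‖ ≤ M)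
    (hD : Convex ℝ D) (hDm : MeasurableSet D) {h : ℝ≥0∞} (hh : ∀ x ∈ D, ∀ y ∈ D, ‖x - y‖ₑ ≤ h)
    (hh' : h ≠ ⊤) :
    ∫⁻ p in D ×ˢ D, ‖u (F p.1) - u (F p.2)‖ₑ ^ 2 ∂(volume.prod volume)
      ≤ 4 * h ^ 2 * (2 ^ d * volume D * (ENNReal.ofReal M ^ 2 * (ENNReal.ofReal δ⁻¹ *
        ∑ i, ∫⁻ x in F '' D, ‖g x i‖ₑ ^ 2))) := by
  have hCc : IsCompact (F '' C) := hC.image hF.continuous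
  obtain ⟨w, hw, hwu, hwg⟩ := hug.exists_smooth_approx hU hu hg hCc hCU
  have hFd : Differentiable ℝ F := hF.differentiable (by simp)
  have hFDC : F '' D ⊆ F '' C := image_mono hDC
  have hvD : volume D ≠ ⊤ := ((measure_mono hDC).trans_lt hC.measure_lt_top).ne
  set κ := ENNReal.ofReal δ⁻¹
  set e0 : ℕ → ℝ≥0∞ := fun n => ∫⁻ x in F '' C, ‖w n x - u x‖ₑ ^ 2
  set e1 : Fin d → ℕ → ℝ≥0∞ := fun i n => ∫⁻ x in F '' C,
        ‖fderiv ℝ (w n) x (EuclideanSpace.single i 1) - g x i‖ₑ ^ 2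
  have hgi : ∀ i, Measurable fun x => g x i := fun i =>
    ((EuclideanSpace.proj i : EuclideanSpace ℂ (Fin d) →L[ℂ] ℂ).continuous.measurable).comp hgm
  have main : ∀ n, ∫⁻ p in D ×ˢ D, ‖u (F p.1) - u (F p.2)‖ₑ ^ 2 ∂(volume.prod volume)
      ≤ 2 * (h ^ 2 * (2 ^ d * volume D * (ENNReal.ofReal M ^ 2 * (κ *
        (2 * ∑ i, e1 i n + 2 * ∑ i, ∫⁻ x in F '' D, ‖g x i‖ₑ ^ 2)))))
        + 2 * (4 * (volume D * (κ * e0 n))) := by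
    intro n
    have hwc : Continuous (w n) := (hw n).continuous
    -- Split u ∘ F into the smooth part W, to which Poincaré's inequality applies, and the remainder
    -- E, whose double difference is controlled by its L² norm and disappears in the limit.
    set W : Pt d → ℂ := fun x => w n (F x)
    have hWs : ContDiff ℝ 1 W := ((hw n).of_le (by simp)).comp hF
    set E : Pt d → ℂ := fun x => u (F x) - W x
    have hEm : Measurable E := (hum.comp hF.continuous.measurable).sub hWs.continuous.measurable
    have hE : ∫⁻ x in D, ‖E x‖ₑ ^ 2 ≤ κ * e0 n := by
      calc ∫⁻ x in D, ‖E x‖ₑ ^ 2 = ∫⁻ x in D, (fun z => ‖w n z - u z‖ₑ ^ 2) (F x) := by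
            refine lintegral_congr fun x => ?_
            simp only [E, W]
            rw [enorm_sub_rev]
        _ ≤ κ * ∫⁻ x in F '' D, ‖w n x - u x‖ₑ ^ 2 :=
            lintegral_comp_le_of_det hDm hFd hinj hδ hdet _
        _ ≤ κ * e0 n := by gcongr; exact lintegral_mono_set hFDC
    have hEE : ∫⁻ p in D ×ˢ D, ‖E p.1 - E p.2‖ₑ ^ 2 ∂(volume.prod volume)
        ≤ 4 * (volume D * (κ * e0 n)) := by
      have hm : Measurable fun p : Pt d × Pt d => 2 * ‖E p.1‖ₑ ^ 2 :=
        ((hEm.comp measurable_fst).enorm.pow_const 2).const_mul 2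
      have hm' : Measurable fun p : Pt d × Pt d => 2 * ‖E p.2‖ₑ ^ 2 :=
        ((hEm.comp measurable_snd).enorm.pow_const 2).const_mul 2
      calc ∫⁻ p in D ×ˢ D, ‖E p.1 - E p.2‖ₑ ^ 2 ∂(volume.prod volume)
          ≤ ∫⁻ p in D ×ˢ D, (2 * ‖E p.1‖ₑ ^ 2 + 2 * ‖E p.2‖ₑ ^ 2) ∂(volume.prod volume) := by
            refine lintegral_mono fun p => ?_
            have := enorm_add_sq_le (E p.1) (-E p.2)
            rwa [enorm_neg, ← sub_eq_add_neg] at this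
        _ = 4 * (volume D * ∫⁻ x in D, ‖E x‖ₑ ^ 2) := by
            rw [lintegral_add_left hm, ← Measure.prod_restrict, lintegral_prod _ hm.aemeasurable,
              lintegral_prod_symm' _ hm']
            simp only [lintegral_const, Measure.restrict_apply MeasurableSet.univ, univ_inter]
            rw [lintegral_mul_const' _ _ hvD, lintegral_const_mul' _ _ (by simp)]
            ring
        _ ≤ _ := by gcongr
    have hWW : ∫⁻ p in D ×ˢ D, ‖W p.1 - W p.2‖ₑ ^ 2 ∂(volume.prod volume)
        ≤ h ^ 2 * (2 ^ d * volume D * (ENNReal.ofReal M ^ 2 * (κ *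
        (2 * ∑ i, e1 i n + 2 * ∑ i, ∫⁻ x in F '' D, ‖g x i‖ₑ ^ 2)))) := by
      refine (lintegral_prod_enorm_sub_sq_le hD hDm hh hWs).trans ?_
      gcongr
      calc ∫⁻ x in D, ‖fderiv ℝ W x‖ₑ ^ 2
          ≤ ∫⁻ x in D, ENNReal.ofReal M ^ 2 *
              (fun z => ∑ i, ‖fderiv ℝ (w n) z (EuclideanSpace.single i 1)‖ₑ ^ 2) (F x) := by
            refine setLIntegral_mono' hDm fun x hx => ?_
            have hcomp : fderiv ℝ W x = (fderiv ℝ (w n) (F x)).comp (fderiv ℝ F x) :=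
              fderiv_comp x ((hw n).differentiable (by simp) _) (hFd x)
            rw [hcomp]
            calc ‖(fderiv ℝ (w n) (F x)).comp (fderiv ℝ F x)‖ₑ ^ 2
                ≤ (‖fderiv ℝ (w n) (F x)‖ₑ * ENNReal.ofReal M) ^ 2 := by
                  gcongr
                  rw [← ofReal_norm, ← ofReal_norm,
                    ← ENNReal.ofReal_mul (norm_nonneg _)]
                  refine ENNReal.ofReal_le_ofReal ((ContinuousLinearMap.opNorm_comp_le _ _).trans ?_)
                  gcongr
                  exact hFM x hx
              _ = ENNReal.ofReal M ^ 2 * ‖fderiv ℝ (w n) (F x)‖ₑ ^ 2 := by ring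
              _ ≤ _ := by gcongr; exact enorm_fderiv_sq_le _
        _ = ENNReal.ofReal M ^ 2 * ∫⁻ x in D,
              (fun z => ∑ i, ‖fderiv ℝ (w n) z (EuclideanSpace.single i 1)‖ₑ ^ 2) (F x) :=
            lintegral_const_mul' _ _ (by simp)
        _ ≤ ENNReal.ofReal M ^ 2 * (κ * ∫⁻ x in F '' D,
              ∑ i, ‖fderiv ℝ (w n) x (EuclideanSpace.single i 1)‖ₑ ^ 2) := by
            gcongr
            exact lintegral_comp_le_of_det hDm hFd hinj hδ hdet _
        _ ≤ _ := by
            gcongr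
            have hmi : ∀ i : Fin d, Measurable fun x =>
                fderiv ℝ (w n) x (EuclideanSpace.single i 1) := fun i =>
              (continuous_test_deriv_complex (hw n) _).measurable
            rw [lintegral_finsetSum _ (fun i _ => (hmi i).enorm.pow_const 2), Finset.mul_sum,
              Finset.mul_sum, ← Finset.sum_add_distrib]
            refine Finset.sum_le_sum fun i _ => ?_
            calc ∫⁻ x in F '' D, ‖fderiv ℝ (w n) x (EuclideanSpace.single i 1)‖ₑ ^ 2
                = ∫⁻ x in F '' D,
                  ‖(fderiv ℝ (w n) x (EuclideanSpace.single i 1) - g x i) + g x i‖ₑ ^ 2 := by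
                  simp
              _ ≤ _ := lintegral_enorm_add_sq_le _
                  ((hmi i).sub (hgi i)).aestronglyMeasurable
              _ ≤ _ := by
                  gcongr
                  exact lintegral_mono_set hFDC
    calc ∫⁻ p in D ×ˢ D, ‖u (F p.1) - u (F p.2)‖ₑ ^ 2 ∂(volume.prod volume)
        = ∫⁻ p in D ×ˢ D, ‖(W p.1 - W p.2) + (E p.1 - E p.2)‖ₑ ^ 2 ∂(volume.prod volume) := by
          refine lintegral_congr fun p => ?_
          congr 2; simp only [E, W]; ring
      _ ≤ _ := lintegral_enorm_add_sq_le _ (by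
          exact ((hWs.continuous.comp continuous_fst).sub
            (hWs.continuous.comp continuous_snd)).aestronglyMeasurable)
      _ ≤ _ := by gcongr
  have hlim : Tendsto (fun n => 2 * (h ^ 2 * (2 ^ d * volume D * (ENNReal.ofReal M ^ 2 * (κ *
        (2 * ∑ i, e1 i n + 2 * ∑ i, ∫⁻ x in F '' D, ‖g x i‖ₑ ^ 2)))))
        + 2 * (4 * (volume D * (κ * e0 n)))) atTop
      (𝓝 (2 * (h ^ 2 * (2 ^ d * volume D * (ENNReal.ofReal M ^ 2 * (κ *
        (2 * ∑ i : Fin d, 0 + 2 * ∑ i, ∫⁻ x in F '' D, ‖g x i‖ₑ ^ 2)))))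
        + 2 * (4 * (volume D * (κ * 0))))) := by
    have hsum : Tendsto (fun n => ∑ i, e1 i n) atTop (𝓝 (∑ i : Fin d, 0)) :=
      tendsto_finsetSum _ fun i _ => hwg i
    refine Tendsto.add ?_ ?_
    · refine ENNReal.Tendsto.const_mul (ENNReal.Tendsto.const_mul (ENNReal.Tendsto.const_mul
        (ENNReal.Tendsto.const_mul (ENNReal.Tendsto.const_mul ((ENNReal.Tendsto.const_mul hsum
          (Or.inr (by simp))).add tendsto_const_nhds)
          (Or.inr (by simp [κ]))) (Or.inr (by simp)))
          (Or.inr ?_)) (Or.inr (by simpa using hh'))) (Or.inr (by simp))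
      exact ENNReal.mul_ne_top (by simp) hvD
    · refine ENNReal.Tendsto.const_mul (ENNReal.Tendsto.const_mul (ENNReal.Tendsto.const_mul
        (ENNReal.Tendsto.const_mul hwu (Or.inr (by simp [κ]))) (Or.inr hvD))
          (Or.inr (by simp))) (Or.inr (by simp))
  refine (ge_of_tendsto' hlim main).trans (le_of_eq ?_)
  simp only [Finset.sum_const_zero, mul_zero, zero_add, add_zero]
  ring

/-- The double difference bound for a pulled back `H¹` function on a convex subset of an
exhausted reference domain. -/
theorem IsWeakGradient.lintegral_prod_le {d : ℕ} {U : Set (Pt d)} (hU : IsOpen U)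
    {u : Pt d → ℂ} {g : Pt d → EuclideanSpace ℂ (Fin d)} (hug : IsWeakGradient U u g)
    (hu : MemLp u 2 (volume.restrict U)) (hg : MemLp g 2 (volume.restrict U))
    (hum : Measurable u) (hgm : Measurable g)
    {F : Pt d → Pt d} (hF : ContDiff ℝ 1 F) {D : Set (Pt d)} {C : ℕ → Set (Pt d)}
    (hC : ∀ n, IsCompact (C n)) (hCc : ∀ n, Convex ℝ (C n)) (hCm : Monotone C)
    (hCU : ∀ n, F '' C n ⊆ U) (hDC : D ⊆ ⋃ n, C n) (hinj : InjOn F D) {δ M : ℝ} (hδ : 0 < δ)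
    (hdet : ∀ x ∈ D, δ ≤ |(fderiv ℝ F x).det|) (hFM : ∀ x ∈ D, ‖fderiv ℝ F x‖ ≤ M)
    (hD : Convex ℝ D) (hDm : MeasurableSet D) {h : ℝ≥0∞} (hh : ∀ x ∈ D, ∀ y ∈ D, ‖x - y‖ₑ ≤ h)
    (hh' : h ≠ ⊤) :
    ∫⁻ p in D ×ˢ D, ‖u (F p.1) - u (F p.2)‖ₑ ^ 2 ∂(volume.prod volume)
      ≤ 4 * h ^ 2 * (2 ^ d * volume D * (ENNReal.ofReal M ^ 2 * (ENNReal.ofReal δ⁻¹ *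
        ∑ i, ∫⁻ x in F '' D, ‖g x i‖ₑ ^ 2))) := by
  -- Smooth approximation works on compact sets only, but the bound is uniform along the exhaustion,
  -- so it passes to the increasing union.
  have hun : D ×ˢ D = ⋃ n, (D ∩ C n) ×ˢ (D ∩ C n) := by
    ext p
    simp only [mem_prod, mem_iUnion, mem_inter_iff]
    constructor
    · rintro ⟨h1, h2⟩
      obtain ⟨n, hn⟩ := mem_iUnion.1 (hDC h1)
      obtain ⟨m, hm⟩ := mem_iUnion.1 (hDC h2)
      exact ⟨max n m, ⟨h1, hCm (le_max_left _ _) hn⟩, ⟨h2, hCm (le_max_right _ _) hm⟩⟩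
    · rintro ⟨n, ⟨h1, _⟩, ⟨h2, _⟩⟩
      exact ⟨h1, h2⟩
  have hmono : Monotone fun n => (D ∩ C n) ×ˢ (D ∩ C n) := fun n m hnm =>
    prod_mono (inter_subset_inter_right _ (hCm hnm)) (inter_subset_inter_right _ (hCm hnm))
  rw [hun, setLIntegral_iUnion_of_directed _ hmono.directed_le]
  refine iSup_le fun n => ?_
  have hs : D ∩ C n ⊆ D := inter_subset_left
  refine (hug.lintegral_prod_le_of_compact hU hu hg hum hgm hF (hC n) (hCU n) inter_subset_right
    (hinj.mono hs) hδ (fun x hx => hdet x hx.1) (fun x hx => hFM x hx.1) (hD.inter (hCc n))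
    (hDm.inter (hC n).measurableSet) (fun x hx y hy => hh x hx.1 y hy.1) hh').trans ?_
  gcongr

/-- The total mass times f(x) is the integral of f plus the integral of f(x) - f(y) over y. Squaring
and integrating over x turns a bound on double differences into control of f by its average. -/
theorem measure_mul_lintegral_enorm_sq_le {α : Type*} [MeasurableSpace α] (ν : Measure α)
    [IsFiniteMeasure ν] {f : α → ℂ} (hf : Measurable f) (hi : Integrable f ν) :
    ν univ * ∫⁻ x, ‖f x‖ₑ ^ 2 ∂ν
      ≤ 2 * ‖∫ x, f x ∂ν‖ₑ ^ 2 + 2 * ∫⁻ p, ‖f p.1 - f p.2‖ₑ ^ 2 ∂(ν.prod ν) := by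
  by_cases h0 : ν univ = 0
  · simp [h0]
  have hfin : ν univ ≠ ⊤ := measure_ne_top _ _
  have hm : Measurable fun p : α × α => ‖f p.1 - f p.2‖ₑ ^ 2 :=
    ((hf.comp measurable_fst).sub (hf.comp measurable_snd)).enorm.pow_const 2
  have hpt : ∀ x, ν univ ^ 2 * ‖f x‖ₑ ^ 2
      ≤ 2 * ‖∫ y, f y ∂ν‖ₑ ^ 2 + 2 * (ν univ * ∫⁻ y, ‖f x - f y‖ₑ ^ 2 ∂ν) := by
    intro x
    have e : (ν.real univ : ℂ) * f x = (∫ y, f y ∂ν) + ∫ y, (f x - f y) ∂ν := by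
      rw [integral_sub (integrable_const _) hi]
      simp
    calc ν univ ^ 2 * ‖f x‖ₑ ^ 2 = ‖(ν.real univ : ℂ) * f x‖ₑ ^ 2 := by
          rw [enorm_mul, mul_pow]
          congr 2
          rw [← ofReal_norm, Complex.norm_real, Real.norm_of_nonneg measureReal_nonneg,
            Measure.real, ENNReal.ofReal_toReal hfin]
      _ ≤ 2 * ‖∫ y, f y ∂ν‖ₑ ^ 2 + 2 * ‖∫ y, (f x - f y) ∂ν‖ₑ ^ 2 := by
          rw [e]; exact enorm_add_sq_le _ _
      _ ≤ _ := by
          gcongr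
          calc ‖∫ y, (f x - f y) ∂ν‖ₑ ^ 2 ≤ (∫⁻ y, ‖f x - f y‖ₑ ∂ν) ^ 2 := by
                gcongr; exact enorm_integral_le_lintegral_enorm _
            _ ≤ _ := sq_lintegral_le _ (measurable_const.sub hf).enorm.aemeasurable
  have hint : ν univ ^ 2 * ∫⁻ x, ‖f x‖ₑ ^ 2 ∂ν
      ≤ ν univ * (2 * ‖∫ x, f x ∂ν‖ₑ ^ 2 + 2 * ∫⁻ p, ‖f p.1 - f p.2‖ₑ ^ 2 ∂(ν.prod ν)) := by
    rw [← lintegral_const_mul' _ _ (by simp)]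
    refine (lintegral_mono hpt).trans (le_of_eq ?_)
    rw [lintegral_add_left measurable_const, lintegral_const, lintegral_const_mul' _ _ (by simp),
      lintegral_const_mul' _ _ hfin, lintegral_prod _ hm.aemeasurable]
    ring
  rw [sq, mul_assoc] at hint
  exact (ENNReal.mul_le_mul_iff_right h0 hfin).1 hint

/-! ### Reference elements: shape functions, geometry, compact convex exhaustion. -/

theorem RefCell.contDiff_shape {d : ℕ} (k : RefCell) (v : k.Vertex d) :
    ContDiff ℝ ∞ (k.shape d v) := by
  have hc : ∀ i : Fin d, ContDiff ℝ ∞ (fun x : Pt d => x i) := fun i => by fun_prop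
  match k, v with
  | .simplex, none => exact contDiff_const.sub (ContDiff.sum fun i _ => hc i)
  | .simplex, some i => exact hc i
  | .cube, b =>
    change ContDiff ℝ ∞ (fun x : Pt d => ∏ i, if (b i : Bool) = true then x i else 1 - x i)
    refine contDiff_prod fun i _ => ?_
    split_ifs
    · exact hc i
    · exact contDiff_const.sub (hc i)

theorem RefCell.sum_shape {d : ℕ} (k : RefCell) (x : Pt d) : ∑ v, k.shape d v x = 1 := by
  match k with
  | .simplex =>
    change ∑ v : Option (Fin d), RefCell.shape d .simplex v x = 1
    rw [Fintype.sum_option]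
    simp [RefCell.shape]
  | .cube =>
    change ∑ b : Fin d → Bool, ∏ i, (if b i = true then x i else 1 - x i) = 1
    rw [← Fintype.prod_sum (fun i (b : Bool) => if b = true then x i else 1 - x i)]
    simp

theorem RefCell.shape_nonneg {d : ℕ} (k : RefCell) (v : k.Vertex d) {x : Pt d}
    (hx : x ∈ k.closedRef d) : 0 ≤ k.shape d v x := by
  match k, v, hx with
  | .simplex, none, hx => exact sub_nonneg.2 hx.2
  | .simplex, some i, hx => exact hx.1 i
  | .cube, b, hx =>
    refine Finset.prod_nonneg fun i _ => ?_
    have := hx i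
    split_ifs <;> linarith

-- The abstract vertices are realised by points of the closed reference element. This is what places
-- the vertices of a mesh element on that element.
open Classical in
theorem RefCell.exists_vertex {d : ℕ} (k : RefCell) (v : k.Vertex d) :
    ∃ y ∈ k.closedRef d, ∀ v', k.shape d v' y = if v' = v then 1 else 0 := by
  match k, v with
  | .simplex, none =>
    refine ⟨0, ⟨fun i => by simp, by simp⟩, fun v' => ?_⟩
    match v' with
    | none => simp [RefCell.shape]; rfl
    | some j => simp [RefCell.shape]
  | .simplex, some i =>
    refine ⟨EuclideanSpace.single i 1, ⟨fun j => ?_, by simp⟩, fun v' => ?_⟩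
    · by_cases h : j = i <;> simp [h]
    match v' with
    | none => simp [RefCell.shape]
    | some j =>
      simp only [RefCell.shape, PiLp.single_apply]
      exact if_congr (Option.some_inj (a := j) (b := i)).symm rfl rfl
  | .cube, b =>
    refine ⟨WithLp.toLp 2 (fun i => if (b i : Bool) = true then 1 else 0), fun i => ?_, fun v' => ?_⟩
    · by_cases h : (b i : Bool) = true <;> simp [h]
    · split_ifs with h
      · subst h
        refine Finset.prod_eq_one fun i _ => ?_
        by_cases h : (v' i : Bool) = true <;> simp [h]
      · obtain ⟨i, hi⟩ := Function.ne_iff.1 h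
        refine Finset.prod_eq_zero (Finset.mem_univ i) ?_
        by_cases h : (b i : Bool) = true <;> by_cases h' : (v' i : Bool) = true <;> simp_all

/-- The assumption d ≤ 3 is needed for this count alone, which fixes the constant in the bound on
gradients of cutoff functions. -/
theorem RefCell.card_vertex_le {d : ℕ} (hd : d ≤ 3) (k : RefCell) :
    Fintype.card (k.Vertex d) ≤ 8 := by
  match k with
  | .simplex =>
    change Fintype.card (Option (Fin d)) ≤ 8
    simp; omega
  | .cube =>
    change Fintype.card (Fin d → Bool) ≤ 8
    simp only [Fintype.card_pi, Fintype.card_bool, Finset.prod_const, Finset.card_univ,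
      Fintype.card_fin]
    calc 2 ^ d ≤ 2 ^ 3 := Nat.pow_le_pow_right (by norm_num) hd
      _ = 8 := by norm_num

theorem RefCell.convex_closedRef {d : ℕ} (k : RefCell) : Convex ℝ (k.closedRef d) := by
  intro x hx y hy a b ha hb hab
  match k, hx, hy with
  | .simplex, hx, hy =>
    refine ⟨fun i => ?_, ?_⟩
    · have := hx.1 i; have := hy.1 i
      simp only [PiLp.add_apply, PiLp.smul_apply, smul_eq_mul]; positivity
    · have h1 := hx.2; have h2 := hy.2
      simp only [PiLp.add_apply, PiLp.smul_apply, smul_eq_mul, Finset.sum_add_distrib,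
        ← Finset.mul_sum]
      nlinarith
  | .cube, hx, hy =>
    intro i
    have h1 := hx i; have h2 := hy i
    simp only [PiLp.add_apply, PiLp.smul_apply, smul_eq_mul]
    constructor <;> nlinarith

theorem RefCell.convex_openRef {d : ℕ} (k : RefCell) : Convex ℝ (k.openRef d) := by
  have key : ∀ {a b s t : ℝ}, 0 ≤ a → 0 ≤ b → a + b = 1 → 0 < s → 0 < t → 0 < a * s + b * t := by
    intro a b s t ha hb hab hs ht
    rcases ha.eq_or_lt with h | h
    · have : b = 1 := by linarith
      simp [← h, this, ht]
    · have := mul_pos h hs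
      positivity
  intro x hx y hy a b ha hb hab
  match k, hx, hy with
  | .simplex, hx, hy =>
    refine ⟨fun i => ?_, ?_⟩
    · simp only [PiLp.add_apply, PiLp.smul_apply, smul_eq_mul]
      exact key ha hb hab (hx.1 i) (hy.1 i)
    · have := key ha hb hab (sub_pos.2 hx.2) (sub_pos.2 hy.2)
      simp only [PiLp.add_apply, PiLp.smul_apply, smul_eq_mul, Finset.sum_add_distrib,
        ← Finset.mul_sum]
      linarith
  | .cube, hx, hy =>
    intro i
    simp only [PiLp.add_apply, PiLp.smul_apply, smul_eq_mul]
    have h1 := key ha hb hab (sub_pos.2 (hx i).2) (sub_pos.2 (hy i).2)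
    exact ⟨key ha hb hab (hx i).1 (hy i).1, by linarith⟩

theorem RefCell.openRef_subset {d : ℕ} (k : RefCell) : k.openRef d ⊆ k.closedRef d := by
  intro x hx
  match k, hx with
  | .simplex, hx => exact ⟨fun i => (hx.1 i).le, hx.2.le⟩
  | .cube, hx => exact fun i => ⟨(hx i).1.le, (hx i).2.le⟩

theorem RefCell.closedRef_coord {d : ℕ} (k : RefCell) {x : Pt d} (hx : x ∈ k.closedRef d)
    (i : Fin d) : 0 ≤ x i ∧ x i ≤ 1 := by
  match k, hx with
  | .simplex, hx =>
    exact ⟨hx.1 i, (Finset.single_le_sum (fun j _ => hx.1 j) (Finset.mem_univ i)).trans hx.2⟩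
  | .cube, hx => exact hx i

theorem RefCell.openRef_coord {d : ℕ} (k : RefCell) {x : Pt d} (hx : x ∈ k.openRef d)
    (i : Fin d) : 0 < x i ∧ x i < 1 := by
  match k, hx with
  | .simplex, hx =>
    exact ⟨hx.1 i, (Finset.single_le_sum (fun j _ => (hx.1 j).le) (Finset.mem_univ i)).trans_lt
      hx.2⟩
  | .cube, hx => exact hx i

theorem isBounded_of_coord {d : ℕ} {s : Set (Pt d)} (hs : ∀ x ∈ s, ∀ i, 0 ≤ x i ∧ x i ≤ 1) :
    Bornology.IsBounded s := by
  refine (Metric.isBounded_closedBall (x := (0 : Pt d)) (r := √d)).subset fun x hx => ?_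
  rw [mem_closedBall_zero_iff, EuclideanSpace.norm_eq]
  refine Real.sqrt_le_sqrt ?_
  calc ∑ i, ‖x i‖ ^ 2 ≤ ∑ i : Fin d, (1 : ℝ) := by
        refine Finset.sum_le_sum fun i _ => ?_
        obtain ⟨h0, h1⟩ := hs x hx i
        rw [Real.norm_of_nonneg h0]
        exact pow_le_one₀ h0 h1
    _ = d := by simp

theorem RefCell.isClosed_closedRef {d : ℕ} (k : RefCell) : IsClosed (k.closedRef d) := by
  match k with
  | .simplex =>
    have : RefCell.closedRef d .simplex
        = (⋂ i, {x : Pt d | 0 ≤ x i}) ∩ {x : Pt d | ∑ i, x i ≤ 1} := by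
      ext x; simp [RefCell.closedRef]
    rw [this]
    exact (isClosed_iInter fun i => isClosed_le (by fun_prop) (by fun_prop)).inter
      (isClosed_le (by fun_prop) (by fun_prop))
  | .cube =>
    have : RefCell.closedRef d .cube = ⋂ i, ({x : Pt d | 0 ≤ x i} ∩ {x : Pt d | x i ≤ 1}) := by
      ext x; simp [RefCell.closedRef]
    rw [this]
    exact isClosed_iInter fun i => (isClosed_le (by fun_prop) (by fun_prop)).inter
      (isClosed_le (by fun_prop) (by fun_prop))

theorem RefCell.isCompact_closedRef {d : ℕ} (k : RefCell) : IsCompact (k.closedRef d) :=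
  Metric.isCompact_of_isClosed_isBounded k.isClosed_closedRef
    (isBounded_of_coord fun _ hx => k.closedRef_coord hx)

theorem RefCell.isOpen_openRef {d : ℕ} (k : RefCell) : IsOpen (k.openRef d) := by
  match k with
  | .simplex =>
    have : RefCell.openRef d .simplex
        = (⋂ i, {x : Pt d | 0 < x i}) ∩ {x : Pt d | ∑ i, x i < 1} := by
      ext x; simp [RefCell.openRef]
    rw [this]
    exact (isOpen_iInter_of_finite fun i => isOpen_lt (by fun_prop) (by fun_prop)).inter
      (isOpen_lt (by fun_prop) (by fun_prop))
  | .cube =>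
    have : RefCell.openRef d .cube = ⋂ i, ({x : Pt d | 0 < x i} ∩ {x : Pt d | x i < 1}) := by
      ext x; simp [RefCell.openRef]
    rw [this]
    exact isOpen_iInter_of_finite fun i => (isOpen_lt (by fun_prop) (by fun_prop)).inter
      (isOpen_lt (by fun_prop) (by fun_prop))

/-- An interior point can be moved by ±t along each axis without leaving the closed element, so
every defining inequality is strict there. -/
theorem RefCell.interior_closedRef_subset {d : ℕ} (k : RefCell) :
    interior (k.closedRef d) ⊆ k.openRef d := by
  intro x hx
  have hnear : ∃ t : ℝ, 0 < t ∧ ∀ i, x + t • EuclideanSpace.single i 1 ∈ k.closedRef d ∧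
      x - t • EuclideanSpace.single i 1 ∈ k.closedRef d := by
    obtain ⟨r, hr, hb⟩ := Metric.isOpen_iff.1 isOpen_interior x hx
    refine ⟨r / 2, by positivity, fun i => ⟨interior_subset (hb ?_), interior_subset (hb ?_)⟩⟩
    all_goals
      rw [Metric.mem_ball, dist_eq_norm]
      simp [norm_smul, abs_of_pos hr]
      linarith
  obtain ⟨t, ht, hn⟩ := hnear
  have hi : ∀ i, 0 < x i ∧ x i < 1 := fun i => by
    have h1 := (k.closedRef_coord (hn i).1 i).2
    have h2 := (k.closedRef_coord (hn i).2 i).1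
    simp at h1 h2
    constructor <;> linarith
  match k, hn with
  | .simplex, hn =>
    refine ⟨fun i => (hi i).1, ?_⟩
    -- Strictness of the sum condition needs one direction to move in. In dimension zero there is
    -- none, but the sum is empty.
    rcases isEmpty_or_nonempty (Fin d) with he | ⟨⟨i⟩⟩
    · simp
    · have := (hn i).1.2
      simp [Finset.sum_add_distrib] at this
      linarith
  | .cube, hn => exact hi

/-- The frontier of a convex set is a null set. -/
theorem RefCell.volume_closedRef_diff {d : ℕ} (k : RefCell) :
    volume (k.closedRef d \ k.openRef d) = 0 := by
  refine measure_mono_null (fun x hx => ?_) (k.convex_closedRef.addHaar_frontier volume)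
  exact ⟨subset_closure hx.1, fun h => hx.2 (k.interior_closedRef_subset h)⟩

/-- A compact convex exhaustion of the open reference element. -/
def RefCell.shrunk (d : ℕ) (n : ℕ) : RefCell → Set (Pt d)
  | .simplex => {x | (∀ i, 1 / ((n : ℝ) + 1) ≤ x i) ∧ ∑ i, x i ≤ 1 - 1 / ((n : ℝ) + 1)}
  | .cube => {x | ∀ i, 1 / ((n : ℝ) + 1) ≤ x i ∧ x i ≤ 1 - 1 / ((n : ℝ) + 1)}

theorem RefCell.shrunk_subset {d : ℕ} (k : RefCell) (n : ℕ) : k.shrunk d n ⊆ k.openRef d := by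
  intro x hx
  have hp : (0 : ℝ) < 1 / ((n : ℝ) + 1) := by positivity
  match k, hx with
  | .simplex, hx => exact ⟨fun i => hp.trans_le (hx.1 i), by linarith [hx.2]⟩
  | .cube, hx => exact fun i => ⟨hp.trans_le (hx i).1, by linarith [(hx i).2]⟩

theorem RefCell.isCompact_shrunk {d : ℕ} (k : RefCell) (n : ℕ) : IsCompact (k.shrunk d n) := by
  refine k.isCompact_closedRef.of_isClosed_subset ?_
    ((k.shrunk_subset n).trans k.openRef_subset)
  match k with
  | .simplex =>
    have : RefCell.shrunk d n .simplex = (⋂ i, {x : Pt d | 1 / ((n : ℝ) + 1) ≤ x i})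
        ∩ {x : Pt d | ∑ i, x i ≤ 1 - 1 / ((n : ℝ) + 1)} := by
      ext x; simp [RefCell.shrunk]
    rw [this]
    exact (isClosed_iInter fun i => isClosed_le (by fun_prop) (by fun_prop)).inter
      (isClosed_le (by fun_prop) (by fun_prop))
  | .cube =>
    have : RefCell.shrunk d n .cube = ⋂ i, ({x : Pt d | 1 / ((n : ℝ) + 1) ≤ x i}
        ∩ {x : Pt d | x i ≤ 1 - 1 / ((n : ℝ) + 1)}) := by
      ext x; simp [RefCell.shrunk]
    rw [this]
    exact isClosed_iInter fun i => (isClosed_le (by fun_prop) (by fun_prop)).inter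
      (isClosed_le (by fun_prop) (by fun_prop))

theorem RefCell.convex_shrunk {d : ℕ} (k : RefCell) (n : ℕ) : Convex ℝ (k.shrunk d n) := by
  intro x hx y hy a b ha hb hab
  match k, hx, hy with
  | .simplex, hx, hy =>
    simp only [RefCell.shrunk, mem_ofPred_eq] at hx hy ⊢
    generalize 1 / ((n : ℝ) + 1) = c at hx hy ⊢
    have hc : c = a * c + b * c := by rw [← add_mul, hab, one_mul]
    refine ⟨fun i => ?_, ?_⟩
    · have h1 := hx.1 i; have h2 := hy.1 i
      simp only [PiLp.add_apply, PiLp.smul_apply, smul_eq_mul]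
      nlinarith [mul_le_mul_of_nonneg_left h1 ha, mul_le_mul_of_nonneg_left h2 hb]
    · have h1 := hx.2; have h2 := hy.2
      simp only [PiLp.add_apply, PiLp.smul_apply, smul_eq_mul, Finset.sum_add_distrib,
        ← Finset.mul_sum]
      nlinarith [mul_le_mul_of_nonneg_left h1 ha, mul_le_mul_of_nonneg_left h2 hb]
  | .cube, hx, hy =>
    intro i
    have h1 := hx i; have h2 := hy i
    simp only [PiLp.add_apply, PiLp.smul_apply, smul_eq_mul]
    constructor <;> nlinarith

theorem RefCell.monotone_shrunk {d : ℕ} (k : RefCell) : Monotone fun n => k.shrunk d n := by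
  intro n m hnm x hx
  have h : 1 / ((m : ℝ) + 1) ≤ 1 / ((n : ℝ) + 1) := by
    apply one_div_le_one_div_of_le (by positivity); gcongr
  match k, hx with
  | .simplex, hx => exact ⟨fun i => h.trans (hx.1 i), by linarith [hx.2]⟩
  | .cube, hx => exact fun i => ⟨h.trans (hx i).1, by linarith [(hx i).2]⟩

theorem RefCell.openRef_subset_iUnion_shrunk {d : ℕ} (k : RefCell) :
    k.openRef d ⊆ ⋃ n, k.shrunk d n := by
  intro x hx
  have ev : ∀ c : ℝ, 0 < c → ∀ᶠ n : ℕ in atTop, 1 / ((n : ℝ) + 1) ≤ c := fun c hc =>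
    (tendsto_one_div_add_atTop_nhds_zero_nat.eventually (gt_mem_nhds hc)).mono fun _ h => h.le
  have : ∀ᶠ n : ℕ in atTop, x ∈ k.shrunk d n := by
    match k, hx with
    | .simplex, hx =>
      filter_upwards [eventually_all.2 fun i => ev (x i) (hx.1 i),
        ev _ (sub_pos.2 hx.2)] with n h1 h2
      exact ⟨h1, by linarith⟩
    | .cube, hx =>
      filter_upwards [eventually_all.2 fun i => ev (x i) (hx i).1,
        eventually_all.2 fun i => ev _ (sub_pos.2 (hx i).2)] with n h1 h2
      exact fun i => ⟨h1 i, by linarith [h2 i]⟩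
  obtain ⟨n, hn⟩ := this.exists
  exact mem_iUnion.2 ⟨n, hn⟩

/-- An injective local diffeomorphism has a Lipschitz inverse on compact sets. -/
theorem exists_antilipschitz_of_injOn {d : ℕ} {F : Pt d → Pt d} {R : Set (Pt d)}
    (hR : IsCompact R) (hF : ContDiff ℝ 1 F) (hinj : InjOn F R)
    (hdet : ∀ x ∈ R, (fderiv ℝ F x).det ≠ 0) :
    ∃ c : ℝ, 0 ≤ c ∧ ∀ x ∈ R, ∀ y ∈ R, ‖x - y‖ ≤ c * ‖F x - F y‖ := by
  have key : ∃ c : ℝ, 0 ≤ c ∧ ∀ p ∈ R ×ˢ R, ‖p.1 - p.2‖ ≤ c * ‖F p.1 - F p.2‖ := by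
    -- Having some constant is a local property on the compact set R × R. Near the diagonal it
    -- follows from strict differentiability and the invertible derivative; away from it,
    -- injectivity keeps ‖F x - F y‖ bounded below. Neither R nor its image has to be convex.
    refine (hR.prod hR).induction_on
      (p := fun s => ∃ c : ℝ, 0 ≤ c ∧ ∀ p ∈ s, ‖p.1 - p.2‖ ≤ c * ‖F p.1 - F p.2‖) ?_ ?_ ?_ ?_
    · exact ⟨0, le_rfl, by simp⟩
    · rintro s t hst ⟨c, hc, h⟩
      exact ⟨c, hc, fun p hp => h p (hst hp)⟩
    · rintro s t ⟨c, hc, h⟩ ⟨c', hc', h'⟩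
      refine ⟨max c c', le_max_of_le_left hc, fun p hp => ?_⟩
      rcases hp with hp | hp
      · exact (h p hp).trans (by gcongr; exact le_max_left _ _)
      · exact (h' p hp).trans (by gcongr; exact le_max_right _ _)
    · rintro ⟨x, y⟩ ⟨hx, hy⟩
      simp only at hx hy
      by_cases hxy : x = y
      · subst hxy
        have hstrict : HasStrictFDerivAt F (fderiv ℝ F x) x :=
          hF.contDiffAt.hasStrictFDerivAt (by simp)
        set e := ContinuousLinearMap.toContinuousLinearEquivOfDetNeZero _ (hdet x hx)
        have he : ∀ v, e v = fderiv ℝ F x v := fun v => rfl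
        set c : ℝ := ‖(e.symm : Pt d →L[ℝ] Pt d)‖ + 1
        have hc : 0 < c := by positivity
        have hev : ∀ v, ‖v‖ ≤ c * ‖fderiv ℝ F x v‖ := by
          intro v
          have h1 := (e.symm : Pt d →L[ℝ] Pt d).le_opNorm (e v)
          simp only [ContinuousLinearEquiv.coe_coe, ContinuousLinearEquiv.symm_apply_apply] at h1
          rw [he] at h1
          refine h1.trans ?_
          gcongr
          simp [c]
        -- With this linearisation error the lower bound for the derivative loses at most half of ‖x
        -- - y‖, which gives the constant 2c.
        have hlo := hstrict.isLittleO.def (c := 1 / (2 * c)) (by positivity)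
        refine ⟨_, mem_nhdsWithin_of_mem_nhds hlo, 2 * c, by positivity, fun p hp => ?_⟩
        have hp' : ‖F p.1 - F p.2 - fderiv ℝ F x (p.1 - p.2)‖ ≤ 1 / (2 * c) * ‖p.1 - p.2‖ := hp
        have h2 := hev (p.1 - p.2)
        have h3 : ‖fderiv ℝ F x (p.1 - p.2)‖
            ≤ ‖F p.1 - F p.2‖ + 1 / (2 * c) * ‖p.1 - p.2‖ := by
          have := norm_sub_le (F p.1 - F p.2) (F p.1 - F p.2 - fderiv ℝ F x (p.1 - p.2))
          rw [sub_sub_cancel] at this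
          linarith
        have h4 : c * (1 / (2 * c) * ‖p.1 - p.2‖) = ‖p.1 - p.2‖ / 2 := by field_simp
        nlinarith
      · have hne : F x - F y ≠ 0 := sub_ne_zero.2 fun h => hxy (hinj hx hy h)
        have hFc := hF.continuous
        set c : ℝ := (‖x - y‖ + 1) / (‖F x - F y‖ / 2)
        have hpos : 0 < ‖F x - F y‖ := norm_pos_iff.2 hne
        have h1 : ∀ᶠ p : Pt d × Pt d in 𝓝 (x, y), ‖F x - F y‖ / 2 < ‖F p.1 - F p.2‖ := by
          have : ContinuousAt (fun p : Pt d × Pt d => ‖F p.1 - F p.2‖) (x, y) := by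
            apply Continuous.continuousAt; fun_prop
          exact this.eventually (lt_mem_nhds (by simp only; linarith))
        have h2 : ∀ᶠ p : Pt d × Pt d in 𝓝 (x, y), ‖p.1 - p.2‖ < ‖x - y‖ + 1 := by
          have : ContinuousAt (fun p : Pt d × Pt d => ‖p.1 - p.2‖) (x, y) := by
            apply Continuous.continuousAt; fun_prop
          exact this.eventually (gt_mem_nhds (by simp only; linarith))
        refine ⟨_, mem_nhdsWithin_of_mem_nhds (h1.and h2), c, by positivity, ?_⟩
        rintro p ⟨hp1, hp2⟩
        calc ‖p.1 - p.2‖ ≤ ‖x - y‖ + 1 := hp2.le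
          _ = c * (‖F x - F y‖ / 2) := by simp only [c]; field_simp
          _ ≤ c * ‖F p.1 - F p.2‖ := by gcongr
  obtain ⟨c, hc, h⟩ := key
  exact ⟨c, hc, fun x hx y hy => h (x, y) ⟨hx, hy⟩⟩

theorem contDiff_refMap {d : ℕ} (k : RefCell) (p : k.Vertex d → Pt d) :
    ContDiff ℝ ∞ (refMap k p) := by
  unfold refMap
  exact ContDiff.sum fun v _ => (k.contDiff_shape v).smul contDiff_const

/-! ### Isoparametric maps, their inverses, and the Lagrange basis on an element. -/

namespace Cell

variable {d : ℕ} (K : Cell d)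

/-- The isoparametric map of the element. -/
def chart : Pt d → Pt d := refMap K.kind K.vertex

theorem contDiff_chart : ContDiff ℝ ∞ K.chart := contDiff_refMap _ _

theorem exists_le_abs_det :
    ∃ δ : ℝ, 0 < δ ∧ ∀ x ∈ K.kind.closedRef d, δ ≤ |(fderiv ℝ K.chart x).det| := by
  have hc : ContinuousOn (fun x => |(fderiv ℝ K.chart x).det|) (K.kind.closedRef d) :=
    (continuous_abs.comp (ContinuousLinearMap.continuous_det.comp
      (K.contDiff_chart.continuous_fderiv (by simp)))).continuousOn
  rcases (K.kind.closedRef d).eq_empty_or_nonempty with he | hne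
  · exact ⟨1, one_pos, by simp [he]⟩
  · obtain ⟨x, hx, hmin⟩ := K.kind.isCompact_closedRef.exists_isMinOn hne hc
    exact ⟨_, abs_pos.2 (K.det_ne_zero x hx), fun y hy => hmin hy⟩

theorem exists_norm_fderiv_chart_le :
    ∃ M : ℝ, 0 ≤ M ∧ ∀ x ∈ K.kind.closedRef d, ‖fderiv ℝ K.chart x‖ ≤ M := by
  obtain ⟨M, hM⟩ := (K.kind.isCompact_closedRef (d := d)).exists_bound_of_continuousOn
    (K.contDiff_chart.continuous_fderiv (by simp)).continuousOn
  exact ⟨max M 0, le_max_right _ _, fun x hx => (hM x hx).trans (le_max_left _ _)⟩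

theorem exists_abs_det_le :
    ∃ M : ℝ, ∀ x ∈ K.kind.closedRef d, |(fderiv ℝ K.chart x).det| ≤ M := by
  obtain ⟨M, hM⟩ := (K.kind.isCompact_closedRef (d := d)).exists_bound_of_continuousOn
    (ContinuousLinearMap.continuous_det.comp
      (K.contDiff_chart.continuous_fderiv (by simp))).continuousOn
  exact ⟨M, hM⟩

theorem isOpen_openSet : IsOpen K.openSet := by
  rw [isOpen_iff_mem_nhds]
  rintro _ ⟨y, hy, rfl⟩
  have hdet := K.det_ne_zero y (K.kind.openRef_subset hy)
  have hs : HasStrictFDerivAt (refMap K.kind K.vertex) (fderiv ℝ (refMap K.kind K.vertex) y) y :=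
    (contDiff_refMap K.kind K.vertex).contDiffAt.hasStrictFDerivAt (by simp)
  have := HasStrictFDerivAt.map_nhds_eq_of_equiv
    (f' := ContinuousLinearMap.toContinuousLinearEquivOfDetNeZero _ hdet) hs
  rw [← this]
  exact image_mem_map (K.kind.isOpen_openRef.mem_nhds hy)

theorem openSet_subset_closedSet : K.openSet ⊆ K.closedSet := image_mono K.kind.openRef_subset

theorem isCompact_closedSet : IsCompact K.closedSet :=
  K.kind.isCompact_closedRef.image (contDiff_refMap _ _).continuous

/-- The difference is covered by the image of the boundary of the reference element, a null set, and
differentiable maps preserve null sets. -/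
theorem volume_closedSet_diff : volume (K.closedSet \ K.openSet) = 0 := by
  have h : K.closedSet \ K.openSet ⊆
      refMap K.kind K.vertex '' (K.kind.closedRef d \ K.kind.openRef d) := by
    rintro _ ⟨⟨y, hy, rfl⟩, h⟩
    exact ⟨y, ⟨hy, fun h' => h ⟨y, h', rfl⟩⟩, rfl⟩
  refine measure_mono_null h ?_
  exact addHaar_image_eq_zero_of_differentiableOn_of_addHaar_eq_zero volume
    ((contDiff_refMap _ _).differentiable (by simp)).differentiableOn K.kind.volume_closedRef_diff

/-- The inverse of the isoparametric map. -/
def inv (x : Pt d) : Pt d :=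
  Function.invFunOn (refMap K.kind K.vertex) (K.kind.closedRef d) x

theorem inv_mem {x : Pt d} (hx : x ∈ K.closedSet) : K.inv x ∈ K.kind.closedRef d :=
  Function.invFunOn_mem hx

theorem chart_inv {x : Pt d} (hx : x ∈ K.closedSet) : K.chart (K.inv x) = x :=
  Function.invFunOn_eq hx

theorem lagrange_nonneg (v : K.kind.Vertex d) {x : Pt d} (hx : x ∈ K.closedSet) :
    0 ≤ K.lagrange v x := K.kind.shape_nonneg v (K.inv_mem hx)

theorem sum_lagrange (x : Pt d) : ∑ v, K.lagrange v x = 1 := K.kind.sum_shape _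

theorem vertex_mem (v : K.kind.Vertex d) : K.vertex v ∈ K.closedSet := by
  classical
  obtain ⟨y, hy, h⟩ := K.kind.exists_vertex v
  refine ⟨y, hy, ?_⟩
  simp [refMap, h]

theorem exists_inv_lipschitz :
    ∃ c : ℝ, 0 ≤ c ∧ ∀ x ∈ K.closedSet, ∀ y ∈ K.closedSet, ‖K.inv x - K.inv y‖ ≤ c * ‖x - y‖ := by
  obtain ⟨c, hc, h⟩ := exists_antilipschitz_of_injOn K.kind.isCompact_closedRef
    (K.contDiff_chart.of_le (by simp)) K.injOn K.det_ne_zero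
  refine ⟨c, hc, fun x hx y hy => ?_⟩
  have := h _ (K.inv_mem hx) _ (K.inv_mem hy)
  rwa [K.chart_inv hx, K.chart_inv hy] at this

/-- The inverse is Lipschitz on the closed element, hence continuous at x. A continuous local
inverse of a map with invertible derivative is differentiable. -/
theorem differentiableAt_inv {x : Pt d} (hx : x ∈ K.openSet) : DifferentiableAt ℝ K.inv x := by
  have hnhds : K.openSet ∈ 𝓝 x := K.isOpen_openSet.mem_nhds hx
  have hcl : K.closedSet ∈ 𝓝 x := mem_of_superset hnhds K.openSet_subset_closedSet
  have hxc := K.openSet_subset_closedSet hx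
  obtain ⟨c, hc, h⟩ := K.exists_inv_lipschitz
  have hlip : LipschitzOnWith c.toNNReal K.inv K.closedSet :=
    LipschitzOnWith.of_dist_le_mul fun a ha b hb => by
      rw [dist_eq_norm, dist_eq_norm, Real.coe_toNNReal _ hc]; exact h a ha b hb
  have hcont : ContinuousAt K.inv x := hlip.continuousOn.continuousAt hcl
  have hdet := K.det_ne_zero _ (K.inv_mem hxc)
  have hd : HasFDerivAt K.chart (ContinuousLinearMap.toContinuousLinearEquivOfDetNeZero
      (fderiv ℝ K.chart (K.inv x)) hdet : Pt d →L[ℝ] Pt d) (K.inv x) :=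
    (K.contDiff_chart.differentiable (by simp) _).hasFDerivAt
  exact (HasFDerivAt.of_local_left_inverse hcont hd
    (by filter_upwards [hcl] with y hy using K.chart_inv hy)).differentiableAt

theorem differentiableAt_lagrange (v : K.kind.Vertex d) {x : Pt d} (hx : x ∈ K.openSet) :
    DifferentiableAt ℝ (K.lagrange v) x :=
  ((K.kind.contDiff_shape v).differentiable (by simp) _).comp x (K.differentiableAt_inv hx)

/-- A shape function is Lipschitz on the convex reference element, and the inverse map is Lipschitz.
The element itself may fail to be convex, so the estimate has to pass through the reference element.
-/
theorem exists_lagrange_lipschitz :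
    ∃ c : ℝ, 0 ≤ c ∧ ∀ v, ∀ x ∈ K.closedSet, ∀ y ∈ K.closedSet,
      |K.lagrange v x - K.lagrange v y| ≤ c * ‖x - y‖ := by
  have h1 : ∀ v : K.kind.Vertex d, ∃ c : ℝ, 0 ≤ c ∧ ∀ x ∈ K.closedSet, ∀ y ∈ K.closedSet,
      |K.lagrange v x - K.lagrange v y| ≤ c * ‖x - y‖ := by
    intro v
    obtain ⟨c, hc, h⟩ := K.exists_inv_lipschitz
    obtain ⟨M, hM⟩ := (K.kind.isCompact_closedRef (d := d)).exists_bound_of_continuousOn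
      ((K.kind.contDiff_shape v).continuous_fderiv (by simp)).continuousOn
    have hM0 : ∀ x ∈ K.kind.closedRef d, ‖fderiv ℝ (K.kind.shape d v) x‖ ≤ max M 0 := fun x hx =>
      (hM x hx).trans (le_max_left _ _)
    refine ⟨max M 0 * c, by positivity, fun x hx y hy => ?_⟩
    have := Convex.norm_image_sub_le_of_norm_fderiv_le (𝕜 := ℝ)
      (fun z _ => (K.kind.contDiff_shape v).differentiable (by simp) z) hM0
      K.kind.convex_closedRef (K.inv_mem hy) (K.inv_mem hx)
    calc |K.lagrange v x - K.lagrange v y| ≤ max M 0 * ‖K.inv x - K.inv y‖ := this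
      _ ≤ max M 0 * (c * ‖x - y‖) := by gcongr; exact h x hx y hy
      _ = _ := by ring
  choose c hc h using h1
  refine ⟨∑ v, c v, Finset.sum_nonneg fun v _ => hc v, fun v x hx y hy => ?_⟩
  refine (h v x hx y hy).trans ?_
  gcongr
  exact Finset.single_le_sum (fun v _ => hc v) (Finset.mem_univ v)

theorem exists_norm_gradient_lagrange_le :
    ∃ c : ℝ, 0 ≤ c ∧ ∀ v, ∀ x ∈ K.openSet, ‖gradient (K.lagrange v) x‖ ≤ c := by
  obtain ⟨c, hc, h⟩ := K.exists_lagrange_lipschitz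
  refine ⟨c, hc, fun v x hx => ?_⟩
  have hlip : LipschitzOnWith c.toNNReal (K.lagrange v) K.closedSet :=
    LipschitzOnWith.of_dist_le_mul fun a ha b hb => by
      rw [Real.dist_eq, dist_eq_norm, Real.coe_toNNReal _ hc]; exact h v a ha b hb
  have := norm_fderiv_le_of_lipschitzOn ℝ (mem_of_superset (K.isOpen_openSet.mem_nhds hx)
    K.openSet_subset_closedSet) hlip
  rw [gradient, LinearIsometryEquiv.norm_map]
  rwa [Real.coe_toNNReal _ hc] at this

theorem measurable_gradient {f : Pt d → ℝ} : Measurable (gradient f) :=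
  ((InnerProductSpace.toDual ℝ (Pt d)).symm.continuous.measurable).comp (measurable_fderiv ℝ f)

end Cell

/-! ### Rellich's theorem on an element. -/

theorem IsWeakGradient.congr {d : ℕ} {U : Set (Pt d)} {u u' : Pt d → ℂ}
    {g g' : Pt d → EuclideanSpace ℂ (Fin d)} (h : IsWeakGradient U u g)
    (hu : u =ᵐ[volume.restrict U] u') (hg : g =ᵐ[volume.restrict U] g') :
    IsWeakGradient U u' g' := by
  intro φ hφ hc hs i
  have h1 : ∫ x in U, (fderiv ℝ φ x (EuclideanSpace.single i 1)) • u' x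
      = ∫ x in U, (fderiv ℝ φ x (EuclideanSpace.single i 1)) • u x :=
    integral_congr_ae (hu.mono fun x hx => by simp only [hx])
  have h2 : ∫ x in U, (φ x) • (g' x) i = ∫ x in U, (φ x) • (g x) i :=
    integral_congr_ae (hg.mono fun x hx => by simp only [hx])
  rw [h1, h2]
  exact h φ hφ hc hs i

theorem sum_enorm_coord_sq {d : ℕ} (z : EuclideanSpace ℂ (Fin d)) :
    ∑ i, ‖z i‖ₑ ^ 2 = ‖z‖ₑ ^ 2 := by
  simp only [← ofReal_norm, ← ENNReal.ofReal_pow (norm_nonneg _)]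
  rw [← ENNReal.ofReal_sum_of_nonneg (fun _ _ => by positivity), EuclideanSpace.norm_sq_eq]

theorem enorm_Lp_sq {α E : Type*} [MeasurableSpace α] {μ : Measure α} [NormedAddCommGroup E]
    (f : Lp E 2 μ) : ‖f‖ₑ ^ 2 = ∫⁻ x, ‖f x‖ₑ ^ 2 ∂μ := by
  rw [Lp.enorm_def]
  have := eLpNorm_nnreal_pow_eq_lintegral (f := f) (μ := μ) (p := 2) (by simp)
  simpa using this

theorem lintegral_enorm_sq_lt_top {α E : Type*} [MeasurableSpace α] {μ : Measure α}
    [NormedAddCommGroup E] {f : α → E} (hf : MemLp f 2 μ) : ∫⁻ x, ‖f x‖ₑ ^ 2 ∂μ < ⊤ := by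
  have := eLpNorm_nnreal_pow_eq_lintegral (f := f) (μ := μ) (p := 2) (by simp)
  simp only [ENNReal.coe_ofNat, NNReal.coe_ofNat, ENNReal.rpow_ofNat] at this
  rw [← this]
  exact ENNReal.pow_lt_top hf.2

theorem memLp_two_of_lintegral {α E : Type*} [MeasurableSpace α] {μ : Measure α}
    [NormedAddCommGroup E] {f : α → E} (hm : AEStronglyMeasurable f μ)
    (hf : ∫⁻ x, ‖f x‖ₑ ^ 2 ∂μ < ⊤) : MemLp f 2 μ := by
  refine ⟨hm, ?_⟩
  have := eLpNorm_nnreal_pow_eq_lintegral (f := f) (μ := μ) (p := 2) (by simp)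
  simp only [ENNReal.coe_ofNat, NNReal.coe_ofNat, ENNReal.rpow_ofNat] at this
  rw [← this] at hf
  exact (ENNReal.pow_lt_top_iff.1 hf).resolve_right (by simp)

/-- The part of the open reference element in the grid cube with index `k` and side `1 / n`. -/
def RefCell.piece {d : ℕ} (K : RefCell) (n : ℕ) (k : Fin d → Fin n) : Set (Pt d) :=
  K.openRef d ∩ {x | ∀ i, (k i : ℝ) / n ≤ x i ∧ x i < ((k i : ℝ) + 1) / n}

namespace RefCell

variable {d : ℕ} (K : RefCell) {n : ℕ}

theorem convex_piece (k : Fin d → Fin n) : Convex ℝ (K.piece n k) := by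
  refine K.convex_openRef.inter ?_
  have : {x : Pt d | ∀ i, (k i : ℝ) / n ≤ x i ∧ x i < ((k i : ℝ) + 1) / n}
      = ⋂ i, ((EuclideanSpace.proj i : Pt d →L[ℝ] ℝ) ⁻¹'
        Ico ((k i : ℝ) / n) (((k i : ℝ) + 1) / n)) := by
    ext x; simp
  rw [this]
  exact convex_iInter fun i => (convex_Ico _ _).is_linear_preimage
    (EuclideanSpace.proj i : Pt d →L[ℝ] ℝ).isLinear

theorem measurableSet_piece (k : Fin d → Fin n) : MeasurableSet (K.piece n k) := by
  refine K.isOpen_openRef.measurableSet.inter ?_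
  have : {x : Pt d | ∀ i, (k i : ℝ) / n ≤ x i ∧ x i < ((k i : ℝ) + 1) / n}
      = ⋂ i, ((EuclideanSpace.proj i : Pt d →L[ℝ] ℝ) ⁻¹'
        Ico ((k i : ℝ) / n) (((k i : ℝ) + 1) / n)) := by
    ext x; simp
  rw [this]
  exact MeasurableSet.iInter fun i =>
    (EuclideanSpace.proj i : Pt d →L[ℝ] ℝ).continuous.measurable measurableSet_Ico

theorem enorm_sub_le_of_mem_piece (k : Fin d → Fin n) {x y : Pt d}
    (hx : x ∈ K.piece n k) (hy : y ∈ K.piece n k) :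
    ‖x - y‖ₑ ≤ ENNReal.ofReal (√d * (1 / n)) := by
  rw [← ofReal_norm]
  refine ENNReal.ofReal_le_ofReal ?_
  rw [EuclideanSpace.norm_eq]
  calc √(∑ i, ‖(x - y) i‖ ^ 2) ≤ √(∑ i : Fin d, (1 / (n : ℝ)) ^ 2) := by
        refine Real.sqrt_le_sqrt (Finset.sum_le_sum fun i _ => ?_)
        have h1 := hx.2 i
        have h2 := hy.2 i
        have h3 : ((k i : ℝ) + 1) / n = (k i : ℝ) / n + 1 / n := by ring
        gcongr
        rw [PiLp.sub_apply, Real.norm_eq_abs, abs_le]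
        constructor <;> linarith
    _ = √d * (1 / n) := by
        rw [Finset.sum_const, Finset.card_univ, Fintype.card_fin, nsmul_eq_mul,
          Real.sqrt_mul (by positivity), Real.sqrt_sq (by positivity)]

theorem pairwise_disjoint_piece :
    Pairwise (Function.onFun Disjoint fun k : Fin d → Fin n => K.piece n k) := by
  intro k k' hne
  refine Set.disjoint_left.2 fun x hx hx' => hne (funext fun i => ?_)
  have hn : (0 : ℝ) < n := by
    have : 0 < n := Fin.pos (k i)
    exact_mod_cast this
  have h1 := hx.2 i
  have h2 := hx'.2 i
  have a : ((k i : ℕ) : ℝ) < (k' i : ℕ) + 1 := (div_lt_div_iff_of_pos_right hn).1 (h1.1.trans_lt h2.2)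
  have b : ((k' i : ℕ) : ℝ) < (k i : ℕ) + 1 := (div_lt_div_iff_of_pos_right hn).1 (h2.1.trans_lt h1.2)
  have a' : (k i : ℕ) < k' i + 1 := by exact_mod_cast a
  have b' : (k' i : ℕ) < k i + 1 := by exact_mod_cast b
  exact Fin.ext (by omega)

theorem iUnion_piece (hn : 0 < n) : ⋃ k : Fin d → Fin n, K.piece n k = K.openRef d := by
  have hn' : (0 : ℝ) < n := by exact_mod_cast hn
  refine subset_antisymm (iUnion_subset fun k => inter_subset_left) fun x hx => ?_
  have hlt : ∀ i, ⌊x i * n⌋₊ < n := fun i => by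
    rw [Nat.floor_lt (mul_nonneg (K.openRef_coord hx i).1.le hn'.le)]
    exact mul_lt_of_lt_one_left hn' (K.openRef_coord hx i).2
  refine mem_iUnion.2 ⟨fun i => ⟨⌊x i * n⌋₊, hlt i⟩, hx, fun i => ?_⟩
  rw [div_le_iff₀ hn', lt_div_iff₀ hn']
  exact ⟨Nat.floor_le (mul_nonneg (K.openRef_coord hx i).1.le hn'.le), Nat.lt_floor_add_one _⟩

end RefCell

namespace Cell

variable {d : ℕ} (K : Cell d)

theorem _root_.Set.InjOn.disjoint_image_image {α β : Type*} {f : α → β} {s t u : Set α}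
    (hf : InjOn f s) (ht : t ⊆ s) (hu : u ⊆ s) (h : Disjoint t u) : Disjoint (f '' t) (f '' u) := by
  rw [Set.disjoint_left]
  rintro _ ⟨a, ha, rfl⟩ ⟨b, hb, hab⟩
  exact Set.disjoint_left.1 h ha (hf (hu hb) (ht ha) hab ▸ hb)

theorem exists_lintegral_comp_chart_le : ∃ κ : ℝ≥0∞, κ ≠ ⊤ ∧ ∀ D ⊆ K.kind.openRef d,
    MeasurableSet D → ∀ f : Pt d → ℝ≥0∞,
      ∫⁻ x in D, f (K.chart x) ≤ κ * ∫⁻ x in K.chart '' D, f x := by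
  obtain ⟨δ, hδ, hdet⟩ := K.exists_le_abs_det
  refine ⟨ENNReal.ofReal δ⁻¹, by simp, fun D hD hDm f => ?_⟩
  have hD' := hD.trans K.kind.openRef_subset
  exact lintegral_comp_le_of_det hDm (K.contDiff_chart.differentiable (by simp))
    (K.injOn.mono hD') hδ (fun x hx => hdet x (hD' hx)) f

/-- Control of the `L²` norm on an element by finitely many averages, up to a small multiple of
the norm of the gradient. -/
theorem exists_lintegral_le_averages {η : ℝ≥0∞} (hη : η ≠ 0) :
    ∃ (ι : Type) (_ : Fintype ι) (D : ι → Set (Pt d)) (A : ℝ≥0∞), A ≠ ⊤ ∧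
      (∀ k, D k ⊆ K.kind.openRef d ∧ MeasurableSet (D k)) ∧
      ∀ (u : Pt d → ℂ) (g : Pt d → EuclideanSpace ℂ (Fin d)), IsWeakGradient K.openSet u g →
        MemLp u 2 (volume.restrict K.openSet) → MemLp g 2 (volume.restrict K.openSet) →
        Measurable u → Measurable g →
        ∫⁻ x in K.openSet, ‖u x‖ₑ ^ 2 ≤ A * ∑ k, ‖∫ x in D k, u (K.chart x)‖ₑ ^ 2
          + η * ∫⁻ x in K.openSet, ‖g x‖ₑ ^ 2 := by
  obtain ⟨δ, hδ, hdet⟩ := K.exists_le_abs_det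
  obtain ⟨M, hM, hFM⟩ := K.exists_norm_fderiv_chart_le
  obtain ⟨J, hJ⟩ := K.exists_abs_det_le
  obtain ⟨κ, hκ, hκle⟩ := K.exists_lintegral_comp_chart_le
  have hFd : Differentiable ℝ K.chart := K.contDiff_chart.differentiable (by simp)
  -- The 8 is the 2 of the mean value bound times the 4 of the double difference bound. The factor
  -- h² has been left out: h is at most √d / n, so a fine grid makes the coefficient of the gradient
  -- at most η.
  set P : ℝ≥0∞ := 8 * 2 ^ d * ENNReal.ofReal M ^ 2 * ENNReal.ofReal δ⁻¹
  have hP : P ≠ ⊤ := by simp [P, ENNReal.mul_eq_top]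
  have hsmall : ∃ n : ℕ, 0 < n ∧
      ENNReal.ofReal J * (P * ENNReal.ofReal (√d * (1 / n)) ^ 2) ≤ η := by
    have hlim : Tendsto (fun n : ℕ => ENNReal.ofReal J *
        (P * ENNReal.ofReal (√d * (1 / n)) ^ 2)) atTop
        (𝓝 (ENNReal.ofReal J * (P * ENNReal.ofReal (√d * 0) ^ 2))) := by
      refine ENNReal.Tendsto.const_mul (ENNReal.Tendsto.const_mul ?_ (Or.inr hP)) (Or.inr (by simp))
      exact ((ENNReal.continuous_pow 2).tendsto _).comp (ENNReal.tendsto_ofReal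
        ((tendsto_const_nhds (x := √d)).mul tendsto_one_div_atTop_nhds_zero_nat))
    simp only [mul_zero, ENNReal.ofReal_zero, ne_eq, OfNat.ofNat_ne_zero, not_false_eq_true,
      zero_pow] at hlim
    have h1 := ENNReal.tendsto_nhds_zero.1 hlim η (pos_iff_ne_zero.2 hη)
    obtain ⟨n, h, hn⟩ := (h1.and (eventually_gt_atTop 0)).exists
    exact ⟨n, hn, h⟩
  obtain ⟨n, hn, hnη⟩ := hsmall
  set h : ℝ≥0∞ := ENNReal.ofReal (√d * (1 / n))
  have hD : ∀ k : Fin d → Fin n, K.kind.piece n k ⊆ K.kind.openRef d := fun k => inter_subset_left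
  have hvD : ∀ k : Fin d → Fin n, volume (K.kind.piece n k) ≠ ⊤ := fun k =>
    ((measure_mono ((hD k).trans K.kind.openRef_subset)).trans_lt
      K.kind.isCompact_closedRef.measure_lt_top).ne
  -- The factor 2 divided by the volume, as in the mean value bound. Null pieces contribute nothing
  -- and get 0, as the inverse of their volume would be infinite.
  let a : (Fin d → Fin n) → ℝ≥0∞ := fun k =>
    if volume (K.kind.piece n k) = 0 then 0 else 2 * (volume (K.kind.piece n k))⁻¹
  have ha : ∀ k, a k ≠ ⊤ := fun k => by
    simp only [a]; split_ifs with h0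
    · simp
    · exact ENNReal.mul_ne_top (by simp) (ENNReal.inv_ne_top.2 h0)
  refine ⟨Fin d → Fin n, inferInstance, fun k => K.kind.piece n k, ENNReal.ofReal J * ∑ k, a k,
    ENNReal.mul_ne_top (by simp) (ENNReal.sum_ne_top.2 fun k _ => ha k),
    fun k => ⟨hD k, K.kind.measurableSet_piece k⟩, fun u g hug hu hg hum hgm => ?_⟩
  have hgi : ∀ i, Measurable fun x => ‖g x i‖ₑ ^ 2 := fun i =>
    (((EuclideanSpace.proj i : EuclideanSpace ℂ (Fin d) →L[ℂ] ℂ).continuous.measurable).comp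
      hgm).enorm.pow_const 2
  have piece : ∀ k : Fin d → Fin n, ∫⁻ x in K.kind.piece n k, ‖u (K.chart x)‖ₑ ^ 2
      ≤ a k * ‖∫ x in K.kind.piece n k, u (K.chart x)‖ₑ ^ 2
        + P * h ^ 2 * ∫⁻ x in K.chart '' K.kind.piece n k, ‖g x‖ₑ ^ 2 := by
    intro k
    set D := K.kind.piece n k
    have hDm : MeasurableSet D := K.kind.measurableSet_piece k
    have hDR : D ⊆ K.kind.closedRef d := (hD k).trans K.kind.openRef_subset
    by_cases hv : volume D = 0
    · rw [Measure.restrict_eq_zero.2 hv]; simp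
    have hdouble := hug.lintegral_prod_le K.isOpen_openSet hu hg hum hgm
      (K.contDiff_chart.of_le (by simp)) (K.kind.isCompact_shrunk (d := d))
      K.kind.convex_shrunk K.kind.monotone_shrunk
      (fun n => image_mono (K.kind.shrunk_subset n))
      ((hD k).trans K.kind.openRef_subset_iUnion_shrunk) (K.injOn.mono hDR) hδ
      (fun x hx => hdet x (hDR hx)) (fun x hx => hFM x (hDR hx)) (K.kind.convex_piece k) hDm
      (fun x hx y hy => K.kind.enorm_sub_le_of_mem_piece k hx hy) ENNReal.ofReal_ne_top
    have hf : Measurable fun x => u (K.chart x) := hum.comp K.contDiff_chart.continuous.measurable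
    have : IsFiniteMeasure (volume.restrict D) :=
      ⟨by rw [Measure.restrict_apply_univ]; exact (hvD k).lt_top⟩
    have hfL : MemLp (fun x => u (K.chart x)) 2 (volume.restrict D) := by
      refine memLp_two_of_lintegral hf.aestronglyMeasurable ?_
      refine (hκle D (hD k) hDm fun z => ‖u z‖ₑ ^ 2).trans_lt (ENNReal.mul_lt_top hκ.lt_top ?_)
      exact (lintegral_mono_set (image_mono (hD k))).trans_lt (lintegral_enorm_sq_lt_top hu)
    have h1 := measure_mul_lintegral_enorm_sq_le (volume.restrict D) hf
      (hfL.integrable (by norm_num))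
    rw [Measure.restrict_apply_univ, Measure.prod_restrict] at h1
    have h2 : volume D * ∫⁻ x in D, ‖u (K.chart x)‖ₑ ^ 2
        ≤ volume D * (a k * ‖∫ x in D, u (K.chart x)‖ₑ ^ 2
        + P * h ^ 2 * ∫⁻ x in K.chart '' D, ‖g x‖ₑ ^ 2) := by
      refine h1.trans ?_
      have hak : volume D * a k = 2 := by
        simp only [a, D, if_neg hv]
        rw [mul_left_comm, ENNReal.mul_inv_cancel hv (hvD k), mul_one]
      rw [mul_add, ← mul_assoc, hak]
      refine add_le_add le_rfl ((mul_le_mul' le_rfl hdouble).trans (le_of_eq ?_))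
      rw [← lintegral_finsetSum _ fun i _ => hgi i]
      simp only [sum_enorm_coord_sq, P]
      ring
    exact (ENNReal.mul_le_mul_iff_right hv (hvD k)).1 h2
  have hU : K.openSet = K.chart '' K.kind.openRef d := rfl
  have hinjO : InjOn K.chart (K.kind.openRef d) := K.injOn.mono K.kind.openRef_subset
  calc ∫⁻ x in K.openSet, ‖u x‖ₑ ^ 2
      ≤ ENNReal.ofReal J * ∫⁻ x in K.kind.openRef d, ‖u (K.chart x)‖ₑ ^ 2 := by
        rw [hU, lintegral_image_eq_lintegral_abs_det_fderiv_mul volume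
          K.kind.isOpen_openRef.measurableSet
          (fun x _ => (hFd x).hasFDerivAt.hasFDerivWithinAt) hinjO,
          ← lintegral_const_mul' _ _ (by simp)]
        refine setLIntegral_mono' K.kind.isOpen_openRef.measurableSet fun x hx => ?_
        gcongr
        exact hJ x (K.kind.openRef_subset hx)
    _ = ENNReal.ofReal J * ∑ k, ∫⁻ x in K.kind.piece n k, ‖u (K.chart x)‖ₑ ^ 2 := by
        rw [← K.kind.iUnion_piece hn, lintegral_iUnion (fun k => K.kind.measurableSet_piece k)
          K.kind.pairwise_disjoint_piece, tsum_fintype]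
    _ ≤ ENNReal.ofReal J * ∑ k, (a k * ‖∫ x in K.kind.piece n k, u (K.chart x)‖ₑ ^ 2
        + P * h ^ 2 * ∫⁻ x in K.chart '' K.kind.piece n k, ‖g x‖ₑ ^ 2) := by
        gcongr with k; exact piece k
    _ = ENNReal.ofReal J * ∑ k, a k * ‖∫ x in K.kind.piece n k, u (K.chart x)‖ₑ ^ 2
        + ENNReal.ofReal J * (P * h ^ 2) * ∫⁻ x in K.openSet, ‖g x‖ₑ ^ 2 := by
        have himg : K.openSet = ⋃ k : Fin d → Fin n, K.chart '' K.kind.piece n k := by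
          rw [← image_iUnion, K.kind.iUnion_piece hn, hU]
        have hdisj : Pairwise (Function.onFun Disjoint
            fun k : Fin d → Fin n => K.chart '' K.kind.piece n k) := fun k k' hkk' =>
          hinjO.disjoint_image_image (hD k) (hD k') (K.kind.pairwise_disjoint_piece hkk')
        rw [himg, lintegral_iUnion (fun k =>
          (K.kind.measurableSet_piece k).image_of_continuousOn_injOn
            K.contDiff_chart.continuous.continuousOn (hinjO.mono (hD k))) hdisj, tsum_fintype,
          Finset.sum_add_distrib, mul_add, ← Finset.mul_sum]
        ring
    _ ≤ _ := by
        refine add_le_add ?_ (mul_le_mul' hnη le_rfl)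
        rw [mul_assoc, Finset.sum_mul]
        gcongr with k
        exact Finset.single_le_sum (f := fun k => ‖∫ x in K.kind.piece n k, u (K.chart x)‖ₑ ^ 2)
          (fun _ _ => zero_le) (Finset.mem_univ k)

theorem enorm_setIntegral_comp_chart_sq_le {κ : ℝ≥0∞} {D : Set (Pt d)}
    (hD : D ⊆ K.kind.openRef d)
    (hκ : ∀ f : Pt d → ℝ≥0∞, ∫⁻ x in D, f (K.chart x) ≤ κ * ∫⁻ x in K.chart '' D, f x)
    {u : Pt d → ℂ} (hu : Measurable u) :
    ‖∫ x in D, u (K.chart x)‖ₑ ^ 2 ≤ volume (K.kind.openRef d) *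
      (κ * ∫⁻ x in K.openSet, ‖u x‖ₑ ^ 2) := by
  calc ‖∫ x in D, u (K.chart x)‖ₑ ^ 2 ≤ (∫⁻ x in D, ‖u (K.chart x)‖ₑ) ^ 2 := by
        gcongr; exact enorm_integral_le_lintegral_enorm _
    _ ≤ volume D * ∫⁻ x in D, ‖u (K.chart x)‖ₑ ^ 2 := by
        refine (sq_lintegral_le _ ?_).trans (by rw [Measure.restrict_apply_univ])
        exact (hu.comp K.contDiff_chart.continuous.measurable).enorm.aemeasurable
    _ ≤ _ := by
        gcongr
        refine (hκ fun z => ‖u z‖ₑ ^ 2).trans ?_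
        gcongr
        exact image_mono hD

set_option maxHeartbeats 1000000 in
/-- Rellich's theorem on an element: bounded sets of `H¹` are totally bounded in `L²`. -/
theorem totallyBounded_fst_H1 (R : ℝ≥0∞) (hR : R ≠ ⊤) :
    TotallyBounded {f : Lp ℂ 2 (volume.restrict K.openSet) |
      ∃ p : H1 K.openSet, p.1.1 = f ∧ ‖p.1.1‖ₑ ^ 2 ≤ R ∧ ‖p.1.2‖ₑ ^ 2 ≤ R} := by
  obtain ⟨κ, hκ, hκle⟩ := K.exists_lintegral_comp_chart_le
  refine Metric.totallyBounded_of_finite_discretization fun ε hε => ?_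
  have hε' : 0 < ENNReal.ofReal ε ^ 2 := by positivity
  set E : ℝ≥0∞ := ENNReal.ofReal ε ^ 2
  have hE : E ≠ ⊤ := by simp [E]
  -- The squared gradient norm of a difference of two members of the set is at most 4R, so the
  -- gradient term uses less than half of the allowed error E.
  obtain ⟨η, hη0, hη⟩ : ∃ η : ℝ≥0∞, η ≠ 0 ∧ η * (4 * R) < E / 2 := by
    have hlim : Tendsto (fun η : ℝ≥0∞ => η * (4 * R)) (𝓝[≠] 0) (𝓝 (0 * (4 * R))) :=
      (ENNReal.Tendsto.mul_const tendsto_id (Or.inr (ENNReal.mul_ne_top (by simp) hR))).mono_left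
        nhdsWithin_le_nhds
    rw [zero_mul] at hlim
    have h1 := hlim.eventually (gt_mem_nhds (ENNReal.half_pos hε'.ne'))
    obtain ⟨η, h, h0⟩ := (h1.and self_mem_nhdsWithin).exists
    exact ⟨η, h0, h⟩
  obtain ⟨ι, _, D, A, hA, hD, hle⟩ := K.exists_lintegral_le_averages hη0
  obtain ⟨τ, hτ0, hτ⟩ : ∃ τ : ℝ, 0 < τ ∧
      A * ∑ _k : ι, ENNReal.ofReal τ ^ 2 < E / 2 := by
    have hlim : Tendsto (fun τ : ℝ => A * ∑ _k : ι, ENNReal.ofReal τ ^ 2) (𝓝[>] 0)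
        (𝓝 (A * ∑ _k : ι, ENNReal.ofReal 0 ^ 2)) := by
      refine Tendsto.mono_left ?_ nhdsWithin_le_nhds
      refine ENNReal.Tendsto.const_mul (tendsto_finsetSum _ fun k _ => ?_) (Or.inr hA)
      exact ((ENNReal.continuous_pow 2).comp ENNReal.continuous_ofReal).tendsto _
    simp only [ENNReal.ofReal_zero, ne_eq, OfNat.ofNat_ne_zero, not_false_eq_true, zero_pow,
      Finset.sum_const_zero, mul_zero] at hlim
    have h1 := hlim.eventually (gt_mem_nhds (ENNReal.half_pos hε'.ne'))
    obtain ⟨τ, h, h0⟩ := (h1.and self_mem_nhdsWithin).exists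
    exact ⟨τ, h0, h⟩
  set s := {f : Lp ℂ 2 (volume.restrict K.openSet) |
      ∃ p : H1 K.openSet, p.1.1 = f ∧ ‖p.1.1‖ₑ ^ 2 ≤ R ∧ ‖p.1.2‖ₑ ^ 2 ≤ R}
  -- The vector of averages maps the set to a bounded, hence totally bounded, subset of a finite
  -- dimensional space. Two functions whose vectors lie in the same ball of radius τ/2 have averages
  -- closer than τ, and then they are close in L².
  let ℓ : Lp ℂ 2 (volume.restrict K.openSet) → ι → ℂ := fun f k => ∫ x in D k, f (K.chart x)
  set B : ℝ≥0∞ := volume (K.kind.openRef d) * (κ * R)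
  have hvol : volume (K.kind.openRef d) ≠ ⊤ := ((measure_mono K.kind.openRef_subset).trans_lt
    K.kind.isCompact_closedRef.measure_lt_top).ne
  have hB : B ≠ ⊤ := ENNReal.mul_ne_top hvol (ENNReal.mul_ne_top hκ hR)
  have hℓB : ∀ f ∈ s, ∀ k, ‖ℓ f k‖ ^ 2 ≤ B.toReal := by
    rintro f ⟨p, rfl, hp1, hp2⟩ k
    have h1 := K.enorm_setIntegral_comp_chart_sq_le (hD k).1 (hκle _ (hD k).1 (hD k).2)
      (Lp.stronglyMeasurable p.1.1).measurable
    rw [← enorm_Lp_sq] at h1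
    have h2 : ‖ℓ p.1.1 k‖ₑ ^ 2 ≤ B := h1.trans (by simp only [B]; gcongr)
    rw [← ofReal_norm, ← ENNReal.ofReal_pow (norm_nonneg _)] at h2
    exact (ENNReal.ofReal_le_iff_le_toReal hB).1 h2
  have hℓb : Bornology.IsBounded (ℓ '' s) := by
    refine (Metric.isBounded_closedBall (x := (0 : ι → ℂ)) (r := √B.toReal)).subset ?_
    rintro _ ⟨f, hf, rfl⟩
    rw [mem_closedBall_zero_iff]
    refine (pi_norm_le_iff_of_nonneg (Real.sqrt_nonneg _)).2 fun k => ?_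
    exact Real.le_sqrt_of_sq_le (hℓB f hf k)
  obtain ⟨t, ht, hcover⟩ := Metric.totallyBounded_iff.1
    (hℓb.isCompact_closure.totallyBounded.subset subset_closure) (τ / 2) (by positivity)
  have hch : ∀ f : s, ∃ c : t, ℓ f ∈ Metric.ball (c : ι → ℂ) (τ / 2) := fun f => by
    obtain ⟨c, hc, h⟩ := mem_iUnion₂.1 (hcover (mem_image_of_mem ℓ f.2))
    exact ⟨⟨c, hc⟩, h⟩
  choose F hF using hch
  refine ⟨t, ht.fintype, F, fun f f' hff' => ?_⟩
  have hdist : dist (ℓ f) (ℓ f') < τ := by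
    have h1 := Metric.mem_ball.1 (hF f)
    have h2 := Metric.mem_ball.1 (hF f')
    rw [← hff', dist_comm] at h2
    linarith [dist_triangle (ℓ f) (F f) (ℓ f')]
  obtain ⟨_, p, rfl, hp1, hp2⟩ := f
  obtain ⟨_, p', rfl, hp1', hp2'⟩ := f'
  simp only at hdist ⊢
  have hae1 := Lp.coeFn_sub p.1.1 p'.1.1
  have hae2 := Lp.coeFn_sub p.1.2 p'.1.2
  have hwg : IsWeakGradient K.openSet (p.1.1 - p'.1.1 : Pt d → ℂ)
      (p.1.2 - p'.1.2 : Pt d → EuclideanSpace ℂ (Fin d)) := by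
    have h0 : IsWeakGradient K.openSet (p - p').1.1 (p - p').1.2 := (p - p').2
    exact h0.congr hae1 hae2
  have hmain := hle _ _ hwg ((Lp.memLp p.1.1).sub (Lp.memLp p'.1.1))
    ((Lp.memLp p.1.2).sub (Lp.memLp p'.1.2))
    ((Lp.stronglyMeasurable p.1.1).measurable.sub (Lp.stronglyMeasurable p'.1.1).measurable)
    ((Lp.stronglyMeasurable p.1.2).measurable.sub (Lp.stronglyMeasurable p'.1.2).measurable)
  have e1 : ∫⁻ x in K.openSet, ‖(p.1.1 - p'.1.1 : Pt d → ℂ) x‖ₑ ^ 2 = ‖p.1.1 - p'.1.1‖ₑ ^ 2 := by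
    rw [enorm_Lp_sq]
    exact lintegral_congr_ae (hae1.mono fun x hx => by simp only [hx])
  have e2 : ∫⁻ x in K.openSet, ‖(p.1.2 - p'.1.2 : Pt d → EuclideanSpace ℂ (Fin d)) x‖ₑ ^ 2
      = ‖p.1.2 - p'.1.2‖ₑ ^ 2 := by
    rw [enorm_Lp_sq]
    exact lintegral_congr_ae (hae2.mono fun x hx => by simp only [hx])
  have hint : ∀ (q : H1 K.openSet) (k : ι), Integrable (fun x => q.1.1 (K.chart x))
      (volume.restrict (D k)) := by
    intro q k
    have : IsFiniteMeasure (volume.restrict (D k)) :=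
      ⟨by rw [Measure.restrict_apply_univ]; exact (measure_mono (hD k).1).trans_lt hvol.lt_top⟩
    refine MemLp.integrable (q := 2) (by norm_num) (memLp_two_of_lintegral ?_ ?_)
    · exact ((Lp.stronglyMeasurable q.1.1).measurable.comp
        K.contDiff_chart.continuous.measurable).aestronglyMeasurable
    · refine (hκle _ (hD k).1 (hD k).2 fun z => ‖q.1.1 z‖ₑ ^ 2).trans_lt
        (ENNReal.mul_lt_top hκ.lt_top ?_)
      exact (lintegral_mono_set (image_mono (hD k).1)).trans_lt
        (lintegral_enorm_sq_lt_top (Lp.memLp q.1.1))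
  have e3 : ∀ k, ‖∫ x in D k, (p.1.1 - p'.1.1 : Pt d → ℂ) (K.chart x)‖ₑ ^ 2
      ≤ ENNReal.ofReal τ ^ 2 := by
    intro k
    simp only [Pi.sub_apply]
    rw [integral_sub (hint p k) (hint p' k), ← ofReal_norm]
    gcongr
    rw [← dist_eq_norm]
    exact (dist_le_pi_dist (ℓ p.1.1) (ℓ p'.1.1) k).trans hdist.le
  rw [e1, e2] at hmain
  have hfin : ‖p.1.1 - p'.1.1‖ₑ ^ 2 < E := by
    calc ‖p.1.1 - p'.1.1‖ₑ ^ 2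
        ≤ A * ∑ k, ‖∫ x in D k, (p.1.1 - p'.1.1 : Pt d → ℂ) (K.chart x)‖ₑ ^ 2
          + η * ‖p.1.2 - p'.1.2‖ₑ ^ 2 := hmain
      _ ≤ A * ∑ _k : ι, ENNReal.ofReal τ ^ 2 + η * (4 * R) := by
          refine add_le_add (mul_le_mul' le_rfl (Finset.sum_le_sum fun k _ => e3 k))
            (mul_le_mul' le_rfl ?_)
          · have := enorm_add_sq_le p.1.2 (-p'.1.2)
            rw [enorm_neg, ← sub_eq_add_neg] at this
            refine this.trans ?_
            calc 2 * ‖p.1.2‖ₑ ^ 2 + 2 * ‖p'.1.2‖ₑ ^ 2 ≤ 2 * R + 2 * R := by gcongr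
              _ = 4 * R := by ring
      _ < E / 2 + E / 2 := ENNReal.add_lt_add hτ hη
      _ = E := ENNReal.add_halves E
  rw [dist_eq_norm]
  have h3 := lt_of_pow_lt_pow_left' 2 hfin
  rw [← ofReal_norm] at h3
  exact (ENNReal.ofReal_lt_ofReal_iff hε).1 h3

end Cell

/-! ### Hermitian forms, orthogonal projections and the min-max principle. -/

section Sesquilinear

variable {X : Type*} [AddCommGroup X] [Module ℂ X]

/-- Sesquilinear forms, linear in the first argument. -/
abbrev Sesq (X : Type*) [AddCommGroup X] [Module ℂ X] : Type _ := X →ₗ[ℂ] X →ₗ⋆[ℂ] ℂ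

/-- Hermitian symmetry of a sesquilinear form. -/
def IsHerm (q : Sesq X) : Prop := ∀ u v, q v u = star (q u v)

theorem IsHerm.re_comm {q : Sesq X} (h : IsHerm q) (u v : X) : (q v u).re = (q u v).re := by
  rw [h u v]; simp

theorem IsHerm.re_add {q : Sesq X} (h : IsHerm q) (u v : X) :
    (q (u + v) (u + v)).re = (q u u).re + 2 * (q u v).re + (q v v).re := by
  simp only [map_add, LinearMap.add_apply, Complex.add_re, h.re_comm u v]
  ring

theorem IsHerm.re_sub {q : Sesq X} (h : IsHerm q) (u v : X) :
    (q (u - v) (u - v)).re = (q u u).re - 2 * (q u v).re + (q v v).re := by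
  simp only [map_sub, LinearMap.sub_apply, Complex.sub_re, h.re_comm u v]
  ring

theorem re_smul_self (q : Sesq X) (c : ℂ) (u : X) :
    (q (c • u) (c • u)).re = ‖c‖ ^ 2 * (q u u).re := by
  simp only [map_smul, LinearMap.smul_apply, smul_eq_mul, LinearMap.map_smulₛₗ]
  rw [← mul_assoc, mul_comm (starRingEnd ℂ c), Complex.mul_conj, Complex.normSq_eq_norm_sq,
    Complex.re_ofReal_mul]

theorem IsHerm.re_add_smul {q : Sesq X} (h : IsHerm q) (x y : X) (t : ℝ) :
    (q (x + (-(t : ℂ) * q x y) • y) (x + (-(t : ℂ) * q x y) • y)).re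
      = ‖q x y‖ ^ 2 * (q y y).re * (t * t) + -(2 * ‖q x y‖ ^ 2) * t + (q x x).re := by
  rw [h.re_add, re_smul_self]
  have e : (q x ((-(t : ℂ) * q x y) • y)).re = -t * ‖q x y‖ ^ 2 := by
    rw [LinearMap.map_smulₛₗ, smul_eq_mul, map_mul, map_neg, Complex.conj_ofReal, mul_assoc,
      mul_comm (starRingEnd ℂ (q x y)), Complex.mul_conj, Complex.normSq_eq_norm_sq,
      ← Complex.ofReal_neg, ← Complex.ofReal_mul, Complex.ofReal_re]
  rw [e, norm_mul, norm_neg, Complex.norm_real, mul_pow, Real.norm_eq_abs, sq_abs]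
  ring

/-- The Cauchy–Schwarz inequality for a form that is nonnegative on the span of two vectors. -/
theorem IsHerm.norm_sq_le {q : Sesq X} (h : IsHerm q) {x y : X}
    (hpos : ∀ c : ℂ, 0 ≤ (q (x + c • y) (x + c • y)).re) (hy : 0 ≤ (q y y).re) :
    ‖q x y‖ ^ 2 ≤ (q x x).re * (q y y).re := by
  have hx : 0 ≤ (q x x).re := by simpa using hpos 0
  set K := ‖q x y‖ ^ 2 with hK
  -- The vector x - t q(x, y) y has cross term -2tK for real t. The discriminant gives K² ≤ K q(x,
  -- x) q(y, y), and K cancels unless it is zero.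
  have hd := discrim_le_zero (a := K * (q y y).re) (b := -(2 * K)) (c := (q x x).re) fun t => by
    have := hpos (-(t : ℂ) * q x y)
    rwa [h.re_add_smul, ← hK] at this
  rw [discrim] at hd
  rcases (sq_nonneg ‖q x y‖).eq_or_lt with h0 | h0
  · rw [← hK] at h0
    rw [← h0]
    exact mul_nonneg hx hy
  · rw [← hK] at h0
    have : K * (4 * K) ≤ K * (4 * ((q x x).re * (q y y).re)) := by nlinarith
    have := le_of_mul_le_mul_left this h0
    linarith

/-- This is Cauchy–Schwarz. Positivity is required only on combinations of x and y, because the form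
to which this will be applied is nonnegative on a subspace only. -/
theorem IsHerm.eq_zero_of_null {q : Sesq X} (h : IsHerm q) {x y : X}
    (hpos : ∀ c : ℂ, 0 ≤ (q (x + c • y) (x + c • y)).re) (hy : 0 ≤ (q y y).re)
    (hx : (q x x).re = 0) : q x y = 0 := by
  have := h.norm_sq_le hpos hy
  rw [hx, zero_mul] at this
  simpa using le_antisymm this (sq_nonneg _)

/-- The parallelogram identity with the nonnegative term of x + y dropped. -/
theorem IsHerm.re_sub_le {q : Sesq X} (h : IsHerm q) {x y : X}
    (hpos : 0 ≤ (q (x + y) (x + y)).re) :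
    (q (x - y) (x - y)).re ≤ 2 * (q x x).re + 2 * (q y y).re := by
  rw [h.re_add] at hpos
  rw [h.re_sub]
  linarith

/-- Expand q(tx + y, tx + y) ≥ 0 and divide by t. -/
theorem IsHerm.neg_re_le {q : Sesq X} (h : IsHerm q) (hpos : ∀ u, 0 ≤ (q u u).re) {t : ℝ}
    (ht : 0 < t) (x y : X) :
    -(q x y).re ≤ (t * (q x x).re + (q y y).re / t) / 2 := by
  have h1 := hpos ((t : ℂ) • x + y)
  rw [h.re_add, re_smul_self, Complex.norm_real, Real.norm_eq_abs, sq_abs, map_smul,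
    LinearMap.smul_apply, smul_eq_mul, Complex.re_ofReal_mul] at h1
  rw [le_div_iff₀ two_pos, ← sub_nonneg]
  have : t * (q x x).re + (q y y).re / t - -(q x y).re * 2
      = (t ^ 2 * (q x x).re + 2 * (t * (q x y).re) + (q y y).re) / t := by
    field_simp
    ring
  rw [this]
  positivity

/-- Vectors that are orthogonal to a family. -/
def orthTo {ι : Type*} (s : Sesq X) (φ : ι → X) : Submodule ℂ X where
  carrier := {v | ∀ i, s v (φ i) = 0}
  zero_mem' := by intro i; simp
  add_mem' := by
    intro u v hu hv i
    simp [hu i, hv i]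
  smul_mem' := by
    intro c u hu i
    simp [hu i]

/-- The orthogonal projection onto the span of a finite orthogonal family. -/
def projOn {ι : Type*} [Fintype ι] (s : Sesq X) (φ : ι → X) : X →ₗ[ℂ] X where
  toFun u := ∑ i, (s u (φ i) / s (φ i) (φ i)) • φ i
  map_add' u v := by
    simp only [map_add, LinearMap.add_apply, add_div, add_smul, Finset.sum_add_distrib]
  map_smul' c u := by
    simp only [map_smul, LinearMap.smul_apply, smul_eq_mul, mul_div_assoc, mul_smul,
      Finset.smul_sum, RingHom.id_apply]

theorem projOn_apply {ι : Type*} [Fintype ι] (s : Sesq X) (φ : ι → X) (u : X) :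
    projOn s φ u = ∑ i, (s u (φ i) / s (φ i) (φ i)) • φ i := rfl

theorem sub_projOn_mem {ι : Type*} [Fintype ι] {s : Sesq X} {φ : ι → X}
    (ho : ∀ i k, i ≠ k → s (φ i) (φ k) = 0) (hn : ∀ i, s (φ i) (φ i) ≠ 0) (u : X) :
    u - projOn s φ u ∈ orthTo s φ := by
  classical
  intro k
  rw [map_sub, LinearMap.sub_apply, projOn_apply, map_sum, LinearMap.sum_apply,
    Finset.sum_eq_single k]
  · simp [hn k]
  · intro i _ hik
    simp [ho i k hik]
  · simp

theorem form_projOn_right {ι : Type*} [Fintype ι] {s b : Sesq X} {φ : ι → X} {w : X}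
    (h : ∀ i, b w (φ i) = 0) (u : X) : b w (projOn s φ u) = 0 := by
  rw [projOn_apply, map_sum]
  exact Finset.sum_eq_zero fun i _ => by rw [LinearMap.map_smulₛₗ, h i, smul_zero]

theorem re_self_eq_projOn {ι : Type*} [Fintype ι] {s : Sesq X} (hs : IsHerm s) {φ : ι → X}
    (ho : ∀ i k, i ≠ k → s (φ i) (φ k) = 0) (hn : ∀ i, s (φ i) (φ i) ≠ 0) (u : X) :
    (s u u).re = (s (projOn s φ u) (projOn s φ u)).re
      + (s (u - projOn s φ u) (u - projOn s φ u)).re := by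
  have h := hs.re_add (u - projOn s φ u) (projOn s φ u)
  rw [sub_add_cancel, form_projOn_right (sub_projOn_mem ho hn u)] at h
  simp only [Complex.zero_re, mul_zero, add_zero] at h
  rw [h, add_comm]

theorem re_projOn_le {ι : Type*} [Fintype ι] {s : Sesq X} (hs : IsHerm s)
    (hs0 : ∀ u, 0 ≤ (s u u).re) {φ : ι → X} (ho : ∀ i k, i ≠ k → s (φ i) (φ k) = 0)
    (hn : ∀ i, s (φ i) (φ i) ≠ 0) (u : X) :
    (s (projOn s φ u) (projOn s φ u)).re ≤ (s u u).re := by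
  rw [re_self_eq_projOn hs ho hn u]
  exact le_add_of_nonneg_right (hs0 _)

/-- The splitting of u into its projection and the remainder is orthogonal for s and, by the
eigenvalue equation, for a as well. The remainder r therefore satisfies s(r, r) ≤ a(r, r)/Λ ≤ a(u,
u)/Λ. -/
theorem re_self_le_projOn_add {ι : Type*} [Fintype ι] {a s : Sesq X} (ha : IsHerm a) (hs : IsHerm s)
    (ha0 : ∀ u, 0 ≤ (a u u).re) {φ : ι → X} {lam : ι → ℝ}
    (heig : ∀ i v, a (φ i) v = lam i * s (φ i) v)
    (ho : ∀ i k, i ≠ k → s (φ i) (φ k) = 0) (hn : ∀ i, s (φ i) (φ i) ≠ 0) {Λ : ℝ} (hΛ : 0 < Λ)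
    (hgap : ∀ v ∈ orthTo s φ, Λ * (s v v).re ≤ (a v v).re) (u : X) :
    (s u u).re ≤ (s (projOn s φ u) (projOn s φ u)).re + (a u u).re / Λ := by
  have hmem := sub_projOn_mem ho hn u
  have h1 := hgap _ hmem
  have h3 := ha.re_add (u - projOn s φ u) (projOn s φ u)
  have h4 : a (u - projOn s φ u) (projOn s φ u) = 0 := by
    refine form_projOn_right (fun i => ?_) u
    rw [ha (φ i), heig, hs (u - projOn s φ u), hmem i]
    simp
  rw [sub_add_cancel, h4, Complex.zero_re, mul_zero, add_zero] at h3
  rw [re_self_eq_projOn hs ho hn u]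
  gcongr
  rw [le_div_iff₀ hΛ, mul_comm, h3]
  exact h1.trans (le_add_of_nonneg_right (ha0 _))

/-- If r were smaller than the n-th eigenvalue, every listed eigenvector with eigenvalue r would
have index below n, and u would be orthogonal to all of them. But u is in their span, so s(u, u) = 0
and hence a(u, u) = 0. -/
theorem le_of_exhaustive {a s : Sesq X} (hs : IsHerm s) (hpos : ∀ u ≠ 0, 0 < (a u u).re)
    {φ : ℕ → X} {lam : ℕ → ℝ} (hmono : Monotone lam)
    (hexh : ∀ (r : ℝ) (u : X), (∀ v, a u v = r * s u v) →
      u ∈ Submodule.span ℂ {w | ∃ i, lam i = r ∧ φ i = w}) {n : ℕ} {r : ℝ} {u : X}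
    (hu : ∀ v, a u v = r * s u v) (huo : u ∈ orthTo s fun i : Fin n => φ i) (hu0 : u ≠ 0) :
    lam n ≤ r := by
  by_contra! hlt
  have hle : Submodule.span ℂ {w | ∃ i, lam i = r ∧ φ i = w} ≤ orthTo s fun _ : Unit => u := by
    refine Submodule.span_le.2 ?_
    rintro _ ⟨i, hi, rfl⟩ _
    have hin : i < n := by
      by_contra! hni
      exact absurd (hmono hni) (not_le.2 (hi ▸ hlt))
    have := huo ⟨i, hin⟩
    rw [hs, this, star_zero]
  have hsu : s u u = 0 := hle (hexh r u hu) ()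
  have h1 := hpos u hu0
  rw [hu u, hsu, mul_zero] at h1
  exact lt_irrefl _ h1

end Sesquilinear

/-- A min-max principle: below the form `a`, the form `s` is controlled on the orthogonal
complement of the first eigenvectors by the next eigenvalue. -/
theorem mul_re_le_of_eigenvalue_gap {X : Type*} [NormedAddCommGroup X] [NormedSpace ℂ X]
    [CompleteSpace X] {a s : Sesq X} (ha : IsHerm a) (hs : IsHerm s)
    {c C : ℝ} (hc : 0 < c) (hac : ∀ u, c * ‖u‖ ^ 2 ≤ (a u u).re)
    (haC : ∀ u, (a u u).re ≤ C * ‖u‖ ^ 2)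
    (hs0 : ∀ u, 0 ≤ (s u u).re) {C' : ℝ} (hC' : 0 ≤ C') (hsa : ∀ u, (s u u).re ≤ C' * (a u u).re)
    (hcpt : ∀ R : ℝ, ∀ x : ℕ → X, (∀ n, ‖x n‖ ≤ R) → ∃ f : ℕ → ℕ, StrictMono f ∧
      ∀ ε > 0, ∃ N, ∀ m ≥ N, ∀ n ≥ N, (s (x (f m) - x (f n)) (x (f m) - x (f n))).re < ε)
    {ι : Type*} [Fintype ι] {φ : ι → X} {lam : ι → ℝ}
    (heig : ∀ i v, a (φ i) v = lam i * s (φ i) v)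
    (ho : ∀ i k, i ≠ k → s (φ i) (φ k) = 0) (hn : ∀ i, s (φ i) (φ i) ≠ 0) {Λ : ℝ} (hΛ : 0 < Λ)
    (hgap : ∀ (r : ℝ) (u : X), (∀ v, a u v = r * s u v) → u ∈ orthTo s φ → u ≠ 0 → Λ ≤ r)
    {v : X} (hv : v ∈ orthTo s φ) : Λ * (s v v).re ≤ (a v v).re := by
  have ha0 : ∀ u, 0 ≤ (a u u).re := fun u => le_trans (by positivity) (hac u)
  set W := orthTo s φ with hW
  -- The supremum M of s under a ≤ 1 on the complement W is the reciprocal of the least Rayleigh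
  -- quotient there; the goal becomes ΛM ≤ 1.
  set B : Set ℝ := {r | ∃ w ∈ W, (a w w).re ≤ 1 ∧ (s w w).re = r} with hB
  have hBbdd : BddAbove B := ⟨C', by
    rintro _ ⟨w, _, h1, rfl⟩
    exact (hsa w).trans (mul_le_of_le_one_right hC' h1)⟩
  have hB0 : (0 : ℝ) ∈ B := ⟨0, W.zero_mem, by simp, by simp⟩
  set M := sSup B with hM
  have hM0 : 0 ≤ M := le_csSup hBbdd hB0
  have hsM : ∀ w ∈ W, (s w w).re ≤ M * (a w w).re := by
    intro w hw
    rcases (ha0 w).eq_or_lt with h0 | h0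
    · have := hsa w
      rw [← h0, mul_zero] at this
      rwa [← h0, mul_zero]
    · have hmem : (s w w).re / (a w w).re ∈ B := by
        refine ⟨((√(a w w).re)⁻¹ : ℝ) • w, W.smul_mem (((√(a w w).re)⁻¹ : ℝ) : ℂ) hw, ?_, ?_⟩ <;>
        · rw [← Complex.coe_smul, re_smul_self, Complex.norm_real, Real.norm_eq_abs, sq_abs,
            inv_pow, Real.sq_sqrt h0.le]
          field_simp
          try exact le_rfl
      rw [← div_le_iff₀ h0]
      exact le_csSup hBbdd hmem
  rcases hM0.eq_or_lt with h0 | hMpos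
  · have := hsM v hv
    rw [← h0, zero_mul] at this
    have := mul_nonpos_of_nonneg_of_nonpos hΛ.le this
    linarith [ha0 v]
  suffices hML : Λ * M ≤ 1 by
    calc Λ * (s v v).re ≤ Λ * (M * (a v v).re) := by gcongr; exact hsM v hv
      _ = Λ * M * (a v v).re := by ring
      _ ≤ 1 * (a v v).re := by gcongr; exact ha0 v
      _ = _ := one_mul _
  -- This form is nonnegative on W, and maximizing sequences are those along which it tends to zero.
  set q : Sesq X := (M : ℂ) • a - s with hq
  have hqre : ∀ u w, (q u w).re = M * (a u w).re - (s u w).re := by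
    intro u w
    simp [hq]
  have hqh : IsHerm q := by
    intro u w
    simp [hq, ha u w, hs u w]
  have hq0 : ∀ w ∈ W, 0 ≤ (q w w).re := fun w hw => by
    rw [hqre]; linarith [hsM w hw]
  have hseq : ∀ n : ℕ, ∃ w ∈ W, (a w w).re ≤ 1 ∧ M - 1 / ((n : ℝ) + 1) < (s w w).re := by
    intro n
    have hp : (0 : ℝ) < 1 / ((n : ℝ) + 1) := by positivity
    obtain ⟨_, ⟨w, hw, h1, rfl⟩, h2⟩ := exists_lt_of_lt_csSup ⟨0, hB0⟩
      (show M - 1 / ((n : ℝ) + 1) < sSup B by linarith)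
    exact ⟨w, hw, h1, h2⟩
  choose x hxW hxa hxs using hseq
  obtain ⟨f, hf, hCau⟩ := hcpt √(1 / c) x fun n => by
    refine Real.le_sqrt_of_sq_le ?_
    rw [le_div_iff₀ hc, mul_comm]
    exact (hac _).trans (hxa n)
  set y : ℕ → X := fun n => x (f n) with hy
  have hyW : ∀ n, y n ∈ W := fun n => hxW _
  have hyq : ∀ n, (q (y n) (y n)).re ≤ 1 / ((n : ℝ) + 1) := by
    intro n
    have h1 : 1 / ((f n : ℝ) + 1) ≤ 1 / ((n : ℝ) + 1) := by
      apply one_div_le_one_div_of_le (by positivity)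
      have : n ≤ f n := hf.le_apply
      gcongr
    have h2 := hxs (f n)
    have h3 := mul_le_of_le_one_right hMpos.le (hxa (f n))
    rw [hqre]
    simp only [hy]
    linarith
  have hlim0 := tendsto_one_div_add_atTop_nhds_zero_nat (𝕜 := ℝ)
  -- Compactness makes a subsequence Cauchy only for s. As q of a difference is at most 2q + 2q,
  -- which tends to zero, and M > 0, it is also Cauchy for a, hence in norm.
  have hcauchy : CauchySeq y := by
    rw [Metric.cauchySeq_iff]
    intro ε hε
    -- Four fifths go to the terms 2q(y m) + 2q(y n), and one fifth to the s-term.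
    have hpos : 0 < M * c * ε ^ 2 / 5 := by positivity
    obtain ⟨N1, hN1⟩ := hCau _ hpos
    obtain ⟨N2, hN2⟩ := (hlim0.eventually (gt_mem_nhds hpos)).exists
    refine ⟨max N1 N2, fun m hm n hn => ?_⟩
    have hstep : ∀ k ≥ max N1 N2, (q (y k) (y k)).re < M * c * ε ^ 2 / 5 := by
      intro k hk
      refine (hyq k).trans_lt (lt_of_le_of_lt ?_ hN2)
      apply one_div_le_one_div_of_le (by positivity)
      have : N2 ≤ k := (le_max_right _ _).trans hk
      gcongr
    have h1 := hqh.re_sub_le (hq0 _ (W.add_mem (hyW m) (hyW n)))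
    have h2 : (s (y m - y n) (y m - y n)).re < M * c * ε ^ 2 / 5 :=
      hN1 m ((le_max_left _ _).trans hm) n ((le_max_left _ _).trans hn)
    rw [hqre (y m - y n)] at h1
    have h3 := hstep m hm
    have h4 := hstep n hn
    have h5 : M * (c * ‖y m - y n‖ ^ 2) ≤ M * (a (y m - y n) (y m - y n)).re := by
      gcongr; exact hac _
    have h6 : M * c * ‖y m - y n‖ ^ 2 < M * c * ε ^ 2 := by linarith
    rw [dist_eq_norm]
    exact lt_of_pow_lt_pow_left₀ 2 hε.le (lt_of_mul_lt_mul_left h6 (by positivity))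
  obtain ⟨z, hz⟩ := cauchySeq_tendsto_of_complete hcauchy
  have haz : Tendsto (fun n => (a (z - y n) (z - y n)).re) atTop (𝓝 0) := by
    have h1 : Tendsto (fun n => C * ‖z - y n‖ ^ 2) atTop (𝓝 (C * ‖z - z‖ ^ 2)) :=
      ((tendsto_const_nhds.sub hz).norm.pow 2).const_mul C
    rw [sub_self, norm_zero, zero_pow two_ne_zero, mul_zero] at h1
    exact squeeze_zero (fun n => ha0 _) (fun n => haC _) h1
  have hsz : Tendsto (fun n => (s (z - y n) (z - y n)).re) atTop (𝓝 0) := by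
    have h1 := haz.const_mul C'
    rw [mul_zero] at h1
    exact squeeze_zero (fun n => hs0 _) (fun n => hsa _) h1
  have hzW : z ∈ W := by
    intro i
    have h1 : ∀ n, ‖s z (φ i)‖ ^ 2 ≤ (s (z - y n) (z - y n)).re * (s (φ i) (φ i)).re := by
      intro n
      have h2 := hs.norm_sq_le (x := z - y n) (y := φ i) (fun c => hs0 _) (hs0 _)
      rwa [map_sub, LinearMap.sub_apply, hyW n i, sub_zero, ← map_sub] at h2
    have h2 := ge_of_tendsto' (hsz.mul_const _) h1
    rw [zero_mul] at h2
    simpa using le_antisymm h2 (sq_nonneg _)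
  have hqz : (q z z).re = 0 := by
    refine le_antisymm ?_ (hq0 z hzW)
    have h1 : ∀ n : ℕ, (q z z).re ≤ 2 * (M * (a (z - y n) (z - y n)).re)
        + 2 * (1 / ((n : ℝ) + 1)) := by
      intro n
      -- The two vectors are chosen so that their difference is z, while q of the second one equals
      -- q of y n.
      have h2 := hqh.re_sub_le (x := z - y n) (y := -y n)
        (hq0 _ (W.add_mem (W.sub_mem hzW (hyW n)) (W.neg_mem (hyW n))))
      simp only [sub_neg_eq_add, sub_add_cancel, map_neg, LinearMap.neg_apply, neg_neg] at h2
      rw [hqre (z - y n)] at h2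
      linarith [hs0 (z - y n), hyq n]
    have h3 := ge_of_tendsto' (((haz.const_mul M).const_mul 2).add (hlim0.const_mul 2)) h1
    simpa using h3
  -- If z were zero, the values of s along the sequence would tend to zero, although they tend to M
  -- > 0.
  have hz0 : z ≠ 0 := by
    rintro rfl
    have h1 : ∀ n : ℕ, M ≤ (s (0 - y n) (0 - y n)).re + 1 / ((n : ℝ) + 1) := by
      intro n
      have h2 := hxs (f n)
      have h3 : 1 / ((f n : ℝ) + 1) ≤ 1 / ((n : ℝ) + 1) := by
        apply one_div_le_one_div_of_le (by positivity)
        have : n ≤ f n := hf.le_apply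
        gcongr
      simp only [zero_sub, map_neg, LinearMap.neg_apply, neg_neg, hy]
      linarith
    have h2 := ge_of_tendsto' (hsz.add hlim0) h1
    linarith
  -- On W this is Cauchy–Schwarz for the null vector z; on the span of the eigenvectors both forms
  -- vanish against z. Together the two parts make z an eigenvector with eigenvalue 1/M.
  have hqzv : ∀ w, q z w = 0 := by
    intro w
    have h1 : q z (w - projOn s φ w) = 0 :=
      hqh.eq_zero_of_null (fun c => hq0 _ (W.add_mem hzW
        (W.smul_mem c (sub_projOn_mem ho hn w))))
        (hq0 _ (sub_projOn_mem ho hn w)) hqz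
    have h2 : q z (projOn s φ w) = 0 := by
      refine form_projOn_right (fun i => ?_) w
      have h3 : a z (φ i) = 0 := by
        rw [ha (φ i) z, heig, hs z (φ i), hzW i]; simp
      simp [hq, h3, hzW i]
    rw [map_sub, h2, sub_zero] at h1
    exact h1
  have hgoal := hgap (1 / M) z (fun w => by
    have h1 := hqzv w
    simp only [hq, LinearMap.sub_apply, LinearMap.smul_apply, smul_eq_mul] at h1
    have hM' : (M : ℂ) ≠ 0 := by exact_mod_cast hMpos.ne'
    rw [sub_eq_zero] at h1
    rw [← h1]
    push_cast
    field_simp) hzW hz0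
  rwa [le_div_iff₀ hMpos] at hgoal

/-! ### Weighted `L²` forms -/

/-- A bounded, measurable and nonnegative weight on a measurable set. -/
structure IsWeight {d : ℕ} (U : Set (Pt d)) (μ : Pt d → ℝ) : Prop where
  measurableSet : MeasurableSet U
  measurable : Measurable μ
  nonneg : ∀ x ∈ U, 0 ≤ μ x
  bdd : ∃ C, ∀ x ∈ U, μ x ≤ C

section Forms

variable {d : ℕ} {U : Set (Pt d)} {μ : Pt d → ℝ}

theorem IsWeight.const (hU : MeasurableSet U) {c : ℝ} (hc : 0 ≤ c) : IsWeight U fun _ => c :=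
  ⟨hU, measurable_const, fun _ _ => hc, c, fun _ _ => le_rfl⟩

theorem IsWeight.integrable (h : IsWeight U μ) {f g : Pt d → ℂ}
    (hf : MemLp f 2 (volume.restrict U)) (hg : MemLp g 2 (volume.restrict U)) :
    Integrable (fun x => (μ x : ℂ) * f x * star (g x)) (volume.restrict U) := by
  obtain ⟨C, hC⟩ := h.bdd
  have h1 : Integrable (fun x => f x * star (g x)) (volume.restrict U) := hf.integrable_mul hg.star
  have h2 := h1.bdd_mul (c := C) (f := fun x => (μ x : ℂ))
    (Complex.measurable_ofReal.comp h.measurable).aestronglyMeasurable (by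
      filter_upwards [ae_restrict_mem h.measurableSet] with x hx
      rw [Complex.norm_real, Real.norm_of_nonneg (h.nonneg x hx)]
      exact hC x hx)
  simpa only [mul_assoc] using h2

theorem IsWeight.integrable_norm_sq (h : IsWeight U μ) {f : Pt d → ℂ}
    (hf : MemLp f 2 (volume.restrict U)) :
    Integrable (fun x => μ x * ‖f x‖ ^ 2) (volume.restrict U) := by
  have h1 := (h.integrable hf hf).re
  refine h1.congr (Eventually.of_forall fun x => ?_)
  simp only [mul_assoc]
  rw [show f x * star (f x) = ((‖f x‖ ^ 2 : ℝ) : ℂ) by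
    rw [Complex.star_def, Complex.mul_conj, Complex.normSq_eq_norm_sq], ← Complex.ofReal_mul]
  exact Complex.ofReal_re _

theorem sForm_self (f : Pt d → ℂ) : sForm μ U f f = ((∫ x in U, μ x * ‖f x‖ ^ 2 : ℝ) : ℂ) := by
  rw [← integral_complex_ofReal]
  refine integral_congr_ae (Eventually.of_forall fun x => ?_)
  simp only [mul_assoc]
  rw [show f x * star (f x) = ((‖f x‖ ^ 2 : ℝ) : ℂ) by
    rw [Complex.star_def, Complex.mul_conj, Complex.normSq_eq_norm_sq], ← Complex.ofReal_mul]

theorem sForm_self_re (f : Pt d → ℂ) : (sForm μ U f f).re = ∫ x in U, μ x * ‖f x‖ ^ 2 := by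
  rw [sForm_self, Complex.ofReal_re]

theorem sForm_congr {f f' g g' : Pt d → ℂ} (hf : f =ᵐ[volume.restrict U] f')
    (hg : g =ᵐ[volume.restrict U] g') : sForm μ U f g = sForm μ U f' g' := by
  refine integral_congr_ae ?_
  filter_upwards [hf, hg] with x h1 h2
  rw [h1, h2]

theorem sForm_comm (f g : Pt d → ℂ) : sForm μ U g f = star (sForm μ U f g) := by
  rw [sForm, sForm, Complex.star_def, ← integral_conj]
  refine integral_congr_ae (Eventually.of_forall fun x => ?_)
  simp
  ring

theorem IsWeight.sForm_add_left (h : IsWeight U μ) {f f' g : Pt d → ℂ}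
    (hf : MemLp f 2 (volume.restrict U)) (hf' : MemLp f' 2 (volume.restrict U))
    (hg : MemLp g 2 (volume.restrict U)) :
    sForm μ U (f + f') g = sForm μ U f g + sForm μ U f' g := by
  rw [sForm, sForm, sForm, ← integral_add (h.integrable hf hg) (h.integrable hf' hg)]
  refine integral_congr_ae (Eventually.of_forall fun x => ?_)
  simp only [Pi.add_apply]
  ring

theorem sForm_smul_left (c : ℂ) (f g : Pt d → ℂ) :
    sForm μ U (c • f) g = c * sForm μ U f g := by
  rw [sForm, sForm, ← integral_const_mul]
  refine integral_congr_ae (Eventually.of_forall fun x => ?_)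
  simp only [Pi.smul_apply, smul_eq_mul]
  ring

theorem IsWeight.sForm_add_right (h : IsWeight U μ) {f g g' : Pt d → ℂ}
    (hf : MemLp f 2 (volume.restrict U)) (hg : MemLp g 2 (volume.restrict U))
    (hg' : MemLp g' 2 (volume.restrict U)) :
    sForm μ U f (g + g') = sForm μ U f g + sForm μ U f g' := by
  rw [sForm_comm (g + g'), h.sForm_add_left hg hg' hf, star_add, ← sForm_comm, ← sForm_comm]

theorem sForm_smul_right (c : ℂ) (f g : Pt d → ℂ) :
    sForm μ U f (c • g) = star c * sForm μ U f g := by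
  rw [sForm_comm (c • g), sForm_smul_left, star_mul', ← sForm_comm]

theorem integral_norm_sq_Lp {α E : Type*} [MeasurableSpace α] {ν : Measure α}
    [NormedAddCommGroup E] (f : Lp E 2 ν) : ∫ x, ‖f x‖ ^ 2 ∂ν = ‖f‖ ^ 2 := by
  rw [integral_eq_lintegral_of_nonneg_ae (Eventually.of_forall fun x => by positivity)
    (by exact (Lp.aestronglyMeasurable f).norm.pow 2)]
  simp_rw [ENNReal.ofReal_pow (norm_nonneg _), ofReal_norm]
  rw [← enorm_Lp_sq, ENNReal.toReal_pow, toReal_enorm]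

theorem IsWeight.sForm_self_nonneg (h : IsWeight U μ) (f : Pt d → ℂ) : 0 ≤ (sForm μ U f f).re := by
  rw [sForm_self_re]
  exact setIntegral_nonneg h.measurableSet fun x hx => mul_nonneg (h.nonneg x hx) (by positivity)

/-! ### `H¹` elements -/

namespace H1

theorem memLp_fn (v : H1 U) : MemLp (fn v) 2 (volume.restrict U) := Lp.memLp _

theorem memLp_grad (v : H1 U) : MemLp (grad v) 2 (volume.restrict U) := Lp.memLp _

theorem memLp_grad_coord (v : H1 U) (i : Fin d) :
    MemLp (fun x => grad v x i) 2 (volume.restrict U) := memLp_coord (memLp_grad v) i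

theorem isWeakGradient (v : H1 U) : IsWeakGradient U (fn v) (grad v) := v.2

theorem fn_add (v w : H1 U) : fn (v + w) =ᵐ[volume.restrict U] fn v + fn w := Lp.coeFn_add _ _

theorem fn_sub (v w : H1 U) : fn (v - w) =ᵐ[volume.restrict U] fn v - fn w := Lp.coeFn_sub _ _

theorem fn_smul (c : ℂ) (v : H1 U) : fn (c • v) =ᵐ[volume.restrict U] c • fn v :=
  Lp.coeFn_smul _ _

theorem grad_add (v w : H1 U) : grad (v + w) =ᵐ[volume.restrict U] grad v + grad w :=
  Lp.coeFn_add _ _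

theorem grad_smul (c : ℂ) (v : H1 U) : grad (c • v) =ᵐ[volume.restrict U] c • grad v :=
  Lp.coeFn_smul _ _

theorem grad_add_coord (v w : H1 U) (i : Fin d) : (fun x => grad (v + w) x i)
    =ᵐ[volume.restrict U] (fun x => grad v x i) + fun x => grad w x i :=
  (grad_add v w).mono fun x hx => by simp [hx]

theorem grad_smul_coord (c : ℂ) (v : H1 U) (i : Fin d) : (fun x => grad (c • v) x i)
    =ᵐ[volume.restrict U] c • fun x => grad v x i :=
  (grad_smul c v).mono fun x hx => by simp [hx]

/-- The element of `H¹` given by a function and its weak gradient. -/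
def mk {u : Pt d → ℂ} {g : Pt d → EuclideanSpace ℂ (Fin d)} (hu : MemLp u 2 (volume.restrict U))
    (hg : MemLp g 2 (volume.restrict U)) (h : IsWeakGradient U u g) : H1 U :=
  ⟨(hu.toLp u, hg.toLp g), h.congr hu.coeFn_toLp.symm hg.coeFn_toLp.symm⟩

theorem fn_mk {u : Pt d → ℂ} {g : Pt d → EuclideanSpace ℂ (Fin d)}
    (hu : MemLp u 2 (volume.restrict U)) (hg : MemLp g 2 (volume.restrict U))
    (h : IsWeakGradient U u g) : fn (mk hu hg h) =ᵐ[volume.restrict U] u := hu.coeFn_toLp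

theorem grad_mk {u : Pt d → ℂ} {g : Pt d → EuclideanSpace ℂ (Fin d)}
    (hu : MemLp u 2 (volume.restrict U)) (hg : MemLp g 2 (volume.restrict U))
    (h : IsWeakGradient U u g) : grad (mk hu hg h) =ᵐ[volume.restrict U] g := hg.coeFn_toLp

theorem ext_ae {v w : H1 U} (h1 : fn v =ᵐ[volume.restrict U] fn w)
    (h2 : grad v =ᵐ[volume.restrict U] grad w) : v = w :=
  Subtype.ext (Prod.ext (Lp.ext h1) (Lp.ext h2))

/-- For a fixed test function both sides of the defining identity are continuous in L², being inner
products with the test function or its derivative. So the space is an intersection of closed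
conditions, hence complete. -/
theorem isClosed : IsClosed (H1 U : Set (Lp ℂ 2 (volume.restrict U) ×
    Lp (EuclideanSpace ℂ (Fin d)) 2 (volume.restrict U))) := by
  have key : ∀ θ : Pt d → ℝ, Continuous θ → HasCompactSupport θ →
      Continuous fun f : Lp ℂ 2 (volume.restrict U) => ∫ x in U, θ x • f x := by
    intro θ hθ hc
    have h2 : MemLp (fun x => (θ x : ℂ)) 2 (volume.restrict U) :=
      (hθ.memLp_of_hasCompactSupport (p := 2) (μ := volume.restrict U) hc).ofReal
    have h3 : (fun f : Lp ℂ 2 (volume.restrict U) => ∫ x in U, θ x • f x)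
        = fun f => inner ℂ (h2.toLp _) f := by
      ext f
      rw [L2.inner_def]
      refine integral_congr_ae ?_
      filter_upwards [h2.coeFn_toLp] with x hx
      rw [hx]
      simp [Complex.real_smul, mul_comm]
    rw [h3]
    exact continuous_const.inner continuous_id
  have hset : (H1 U : Set (Lp ℂ 2 (volume.restrict U) ×
      Lp (EuclideanSpace ℂ (Fin d)) 2 (volume.restrict U)))
      = ⋂ (φ : Pt d → ℝ) (_ : ContDiff ℝ ∞ φ) (_ : HasCompactSupport φ) (_ : tsupport φ ⊆ U)
        (i : Fin d), {p | ∫ x in U, (fderiv ℝ φ x (EuclideanSpace.single i 1)) • p.1 x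
          = - ∫ x in U, (φ x) • (p.2 x) i} := by
    ext p
    simp only [mem_iInter]
    exact Iff.rfl
  rw [hset]
  refine isClosed_iInter fun φ => isClosed_iInter fun hφ => isClosed_iInter fun hc =>
    isClosed_iInter fun _ => isClosed_iInter fun i => isClosed_eq ?_ ?_
  · exact (key _ (continuous_test_deriv hφ _) (hasCompactSupport_test_deriv hc _)).comp
      continuous_fst
  · have h1 := (key φ hφ.continuous hc).comp
      (((EuclideanSpace.proj i : EuclideanSpace ℂ (Fin d) →L[ℂ] ℂ).compLpL 2
        (volume.restrict U)).continuous)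
    have h2 : (fun p : Lp ℂ 2 (volume.restrict U) ×
        Lp (EuclideanSpace ℂ (Fin d)) 2 (volume.restrict U) => -∫ x in U, (φ x) • (p.2 x) i)
        = fun p => -(((fun f : Lp ℂ 2 (volume.restrict U) => ∫ x in U, φ x • f x) ∘
          ((EuclideanSpace.proj i : EuclideanSpace ℂ (Fin d) →L[ℂ] ℂ).compLpL 2
            (volume.restrict U))) p.2) := by
      ext p
      congr 1
      refine integral_congr_ae ?_
      filter_upwards [ContinuousLinearMap.coeFn_compLpL
        (EuclideanSpace.proj i : EuclideanSpace ℂ (Fin d) →L[ℂ] ℂ) p.2] with x hx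
      rw [hx]
      rfl
    rw [h2]
    exact (h1.comp continuous_snd).neg

instance : CompleteSpace (H1 U) := isClosed.completeSpace_coe

end H1

/-! ### The forms of the problem as sesquilinear forms on `H¹` -/

/-- `s` as a sesquilinear form on `H¹`. -/
def IsWeight.sSesq (h : IsWeight U μ) : Sesq (H1 U) :=
  LinearMap.mk₂'ₛₗ (RingHom.id ℂ) (starRingEnd ℂ) (fun w v => sForm μ U (H1.fn w) (H1.fn v))
    (fun w w' v => by
      rw [sForm_congr (H1.fn_add w w') (ae_eq_refl _),
        h.sForm_add_left (H1.memLp_fn w) (H1.memLp_fn w') (H1.memLp_fn v)])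
    (fun c w v => by
      rw [sForm_congr (H1.fn_smul c w) (ae_eq_refl _), sForm_smul_left]; rfl)
    (fun w v v' => by
      rw [sForm_congr (ae_eq_refl _) (H1.fn_add v v'),
        h.sForm_add_right (H1.memLp_fn w) (H1.memLp_fn v) (H1.memLp_fn v')])
    (fun c w v => by
      rw [sForm_congr (ae_eq_refl _) (H1.fn_smul c v), sForm_smul_right]; rfl)

theorem IsWeight.sSesq_apply (h : IsWeight U μ) (w v : H1 U) :
    h.sSesq w v = sForm μ U (H1.fn w) (H1.fn v) := rfl

theorem IsWeight.isHerm_sSesq (h : IsWeight U μ) : IsHerm h.sSesq := fun _ _ => sForm_comm _ _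

/-- The Dirichlet form of a partial derivative as a sesquilinear form on `H¹`. -/
def IsWeight.dSesq (h : IsWeight U μ) (i : Fin d) : Sesq (H1 U) :=
  LinearMap.mk₂'ₛₗ (RingHom.id ℂ) (starRingEnd ℂ)
    (fun w v => sForm μ U (fun x => H1.grad w x i) (fun x => H1.grad v x i))
    (fun w w' v => by
      rw [sForm_congr (H1.grad_add_coord w w' i) (ae_eq_refl _),
        h.sForm_add_left (H1.memLp_grad_coord w i) (H1.memLp_grad_coord w' i) (H1.memLp_grad_coord v i)])
    (fun c w v => by
      rw [sForm_congr (H1.grad_smul_coord c w i) (ae_eq_refl _), sForm_smul_left]; rfl)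
    (fun w v v' => by
      rw [sForm_congr (ae_eq_refl _) (H1.grad_add_coord v v' i),
        h.sForm_add_right (H1.memLp_grad_coord w i) (H1.memLp_grad_coord v i) (H1.memLp_grad_coord v' i)])
    (fun c w v => by
      rw [sForm_congr (ae_eq_refl _) (H1.grad_smul_coord c v i), sForm_smul_right]; rfl)

variable {V : Pt d → ℝ} (ε : ℝ)

/-- `a` as a sesquilinear form on `H¹`. -/
def IsWeight.aSesq (hV : IsWeight U V) : Sesq (H1 U) :=
  ∑ i, (IsWeight.const hV.measurableSet (c := ε ^ 2 / 2) (by positivity)).dSesq i + hV.sSesq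

theorem IsWeight.integrable_aForm (hV : IsWeight U V) (w v : H1 U) :
    Integrable (fun x => ((ε ^ 2 / 2 : ℝ) : ℂ) * ∑ i, H1.grad w x i * star (H1.grad v x i)
      + (V x : ℂ) * H1.fn w x * star (H1.fn v x)) (volume.restrict U) := by
  refine Integrable.add ?_ (hV.integrable (H1.memLp_fn w) (H1.memLp_fn v))
  simp_rw [Finset.mul_sum, ← mul_assoc]
  exact integrable_finsetSum _ fun i _ => (IsWeight.const hV.measurableSet (c := ε ^ 2 / 2)
    (by positivity)).integrable (H1.memLp_grad_coord w i) (H1.memLp_grad_coord v i)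

theorem IsWeight.aSesq_apply (hV : IsWeight U V) (w v : H1 U) :
    hV.aSesq ε w v = aForm ε V w v := by
  have hc := IsWeight.const hV.measurableSet (c := ε ^ 2 / 2) (by positivity)
  have hi : ∀ i ∈ Finset.univ, Integrable (fun x => ((ε ^ 2 / 2 : ℝ) : ℂ) * H1.grad w x i *
      star (H1.grad v x i)) (volume.restrict U) := fun i _ =>
    hc.integrable (H1.memLp_grad_coord w i) (H1.memLp_grad_coord v i)
  have h1 : aForm ε V w v = ∫ x in U, (∑ i, ((ε ^ 2 / 2 : ℝ) : ℂ) * H1.grad w x i *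
      star (H1.grad v x i) + (V x : ℂ) * H1.fn w x * star (H1.fn v x)) := by
    simp_rw [aForm, Finset.mul_sum, ← mul_assoc]
  rw [h1, integral_add (integrable_finsetSum _ hi)
    (hV.integrable (H1.memLp_fn w) (H1.memLp_fn v)), integral_finsetSum _ hi]
  simp only [aSesq, LinearMap.add_apply, LinearMap.sum_apply]
  rfl

theorem IsWeight.isHerm_aSesq (hV : IsWeight U V) : IsHerm (hV.aSesq ε) := by
  intro u v
  simp only [aSesq, LinearMap.add_apply, LinearMap.sum_apply, star_add, star_sum]
  congr 1
  · exact Finset.sum_congr rfl fun i _ => sForm_comm _ _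
  · exact sForm_comm _ _

theorem IsWeight.integrable_energy (hV : IsWeight U V) (v : H1 U) :
    Integrable (fun x => ε ^ 2 / 2 * ‖H1.grad v x‖ ^ 2 + V x * ‖H1.fn v x‖ ^ 2)
      (volume.restrict U) :=
  ((H1.memLp_grad v).integrable_norm_pow (by norm_num)).const_mul _ |>.add
    (hV.integrable_norm_sq (H1.memLp_fn v))

theorem IsWeight.aSesq_self_re (hV : IsWeight U V) (v : H1 U) :
    (hV.aSesq ε v v).re
      = ∫ x in U, (ε ^ 2 / 2 * ‖H1.grad v x‖ ^ 2 + V x * ‖H1.fn v x‖ ^ 2) := by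
  rw [hV.aSesq_apply, aForm]
  refine (integral_re (hV.integrable_aForm ε v v)).symm.trans ?_
  refine integral_congr_ae (Eventually.of_forall fun x => ?_)
  simp only
  have h1 : ∑ i, H1.grad v x i * star (H1.grad v x i) = ((‖H1.grad v x‖ ^ 2 : ℝ) : ℂ) := by
    rw [EuclideanSpace.norm_sq_eq, Complex.ofReal_sum]
    refine Finset.sum_congr rfl fun i _ => ?_
    rw [Complex.star_def, Complex.mul_conj, Complex.normSq_eq_norm_sq]
  have h2 : H1.fn v x * star (H1.fn v x) = ((‖H1.fn v x‖ ^ 2 : ℝ) : ℂ) := by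
    rw [Complex.star_def, Complex.mul_conj, Complex.normSq_eq_norm_sq]
  rw [h1, mul_assoc, h2, ← Complex.ofReal_mul, ← Complex.ofReal_mul, ← Complex.ofReal_add]
  exact Complex.ofReal_re _

theorem IsWeight.aSesq_self_eq (hV : IsWeight U V) (v : H1 U) :
    (hV.aSesq ε v v).re = ε ^ 2 / 2 * ‖v.1.2‖ ^ 2 + ∫ x in U, V x * ‖H1.fn v x‖ ^ 2 := by
  rw [hV.aSesq_self_re, integral_add (((H1.memLp_grad v).integrable_norm_pow (by norm_num)).const_mul _)
    (hV.integrable_norm_sq (H1.memLp_fn v)), integral_const_mul]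
  congr 2
  exact integral_norm_sq_Lp v.1.2

theorem IsWeight.le_integral (hV : IsWeight U μ) {m : ℝ} (hm : ∀ x ∈ U, m ≤ μ x) (v : H1 U) :
    m * ‖v.1.1‖ ^ 2 ≤ ∫ x in U, μ x * ‖H1.fn v x‖ ^ 2 := by
  rw [← integral_norm_sq_Lp, ← integral_const_mul]
  refine setIntegral_mono_on (((H1.memLp_fn v).integrable_norm_pow (by norm_num)).const_mul _)
    (hV.integrable_norm_sq (H1.memLp_fn v)) hV.measurableSet fun x hx => ?_
  exact mul_le_mul_of_nonneg_right (hm x hx) (sq_nonneg _)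

theorem IsWeight.integral_le (hV : IsWeight U μ) {m : ℝ} (hm : ∀ x ∈ U, μ x ≤ m) (v : H1 U) :
    ∫ x in U, μ x * ‖H1.fn v x‖ ^ 2 ≤ m * ‖v.1.1‖ ^ 2 := by
  rw [← integral_norm_sq_Lp, ← integral_const_mul]
  refine setIntegral_mono_on (hV.integrable_norm_sq (H1.memLp_fn v))
    (((H1.memLp_fn v).integrable_norm_pow (by norm_num)).const_mul _) hV.measurableSet fun x hx => ?_
  exact mul_le_mul_of_nonneg_right (hm x hx) (sq_nonneg _)

theorem IsWeight.aSesq_self_nonneg (hV : IsWeight U V) (v : H1 U) : 0 ≤ (hV.aSesq ε v v).re := by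
  rw [hV.aSesq_self_re]
  exact setIntegral_nonneg hV.measurableSet fun x hx => by
    have := hV.nonneg x hx
    positivity

theorem IsWeight.exists_le_aSesq (hV : IsWeight U V) {ε : ℝ} (hε : 0 < ε) {m : ℝ} (hm : 0 < m)
    (hVm : ∀ x ∈ U, m ≤ V x) : ∃ c : ℝ, 0 < c ∧ ∀ v : H1 U, c * ‖v‖ ^ 2 ≤ (hV.aSesq ε v v).re := by
  refine ⟨min (ε ^ 2 / 2) m, by positivity, fun v => ?_⟩
  rw [hV.aSesq_self_eq]
  have h1 := hV.le_integral hVm v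
  -- The norm inherited from the product is the maximum of the two L² norms, hence the case
  -- distinction below.
  have hn : ‖v‖ = max ‖v.1.1‖ ‖v.1.2‖ := rfl
  have hp := sq_nonneg ‖v.1.1‖
  have hp' := sq_nonneg ‖v.1.2‖
  have hε2 : 0 < ε ^ 2 / 2 := by positivity
  rw [hn]
  rcases max_choice ‖v.1.1‖ ‖v.1.2‖ with h | h <;> rw [h]
  · calc min (ε ^ 2 / 2) m * ‖v.1.1‖ ^ 2 ≤ m * ‖v.1.1‖ ^ 2 := by gcongr; exact min_le_right _ _
      _ ≤ _ := by nlinarith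
  · calc min (ε ^ 2 / 2) m * ‖v.1.2‖ ^ 2 ≤ ε ^ 2 / 2 * ‖v.1.2‖ ^ 2 := by
          gcongr; exact min_le_left _ _
      _ ≤ _ := by nlinarith

theorem IsWeight.exists_aSesq_le (hV : IsWeight U V) :
    ∃ C : ℝ, ∀ v : H1 U, (hV.aSesq ε v v).re ≤ C * ‖v‖ ^ 2 := by
  obtain ⟨C, hC⟩ := hV.bdd
  refine ⟨ε ^ 2 / 2 + max C 0, fun v => ?_⟩
  rw [hV.aSesq_self_eq]
  have h1 := hV.integral_le (fun x hx => (hC x hx).trans (le_max_left _ 0)) v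
  have hn1 : ‖v.1.1‖ ≤ ‖v‖ := le_max_left _ _
  have hn2 : ‖v.1.2‖ ≤ ‖v‖ := le_max_right _ _
  calc _ ≤ ε ^ 2 / 2 * ‖v.1.2‖ ^ 2 + max C 0 * ‖v.1.1‖ ^ 2 := by gcongr
    _ ≤ ε ^ 2 / 2 * ‖v‖ ^ 2 + max C 0 * ‖v‖ ^ 2 := by gcongr
    _ = _ := by ring

end Forms

theorem IsWeight.mono {d : ℕ} {U U' : Set (Pt d)} {μ : Pt d → ℝ} (h : IsWeight U μ)
    (hU' : MeasurableSet U') (hs : U' ⊆ U) : IsWeight U' μ :=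
  ⟨hU', h.measurable, fun x hx => h.nonneg x (hs hx), h.bdd.imp fun _ hC x hx => hC x (hs hx)⟩

namespace Mesh

variable {d : ℕ} {Ω : Set (Pt d)} {N : ℕ} (T : Mesh Ω N)

theorem weight_eq (ε : ℝ) {j : Fin N} {x : Pt d} (hx : x ∈ (T.cell j).openSet) :
    T.weight ε x = ∑ v, ε ^ 2 / 2 * ‖gradient ((T.cell j).lagrange v) x‖ ^ 2 := by
  rw [weight, Finset.sum_eq_single j]
  · exact indicator_of_mem hx _
  · intro k _ hkj
    exact indicator_of_notMem (fun h => Set.disjoint_left.1 (T.disjoint k j hkj) h hx) _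
  · simp

theorem isWeight_weight (ε : ℝ) {U : Set (Pt d)} (hU : MeasurableSet U) :
    IsWeight U (T.weight ε) := by
  choose c hc0 hc using fun j => (T.cell j).exists_norm_gradient_lagrange_le
  refine ⟨hU, ?_, fun x _ => ?_, ∑ j, ∑ _v : (T.cell j).kind.Vertex d, ε ^ 2 / 2 * c j ^ 2,
    fun x _ => ?_⟩
  · refine Finset.measurable_sum _ fun j _ => Measurable.indicator ?_
      (T.cell j).isOpen_openSet.measurableSet
    exact Finset.measurable_sum _ fun v _ => ((Cell.measurable_gradient.norm.pow_const 2).const_mul _)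
  · exact Finset.sum_nonneg fun j _ => indicator_nonneg (fun x _ => Finset.sum_nonneg fun v _ => by
      positivity) x
  · refine Finset.sum_le_sum fun j _ => ?_
    by_cases hx : x ∈ (T.cell j).openSet
    · rw [indicator_of_mem hx]
      refine Finset.sum_le_sum fun v _ => ?_
      gcongr
      exact hc j v x hx
    · rw [indicator_of_notMem hx]
      exact Finset.sum_nonneg fun v _ => by positivity

theorem measurableSet_openSet (j : Fin N) : MeasurableSet (T.cell j).openSet :=
  (T.cell j).isOpen_openSet.measurableSet

end Mesh

/-! ### The spectral gap of the local eigenvalue problems. -/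

section Eigen

variable {d : ℕ} {Ω : Set (Pt d)} {N : ℕ} {T : Mesh Ω N} {ε : ℝ} {V : Pt d → ℝ} {j : Fin N}

/-- `s_j` as a sesquilinear form. -/
abbrev sCell (T : Mesh Ω N) (ε : ℝ) (j : Fin N) : Sesq (H1 (T.cell j).openSet) :=
  (T.isWeight_weight ε (T.measurableSet_openSet j)).sSesq

theorem EigenSystem.eigen_eq (S : EigenSystem T ε V j) (hV : IsWeight (T.cell j).openSet V) (i : ℕ)
    (v : H1 (T.cell j).openSet) :
    hV.aSesq ε (S.eigfun i) v = S.eigval i * sCell T ε j (S.eigfun i) v := by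
  rw [hV.aSesq_apply]
  exact S.isEigenpair i v

/-- Coercivity makes a positive on an eigenfunction. As a is λ times s there and s is nonnegative,
both factors are positive. So s, known only to be semidefinite, does not degenerate on
eigenfunctions. -/
theorem EigenSystem.pos (S : EigenSystem T ε V j) (hε : 0 < ε)
    (hV : IsWeight (T.cell j).openSet V) {m : ℝ} (hm : 0 < m)
    (hVm : ∀ x ∈ (T.cell j).openSet, m ≤ V x) (i : ℕ) :
    0 < S.eigval i ∧ 0 < (sCell T ε j (S.eigfun i) (S.eigfun i)).re := by
  obtain ⟨c, hc, hac⟩ := hV.exists_le_aSesq hε hm hVm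
  have h1 : 0 < (hV.aSesq ε (S.eigfun i) (S.eigfun i)).re := by
    have := norm_pos_iff.2 (S.ne_zero i)
    exact lt_of_lt_of_le (by positivity) (hac _)
  rw [S.eigen_eq hV, Complex.re_ofReal_mul] at h1
  have h2 : 0 ≤ (sCell T ε j (S.eigfun i) (S.eigfun i)).re :=
    (T.isWeight_weight ε (T.measurableSet_openSet j)).sForm_self_nonneg _
  constructor
  · by_contra! h
    exact absurd h1 (not_lt.2 (mul_nonpos_of_nonpos_of_nonneg h h2))
  · refine lt_of_le_of_ne h2 fun h => ?_
    rw [← h, mul_zero] at h1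
    exact lt_irrefl _ h1

theorem Cell.exists_subseq_fst_cauchy (K : Cell d) (R : ℝ) (x : ℕ → H1 K.openSet)
    (hx : ∀ n, ‖x n‖ ≤ R) :
    ∃ f : ℕ → ℕ, StrictMono f ∧ CauchySeq fun n => (x (f n)).1.1 := by
  have htb := K.totallyBounded_fst_H1 (ENNReal.ofReal (R ^ 2)) ENNReal.ofReal_ne_top
  have hcl := htb.closure.isCompact_of_isClosed isClosed_closure
  have hmem : ∀ n, (x n).1.1 ∈ closure {f : Lp ℂ 2 (volume.restrict K.openSet) |
      ∃ p : H1 K.openSet, p.1.1 = f ∧ ‖p.1.1‖ₑ ^ 2 ≤ ENNReal.ofReal (R ^ 2)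
        ∧ ‖p.1.2‖ₑ ^ 2 ≤ ENNReal.ofReal (R ^ 2)} := by
    intro n
    refine subset_closure ⟨x n, rfl, ?_, ?_⟩
    · rw [← ofReal_norm, ← ENNReal.ofReal_pow (norm_nonneg _)]
      refine ENNReal.ofReal_le_ofReal ?_
      gcongr
      exact (le_max_left _ _).trans (hx n)
    · rw [← ofReal_norm, ← ENNReal.ofReal_pow (norm_nonneg _)]
      refine ENNReal.ofReal_le_ofReal ?_
      gcongr
      exact (le_max_right _ _).trans (hx n)
  obtain ⟨_, -, f, hf, hlim⟩ := hcl.tendsto_subseq hmem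
  exact ⟨f, hf, hlim.cauchySeq⟩

theorem IsWeight.exists_sSesq_le {U : Set (Pt d)} {μ : Pt d → ℝ} (hμ : IsWeight U μ) :
    ∃ C : ℝ, 0 < C ∧ ∀ u : H1 U, (hμ.sSesq u u).re ≤ C * ‖u.1.1‖ ^ 2 :=
  hμ.bdd.elim fun C hC => ⟨|C| + 1, by positivity, fun u =>
    (sForm_self_re (U := U) (μ := μ) (H1.fn u)).trans_le (hμ.integral_le
      (fun x hx => (hC x hx).trans ((le_abs_self C).trans (by linarith))) u)⟩

theorem lt_of_le_mul_sq {C δ a x : ℝ} (hC : 0 < C) (hδ : 0 < δ) (hx : 0 ≤ x)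
    (hxδ : x < √(δ / C)) (ha : a ≤ C * x ^ 2) : a < δ := by
  have h3 : x ^ 2 < √(δ / C) ^ 2 := by gcongr
  rw [Real.sq_sqrt (by positivity), lt_div_iff₀ hC] at h3
  linarith

theorem Cell.exists_subseq_sForm_cauchy (K : Cell d) {μ : Pt d → ℝ} (hμ : IsWeight K.openSet μ)
    (R : ℝ) (x : ℕ → H1 K.openSet) (hx : ∀ n, ‖x n‖ ≤ R) : ∃ f : ℕ → ℕ, StrictMono f ∧
      ∀ δ > 0, ∃ N, ∀ m ≥ N, ∀ n ≥ N,
        (hμ.sSesq (x (f m) - x (f n)) (x (f m) - x (f n))).re < δ :=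
  (K.exists_subseq_fst_cauchy R x hx).elim fun f hf => ⟨f, hf.1, fun δ hδ =>
    hμ.exists_sSesq_le.elim fun C hC =>
      (Metric.cauchySeq_iff.1 hf.2 (√(δ / C)) (Real.sqrt_pos.2 (div_pos hδ hC.1))).elim
        fun N hN => ⟨N, fun m hm n hn => lt_of_le_mul_sq hC.1 hδ (norm_nonneg _)
          ((dist_eq_norm _ _).symm.trans_lt (hN m hm n hn)) (hC.2 _)⟩⟩

theorem sCell_self_nonneg (u : H1 (T.cell j).openSet) : 0 ≤ (sCell T ε j u u).re :=
  (T.isWeight_weight ε (T.measurableSet_openSet j)).sForm_self_nonneg _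

theorem isHerm_sCell : IsHerm (sCell T ε j) :=
  (T.isWeight_weight ε (T.measurableSet_openSet j)).isHerm_sSesq

theorem EigenSystem.orthogonal_fin (S : EigenSystem T ε V j) (n : ℕ) (i k : Fin n) (hik : i ≠ k) :
    sCell T ε j (S.eigfun i) (S.eigfun k) = 0 :=
  S.orthogonal i k fun h => hik (Fin.ext h)

theorem EigenSystem.sCell_eigfun_ne_zero (S : EigenSystem T ε V j) (hε : 0 < ε)
    (hV : IsWeight (T.cell j).openSet V) {m : ℝ} (hm : 0 < m)
    (hVm : ∀ x ∈ (T.cell j).openSet, m ≤ V x) (i : ℕ) :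
    sCell T ε j (S.eigfun i) (S.eigfun i) ≠ 0 :=
  fun h => (S.pos hε hV hm hVm i).2.ne' (congrArg Complex.re h)

theorem le_div_mul_of_le_sq {C c x y a b : ℝ} (hC : 0 < C) (hc : 0 < c) (hx : 0 ≤ x) (hxy : x ≤ y)
    (ha : a ≤ C * x ^ 2) (hb : c * y ^ 2 ≤ b) : a ≤ C / c * b :=
  calc a ≤ C * y ^ 2 := ha.trans (by gcongr)
    _ = C / c * (c * y ^ 2) := by field_simp
    _ ≤ _ := by gcongr

/-- The min-max principle, with compactness from Rellich's theorem and the lower bound on further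
eigenvalues from exhaustiveness of the list. -/
theorem EigenSystem.gap (S : EigenSystem T ε V j) (hε : 0 < ε)
    (hV : IsWeight (T.cell j).openSet V) {m : ℝ} (hm : 0 < m)
    (hVm : ∀ x ∈ (T.cell j).openSet, m ≤ V x) (n : ℕ) (v : H1 (T.cell j).openSet)
    (hv : v ∈ orthTo (sCell T ε j) fun i : Fin n => S.eigfun i) :
    S.eigval n * (sCell T ε j v v).re ≤ (hV.aSesq ε v v).re :=
  (hV.exists_le_aSesq hε hm hVm).elim fun _ hc => (hV.exists_aSesq_le ε).elim fun _ haC =>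
    (T.isWeight_weight ε (T.measurableSet_openSet j)).exists_sSesq_le.elim fun _ hD =>
      mul_re_le_of_eigenvalue_gap (hV.isHerm_aSesq ε) isHerm_sCell hc.1 hc.2 haC sCell_self_nonneg
        (div_pos hD.1 hc.1).le
        (fun u => le_div_mul_of_le_sq hD.1 hc.1 (norm_nonneg _) (le_max_left _ _) (hD.2 u) (hc.2 u))
        ((T.cell j).exists_subseq_sForm_cauchy
          (T.isWeight_weight ε (T.measurableSet_openSet j)))
        (lam := fun i : Fin n => S.eigval i) (fun i v => S.eigen_eq hV i v) (S.orthogonal_fin n)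
        (fun i => S.sCell_eigfun_ne_zero hε hV hm hVm i) (S.pos hε hV hm hVm n).1
        (fun _ _ hu huo hu0 => le_of_exhaustive isHerm_sCell
          (fun w hw => (mul_pos hc.1 (pow_pos (norm_pos_iff.2 hw) 2)).trans_le (hc.2 w))
          S.monotone
          (fun r u hu => S.exhaustive r u fun v => (hV.aSesq_apply ε u v).symm.trans (hu v))
          hu huo hu0) hv

/-- The local spectral projection. -/
def EigenSystem.proj (S : EigenSystem T ε V j) (n : ℕ) :
    H1 (T.cell j).openSet →ₗ[ℂ] H1 (T.cell j).openSet :=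
  projOn (sCell T ε j) fun i : Fin n => S.eigfun i

theorem EigenSystem.proj_le (S : EigenSystem T ε V j) (hε : 0 < ε)
    (hV : IsWeight (T.cell j).openSet V) {m : ℝ} (hm : 0 < m)
    (hVm : ∀ x ∈ (T.cell j).openSet, m ≤ V x) (n : ℕ) (u : H1 (T.cell j).openSet) :
    (sCell T ε j (S.proj n u) (S.proj n u)).re ≤ (sCell T ε j u u).re :=
  re_projOn_le isHerm_sCell sCell_self_nonneg (S.orthogonal_fin n)
    (fun i => S.sCell_eigfun_ne_zero hε hV hm hVm i) u

theorem EigenSystem.le_proj_add (S : EigenSystem T ε V j) (hε : 0 < ε)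
    (hV : IsWeight (T.cell j).openSet V) {m : ℝ} (hm : 0 < m)
    (hVm : ∀ x ∈ (T.cell j).openSet, m ≤ V x) (n : ℕ) {Λ : ℝ} (hΛ : 0 < Λ) (hΛn : Λ ≤ S.eigval n)
    (u : H1 (T.cell j).openSet) :
    (sCell T ε j u u).re
      ≤ (sCell T ε j (S.proj n u) (S.proj n u)).re + (hV.aSesq ε u u).re / Λ :=
  re_self_le_projOn_add (hV.isHerm_aSesq ε) isHerm_sCell (hV.aSesq_self_nonneg ε)
    (lam := fun i : Fin n => S.eigval i) (fun i v => S.eigen_eq hV i v) (S.orthogonal_fin n)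
    (fun i => S.sCell_eigfun_ne_zero hε hV hm hVm i) hΛ
    (fun v hv => (mul_le_mul_of_nonneg_right hΛn (sCell_self_nonneg v)).trans
      (S.gap hε hV hm hVm n v hv)) u

end Eigen

/-! ### Restriction of `H¹` functions -/

namespace H1

variable {d : ℕ} {Ω U : Set (Pt d)}

theorem isWeakGradient_restrict (hΩ : MeasurableSet Ω) (hs : U ⊆ Ω)
    {u : Pt d → ℂ} {g : Pt d → EuclideanSpace ℂ (Fin d)} (h : IsWeakGradient Ω u g) :
    IsWeakGradient U u g := by
  intro φ hφ hc hsupp i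
  have h1 := h φ hφ hc (hsupp.trans hs) i
  have h0 : ∀ x ∉ U, φ x = 0 := fun x hx => image_eq_zero_of_notMem_tsupport fun h => hx (hsupp h)
  have h0' : ∀ x ∉ U, fderiv ℝ φ x = 0 := fun x hx =>
    image_eq_zero_of_notMem_tsupport fun h => hx (hsupp (tsupport_fderiv_subset ℝ h))
  rwa [setIntegral_eq_of_subset_of_forall_sdiff_eq_zero hΩ hs
      (fun x hx => by rw [h0' x hx.2]; simp),
    setIntegral_eq_of_subset_of_forall_sdiff_eq_zero hΩ hs
      (fun x hx => by rw [h0 x hx.2]; simp)] at h1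

theorem ae_restrict_mono {p : Pt d → Prop} (hs : U ⊆ Ω) (h : ∀ᵐ x ∂(volume.restrict Ω), p x) :
    ∀ᵐ x ∂(volume.restrict U), p x :=
  MeasureTheory.ae_mono (Measure.restrict_mono hs le_rfl) h

/-- The restriction of an `H¹(Ω)` function to a subset. -/
def resFun (hΩ : MeasurableSet Ω) (hs : U ⊆ Ω) (v : H1 Ω) : H1 U :=
  mk ((memLp_fn v).mono_measure (Measure.restrict_mono hs le_rfl))
    ((memLp_grad v).mono_measure (Measure.restrict_mono hs le_rfl))
    (isWeakGradient_restrict hΩ hs (isWeakGradient v))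

theorem fn_resFun (hΩ : MeasurableSet Ω) (hs : U ⊆ Ω) (v : H1 Ω) :
    fn (resFun hΩ hs v) =ᵐ[volume.restrict U] fn v := fn_mk _ _ _

theorem grad_resFun (hΩ : MeasurableSet Ω) (hs : U ⊆ Ω) (v : H1 Ω) :
    grad (resFun hΩ hs v) =ᵐ[volume.restrict U] grad v := grad_mk _ _ _

theorem resFun_add (hΩ : MeasurableSet Ω) (hs : U ⊆ Ω) (v w : H1 Ω) :
    resFun hΩ hs (v + w) = resFun hΩ hs v + resFun hΩ hs w := by
  refine ext_ae ?_ ?_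
  · filter_upwards [fn_resFun hΩ hs (v + w), fn_resFun hΩ hs v, fn_resFun hΩ hs w,
      fn_add (resFun hΩ hs v) (resFun hΩ hs w), ae_restrict_mono hs (fn_add v w)]
      with x h1 h2 h3 h4 h5
    rw [h1, h4, h5, Pi.add_apply, Pi.add_apply, h2, h3]
  · filter_upwards [grad_resFun hΩ hs (v + w), grad_resFun hΩ hs v, grad_resFun hΩ hs w,
      grad_add (resFun hΩ hs v) (resFun hΩ hs w), ae_restrict_mono hs (grad_add v w)]
      with x h1 h2 h3 h4 h5
    rw [h1, h4, h5, Pi.add_apply, Pi.add_apply, h2, h3]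

theorem resFun_smul (hΩ : MeasurableSet Ω) (hs : U ⊆ Ω) (c : ℂ) (v : H1 Ω) :
    resFun hΩ hs (c • v) = c • resFun hΩ hs v := by
  refine ext_ae ?_ ?_
  · filter_upwards [fn_resFun hΩ hs (c • v), fn_resFun hΩ hs v,
      fn_smul c (resFun hΩ hs v), ae_restrict_mono hs (fn_smul c v)] with x h1 h2 h4 h5
    rw [h1, h4, h5, Pi.smul_apply, Pi.smul_apply, h2]
  · filter_upwards [grad_resFun hΩ hs (c • v), grad_resFun hΩ hs v,
      grad_smul c (resFun hΩ hs v), ae_restrict_mono hs (grad_smul c v)] with x h1 h2 h4 h5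
    rw [h1, h4, h5, Pi.smul_apply, Pi.smul_apply, h2]

/-- The restriction of `H¹(Ω)` functions to a subset, as a linear map. -/
def res (hΩ : MeasurableSet Ω) (hs : U ⊆ Ω) : H1 Ω →ₗ[ℂ] H1 U where
  toFun := resFun hΩ hs
  map_add' := resFun_add hΩ hs
  map_smul' := resFun_smul hΩ hs

theorem fn_res (hΩ : MeasurableSet Ω) (hs : U ⊆ Ω) (v : H1 Ω) :
    fn (res hΩ hs v) =ᵐ[volume.restrict U] fn v := fn_resFun hΩ hs v

theorem grad_res (hΩ : MeasurableSet Ω) (hs : U ⊆ Ω) (v : H1 Ω) :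
    grad (res hΩ hs v) =ᵐ[volume.restrict U] grad v := grad_resFun hΩ hs v

end H1

section

/-! ### Lipschitz test functions -/

variable {d : ℕ}

/-- The derivative falls on the kernel and is moved to ζ by integration by parts for Lipschitz
functions. The reflection t ↦ x - t turns the direction v into -v. -/
theorem fderiv_mollify_lipschitz {C : NNReal} {ζ : Pt d → ℝ} (hζ : LipschitzWith C ζ) (n : ℕ)
    (x v : Pt d) : fderiv ℝ (mollify n ζ) x v = mollify n (fun y => lineDeriv ℝ ζ y v) x := by
  set ρ := (bumpSeq d n).normed (volume : Measure (Pt d)) with hρ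
  have hρs : ContDiff ℝ ∞ ρ := (bumpSeq d n).contDiff_normed
  have hρcs : HasCompactSupport ρ := (bumpSeq d n).hasCompactSupport_normed
  have hloc : LocallyIntegrable ζ volume := hζ.continuous.locallyIntegrable
  have hd := hρcs.hasFDerivAt_convolution_left (ContinuousLinearMap.lsmul ℝ ℝ)
    (hρs.of_le (by simp)) hloc x
  have hd' : fderiv ℝ (mollify n ζ) x = _ := hd.fderiv
  have hex := (hρcs.fderiv ℝ).convolutionExists_left
    (ContinuousLinearMap.precompL (Pt d) (ContinuousLinearMap.lsmul ℝ ℝ))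
    (hρs.continuous_fderiv (by simp)) hloc x
  rw [hd', convolution_def, ContinuousLinearMap.integral_apply hex]
  obtain ⟨D, hD⟩ := hρs.lipschitzWith_of_hasCompactSupport hρcs (by simp)
  have hζ' : LipschitzWith C fun t => ζ (x - t) := by
    refine LipschitzWith.of_dist_le_mul fun a b => ?_
    have := hζ.dist_le_mul (x - a) (x - b)
    rwa [dist_sub_left] at this
  have key := hζ'.integral_lineDeriv_mul_eq (μ := volume) hD hρcs (-v)
  have h1 : ∀ t, lineDeriv ℝ (fun t => ζ (x - t)) t (-v) = lineDeriv ℝ ζ (x - t) v := by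
    intro t
    simp only [lineDeriv]
    congr 1
    ext s
    congr 1
    rw [smul_neg]
    abel
  have h2 : ∀ t, lineDeriv ℝ ρ t v = fderiv ℝ ρ t v := fun t =>
    (hρs.differentiable (by simp) t).lineDeriv_eq_fderiv
  simp only [h1, neg_neg, h2] at key
  calc _ = ∫ t, fderiv ℝ ρ t v * ζ (x - t) := rfl
    _ = ∫ t, lineDeriv ℝ ζ (x - t) v * ρ t := key.symm
    _ = ∫ t, ρ t * lineDeriv ℝ ζ (x - t) v := by simp_rw [mul_comm]
    _ = _ := rfl

theorem tendsto_integral_smul {U : Set (Pt d)} {u : Pt d → ℂ} (hu : MemLp u 2 (volume.restrict U))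
    {f : Pt d → ℝ} {F : ℕ → Pt d → ℝ} (hf : MemLp f 2 volume) (hF : ∀ n, MemLp (F n) 2 volume)
    (h : Tendsto (fun n => ∫⁻ x, ‖F n x - f x‖ₑ ^ 2) atTop (𝓝 0)) :
    Tendsto (fun n => ∫ x in U, F n x • u x) atTop (𝓝 (∫ x in U, f x • u x)) := by
  have hint : ∀ G : Pt d → ℝ, MemLp G 2 volume →
      Integrable (fun x => G x • u x) (volume.restrict U) := fun G hG => by
    have h3 : MemLp (fun x => (G x : ℂ)) 2 (volume.restrict U) := (hG.restrict U).ofReal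
    exact (h3.integrable_mul hu).congr (Eventually.of_forall fun x => by simp [Complex.real_smul])
  refine tendsto_integral_of_L1 _ (hint f hf).aestronglyMeasurable (Eventually.of_forall fun n => hint _ (hF n)) ?_
  have hu2 : ∫⁻ x in U, ‖u x‖ₑ ^ 2 ≠ ⊤ := (lintegral_enorm_sq_lt_top hu).ne
  have hle : ∀ n, ∫⁻ x in U, ‖F n x • u x - f x • u x‖ₑ
      ≤ (∫⁻ x, ‖F n x - f x‖ₑ ^ 2) ^ (1 / 2 : ℝ) * (∫⁻ x in U, ‖u x‖ₑ ^ 2) ^ (1 / 2 : ℝ) := by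
    intro n
    have := ENNReal.lintegral_mul_le_Lp_mul_Lq (volume.restrict U) Real.HolderConjugate.two_two
      (((hF n).sub hf).restrict U).aestronglyMeasurable.enorm hu.aestronglyMeasurable.enorm
    simp only [Pi.mul_apply, Pi.sub_apply, ENNReal.rpow_two] at this
    simp_rw [← sub_smul, enorm_smul]
    refine this.trans ?_
    gcongr
    exact Measure.restrict_le_self
  refine tendsto_of_tendsto_of_tendsto_of_le_of_le tendsto_const_nhds ?_ (fun n => zero_le) hle
  have h1 := (ENNReal.continuous_rpow_const (y := (1 / 2 : ℝ))).tendsto 0 |>.comp h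
  rw [ENNReal.zero_rpow_of_pos (by norm_num)] at h1
  have h2 := ENNReal.Tendsto.mul_const (b := (∫⁻ x in U, ‖u x‖ₑ ^ 2) ^ (1 / 2 : ℝ)) h1
    (Or.inr (ENNReal.rpow_ne_top_of_nonneg (by norm_num) hu2))
  rwa [zero_mul] at h2

theorem tsupport_mollify_subset {ζ : Pt d → ℝ} (n : ℕ) {δ : ℝ}
    (hn : (bumpSeq d n).rOut ≤ δ) :
    tsupport (mollify n ζ) ⊆ Metric.cthickening δ (tsupport ζ) := by
  refine closure_minimal (fun x hx => ?_) Metric.isClosed_cthickening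
  have h1 := support_convolution_subset_swap (ContinuousLinearMap.lsmul ℝ ℝ) hx
  obtain ⟨a, ha, b, hb, rfl⟩ := h1
  rw [(bumpSeq d n).support_normed_eq, mem_ball_zero_iff] at hb
  refine Metric.mem_cthickening_of_dist_le _ a δ _ (subset_tsupport _ ha) ?_
  rw [dist_eq_norm]
  simpa using hb.le.trans hn

/-- The definition of the weak gradient extends to Lipschitz test functions. -/
theorem IsWeakGradient.integral_lipschitz {U : Set (Pt d)} (hU : IsOpen U)
    {u : Pt d → ℂ} {g : Pt d → EuclideanSpace ℂ (Fin d)} (h : IsWeakGradient U u g)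
    (hu : MemLp u 2 (volume.restrict U)) (hg : MemLp g 2 (volume.restrict U))
    {C : NNReal} {ζ : Pt d → ℝ} (hζ : LipschitzWith C ζ) (hc : HasCompactSupport ζ)
    (hs : tsupport ζ ⊆ U) (i : Fin d) :
    ∫ x in U, (lineDeriv ℝ ζ x (EuclideanSpace.single i 1)) • u x
      = - ∫ x in U, (ζ x) • (g x) i := by
  set e : Pt d := EuclideanSpace.single i 1 with he
  obtain ⟨δ, hδ, hδU⟩ := hc.isCompact.exists_cthickening_subset_open hU hs
  have hζL : MemLp ζ 2 volume := hζ.continuous.memLp_of_hasCompactSupport hc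
  have hdc : HasCompactSupport fun x => lineDeriv ℝ ζ x e := by
    refine HasCompactSupport.of_support_subset_isCompact hc.isCompact fun x hx => ?_
    by_contra hxs
    refine hx ?_
    have h0 : ζ =ᶠ[𝓝 x] fun _ => (0 : ℝ) := notMem_tsupport_iff_eventuallyEq.1 hxs
    simp only
    rw [DifferentiableAt.lineDeriv_eq_fderiv
      ((differentiableAt_const (0 : ℝ)).congr_of_eventuallyEq h0), h0.fderiv_eq]
    simp
  have hdm : MemLp (fun x => lineDeriv ℝ ζ x e) 2 volume :=
    hdc.memLp_of_bound (measurable_lineDeriv hζ.continuous).aestronglyMeasurable (C * ‖e‖)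
      (Eventually.of_forall fun x => norm_lineDeriv_le_of_lipschitz ℝ hζ)
  have hsm : ∀ n, ContDiff ℝ ∞ (mollify n ζ) := fun n =>
    contDiff_mollify hζ.continuous.locallyIntegrable n
  have hcs : ∀ n, HasCompactSupport (mollify n ζ) := fun n =>
    ((bumpSeq d n).hasCompactSupport_normed).convolution _ hc
  have h1 : Tendsto (fun n => ∫ x in U, (fderiv ℝ (mollify n ζ) x e) • u x) atTop
      (𝓝 (∫ x in U, (lineDeriv ℝ ζ x e) • u x)) := by
    refine tendsto_integral_smul hu hdm (fun n => ?_) ?_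
    · exact (continuous_test_deriv (hsm n) e).memLp_of_hasCompactSupport
        (hasCompactSupport_test_deriv (hcs n) e)
    · simp_rw [fderiv_mollify_lipschitz hζ]
      exact tendsto_lintegral_mollify_sub hdm
  have h2 : Tendsto (fun n => - ∫ x in U, mollify n ζ x • (g x) i) atTop
      (𝓝 (- ∫ x in U, (ζ x) • (g x) i)) :=
    (tendsto_integral_smul (memLp_coord hg i) hζL
      (fun n => (hsm n).continuous.memLp_of_hasCompactSupport (hcs n))
      (tendsto_lintegral_mollify_sub hζL)).neg
  refine tendsto_nhds_unique h1 (h2.congr' ?_)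
  filter_upwards [(tendsto_bumpSeq_rOut d).eventually (gt_mem_nhds hδ)] with n hn
  exact (h _ (hsm n) (hcs n) ((tsupport_mollify_subset n hn.le).trans hδU) i).symm

/-! ### Multiplication by locally Lipschitz functions -/

/-- On the segment from x to y, the parameters up to which the bound holds form a closed set that
can always be extended to the right. The constant L is kept. -/
theorem abs_sub_le_of_eventually {f : Pt d → ℝ} {L : ℝ}
    (h : ∀ x, ∀ᶠ y in 𝓝 x, |f y - f x| ≤ L * ‖y - x‖) (x y : Pt d) :
    |f y - f x| ≤ L * ‖y - x‖ := by
  have hcont : Continuous f := by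
    rw [continuous_iff_continuousAt]
    intro x
    rw [ContinuousAt, tendsto_iff_norm_sub_tendsto_zero]
    refine squeeze_zero' (Eventually.of_forall fun y => norm_nonneg _) (h x) ?_
    have : Tendsto (fun y => L * ‖y - x‖) (𝓝 x) (𝓝 (L * ‖x - x‖)) :=
      Continuous.tendsto (by fun_prop) x
    simpa using this
  set γ : ℝ → Pt d := fun t => x + t • (y - x) with hγ
  have hγc : Continuous γ := by fun_prop
  set S : Set ℝ := {t | |f (γ t) - f (γ 0)| ≤ L * ‖y - x‖ * t} with hS
  have hcl : IsClosed S := isClosed_le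
    (((hcont.comp hγc).sub continuous_const).abs) (continuous_const.mul continuous_id)
  have hsub : Icc 0 1 ⊆ S := by
    refine IsClosed.Icc_subset_of_forall_exists_gt (hcl.inter isClosed_Icc) (by simp [hS]) ?_
    rintro t ⟨ht, -⟩ s hs
    have hev : ∀ᶠ r in 𝓝[>] t, |f (γ r) - f (γ t)| ≤ L * ‖γ r - γ t‖ :=
      (hγc.continuousAt.eventually (h (γ t))).filter_mono nhdsWithin_le_nhds
    obtain ⟨r, hr, hrt⟩ := (hev.and (Ioc_mem_nhdsGT hs)).exists
    refine ⟨r, ?_, hrt⟩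
    have h1 : γ r - γ t = (r - t) • (y - x) := by
      simp only [hγ, sub_smul]; abel
    rw [h1, norm_smul, Real.norm_of_nonneg (sub_nonneg.2 hrt.1.le)] at hr
    have h2 : |f (γ t) - f (γ 0)| ≤ L * ‖y - x‖ * t := ht
    change |f (γ r) - f (γ 0)| ≤ L * ‖y - x‖ * r
    have h3 := abs_sub_le (f (γ r)) (f (γ t)) (f (γ 0))
    nlinarith
  have := hsub (right_mem_Icc.2 zero_le_one)
  simpa [hS, hγ] using this

/-- Off Ω the product is locally zero, so the local bound holds at every point of the whole space.
That is why χ has to be controlled on Ω only, where it may be merely locally Lipschitz. -/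
theorem lipschitzWith_mul_of_eventually {Ω : Set (Pt d)} {χ : Pt d → ℝ} {L : ℝ}
    (hL : ∀ x ∈ Ω, ∀ᶠ y in 𝓝 x, |χ y - χ x| ≤ L * ‖y - x‖) (hb : ∀ x ∈ Ω, |χ x| ≤ 1)
    {φ : Pt d → ℝ} (hφ : ContDiff ℝ ∞ φ) (hc : HasCompactSupport φ) (hs : tsupport φ ⊆ Ω) :
    ∃ C, LipschitzWith C fun x => φ x * χ x := by
  obtain ⟨M, hM⟩ := hφ.continuous.bounded_above_of_compact_support hc
  obtain ⟨D, hD⟩ := hφ.lipschitzWith_of_hasCompactSupport hc (by simp)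
  have hM0 : 0 ≤ M := (norm_nonneg _).trans (hM 0)
  have key : ∀ x, ∀ᶠ y in 𝓝 x, |φ y * χ y - φ x * χ x| ≤ (M * |L| + D) * ‖y - x‖ := by
    intro x
    by_cases hx : x ∈ Ω
    · filter_upwards [hL x hx] with y hy
      have h1 : φ y * χ y - φ x * χ x = φ y * (χ y - χ x) + (φ y - φ x) * χ x := by ring
      have h2 : |φ y - φ x| ≤ D * ‖y - x‖ := by
        have := hD.dist_le_mul y x
        rwa [Real.dist_eq, dist_eq_norm] at this
      have h3 : |φ y| ≤ M := hM y
      have h4 : |χ y - χ x| ≤ |L| * ‖y - x‖ := hy.trans (by gcongr; exact le_abs_self L)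
      rw [h1]
      refine (abs_add_le _ _).trans ?_
      rw [abs_mul, abs_mul, add_mul, mul_assoc]
      refine add_le_add (by gcongr) ?_
      calc |φ y - φ x| * |χ x| ≤ D * ‖y - x‖ * 1 := by gcongr; exact hb x hx
        _ = _ := mul_one _
    · have h0 : φ =ᶠ[𝓝 x] 0 := notMem_tsupport_iff_eventuallyEq.1 fun h => hx (hs h)
      filter_upwards [h0] with y hy
      rw [hy, h0.eq_of_nhds]
      simp only [Pi.zero_apply, zero_mul, sub_self, abs_zero]
      positivity
  refine ⟨(M * |L| + D).toNNReal, LipschitzWith.of_dist_le_mul fun x y => ?_⟩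
  rw [Real.coe_toNNReal _ (by positivity), Real.dist_eq, dist_eq_norm]
  exact abs_sub_le_of_eventually key y x

/-- The product rule for an `H¹` function and a bounded locally Lipschitz function. -/
theorem IsWeakGradient.mul {Ω : Set (Pt d)} (hΩ : IsOpen Ω) {χ : Pt d → ℝ} {L : ℝ}
    (hL : ∀ x ∈ Ω, ∀ᶠ y in 𝓝 x, |χ y - χ x| ≤ L * ‖y - x‖) (hb : ∀ x ∈ Ω, |χ x| ≤ 1)
    (hd : ∀ᵐ x ∂(volume.restrict Ω), DifferentiableAt ℝ χ x)
    {u : Pt d → ℂ} {g : Pt d → EuclideanSpace ℂ (Fin d)} (h : IsWeakGradient Ω u g)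
    (hu : MemLp u 2 (volume.restrict Ω)) (hg : MemLp g 2 (volume.restrict Ω))
    (hχu : MemLp (fun x => χ x • u x) 2 (volume.restrict Ω))
    (hχg : MemLp (fun x => WithLp.toLp 2 fun i : Fin d =>
      χ x • g x i + fderiv ℝ χ x (EuclideanSpace.single i 1) • u x) 2 (volume.restrict Ω)) :
    IsWeakGradient Ω (fun x => χ x • u x) (fun x => WithLp.toLp 2 fun i : Fin d =>
      χ x • g x i + fderiv ℝ χ x (EuclideanSpace.single i 1) • u x) := by
  intro φ hφ hc hs i
  set e : Pt d := EuclideanSpace.single i 1 with he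
  -- The product φχ is a Lipschitz function with compact support in Ω, so it may itself be used as a
  -- test function for u.
  obtain ⟨C, hC⟩ := lipschitzWith_mul_of_eventually hL hb hφ hc hs
  have hsupp : tsupport (fun x => φ x * χ x) ⊆ tsupport φ := tsupport_mul_subset_left
  have key := h.integral_lipschitz hΩ hu hg hC (hc.mul_right) (hsupp.trans hs) i
  have hld : (fun x => lineDeriv ℝ (fun x => φ x * χ x) x e • u x) =ᵐ[volume.restrict Ω]
      fun x => fderiv ℝ φ x e • (χ x • u x)
        + (φ x • (χ x • g x i + fderiv ℝ χ x e • u x) - (φ x * χ x) • g x i) := by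
    filter_upwards [hd] with x hx
    have hφx := hφ.differentiable (by simp) x
    rw [(hφx.fun_mul hx).lineDeriv_eq_fderiv, fderiv_fun_mul hφx hx]
    simp only [add_apply, smul_apply, Complex.real_smul,
      smul_eq_mul]
    push_cast
    ring
  have hi1 : Integrable (fun x => fderiv ℝ φ x e • (χ x • u x)) (volume.restrict Ω) :=
    integrable_smul_test hχu (continuous_test_deriv hφ e) (hasCompactSupport_test_deriv hc e)
  have hi2 : Integrable (fun x => φ x • (χ x • g x i + fderiv ℝ χ x e • u x))
      (volume.restrict Ω) := integrable_smul_test (memLp_coord hχg i) hφ.continuous hc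
  have hi3 : Integrable (fun x => (φ x * χ x) • g x i) (volume.restrict Ω) :=
    integrable_smul_test (memLp_coord hg i) hC.continuous hc.mul_right
  rw [integral_congr_ae hld, integral_add hi1 (by exact hi2.sub hi3),
    integral_sub hi2 hi3] at key
  change ∫ x in Ω, fderiv ℝ φ x e • (χ x • u x)
    = -∫ x in Ω, φ x • (χ x • g x i + fderiv ℝ χ x e • u x)
  linear_combination key

/-! ### Finite element cutoff functions -/

theorem gradient_apply (f : Pt d → ℝ) (x : Pt d) (i : Fin d) :
    gradient f x i = fderiv ℝ f x (EuclideanSpace.single i 1) := by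
  have h := InnerProductSpace.toDual_symm_apply (𝕜 := ℝ) (x := EuclideanSpace.single i (1 : ℝ))
    (y := fderiv ℝ f x)
  rw [EuclideanSpace.inner_single_right] at h
  simpa [gradient] using h

namespace Cell

variable (K : Cell d)

/-- The sum of some of the Lagrange basis functions of an element. -/
def partialSum (A : Finset (K.kind.Vertex d)) (x : Pt d) : ℝ := ∑ v ∈ A, K.lagrange v x

variable {K}

theorem partialSum_nonneg (A : Finset (K.kind.Vertex d)) {x : Pt d} (hx : x ∈ K.closedSet) :
    0 ≤ K.partialSum A x := Finset.sum_nonneg fun v _ => K.lagrange_nonneg v hx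

theorem partialSum_le_one (A : Finset (K.kind.Vertex d)) {x : Pt d} (hx : x ∈ K.closedSet) :
    K.partialSum A x ≤ 1 := by
  rw [← K.sum_lagrange x]
  exact Finset.sum_le_sum_of_subset_of_nonneg (Finset.subset_univ A)
    fun v _ _ => K.lagrange_nonneg v hx

open Classical in
theorem partialSum_compl (A : Finset (K.kind.Vertex d)) (x : Pt d) :
    K.partialSum Aᶜ x = 1 - K.partialSum A x := by
  rw [eq_sub_iff_add_eq', ← K.sum_lagrange x]
  exact Finset.sum_add_sum_compl A _

theorem differentiableAt_partialSum (A : Finset (K.kind.Vertex d)) {x : Pt d}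
    (hx : x ∈ K.openSet) : DifferentiableAt ℝ (K.partialSum A) x := by
  unfold partialSum
  exact DifferentiableAt.fun_sum fun v _ => K.differentiableAt_lagrange v hx

theorem exists_partialSum_lipschitz (K : Cell d) :
    ∃ c : ℝ, 0 ≤ c ∧ ∀ A : Finset (K.kind.Vertex d), ∀ x ∈ K.closedSet, ∀ y ∈ K.closedSet,
      |K.partialSum A x - K.partialSum A y| ≤ c * ‖x - y‖ := by
  obtain ⟨c, hc, h⟩ := K.exists_lagrange_lipschitz
  refine ⟨Fintype.card (K.kind.Vertex d) * c, by positivity, fun A x hx y hy => ?_⟩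
  rw [partialSum, partialSum, ← Finset.sum_sub_distrib]
  calc _ ≤ ∑ v ∈ A, |K.lagrange v x - K.lagrange v y| := Finset.abs_sum_le_sum_abs _ _
    _ ≤ ∑ v, |K.lagrange v x - K.lagrange v y| :=
        Finset.sum_le_sum_of_subset_of_nonneg (Finset.subset_univ A) fun _ _ _ => abs_nonneg _
    _ ≤ ∑ _v : K.kind.Vertex d, c * ‖x - y‖ := Finset.sum_le_sum fun v _ => h v x hx y hy
    _ = _ := by simp [mul_assoc]

theorem gradient_partialSum (A : Finset (K.kind.Vertex d)) {x : Pt d} (hx : x ∈ K.openSet) :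
    gradient (K.partialSum A) x = ∑ v ∈ A, gradient (K.lagrange v) x := by
  have : fderiv ℝ (K.partialSum A) x = ∑ v ∈ A, fderiv ℝ (K.lagrange v) x := by
    unfold partialSum
    exact fderiv_fun_sum fun v _ => K.differentiableAt_lagrange v hx
  simp only [gradient, this, map_sum]

/-- As the gradients of the at most eight Lagrange basis functions add up to zero, the gradient of
a partial sum is controlled by them with the constant `2`. -/
theorem norm_gradient_partialSum_sq_le (hd : d ≤ 3) (A : Finset (K.kind.Vertex d)) {x : Pt d}
    (hx : x ∈ K.openSet) :
    ‖gradient (K.partialSum A) x‖ ^ 2 ≤ 2 * ∑ v, ‖gradient (K.lagrange v) x‖ ^ 2 := by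
  classical
  set g := fun v => gradient (K.lagrange v) x with hg
  have h0 : ∑ v, g v = 0 := by
    rw [← gradient_partialSum Finset.univ hx]
    have : K.partialSum Finset.univ = fun _ => 1 := funext fun x => K.sum_lagrange x
    rw [this]
    simp [gradient]
  -- The gradients add up to zero, so half their sum can be subtracted, which centres the
  -- coefficients 0 and 1 at ±1/2. With at most eight terms Cauchy–Schwarz then yields 8/4 = 2.
  have h1 : gradient (K.partialSum A) x = ∑ v, ((if v ∈ A then 1 else 0) - 1 / 2 : ℝ) • g v := by
    simp_rw [sub_smul, Finset.sum_sub_distrib, ← Finset.smul_sum, h0, smul_zero, sub_zero,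
      ite_smul, one_smul, zero_smul]
    rw [gradient_partialSum A hx, Finset.sum_ite_mem, Finset.univ_inter]
  have h2 : ‖gradient (K.partialSum A) x‖ ≤ 1 / 2 * ∑ v, ‖g v‖ := by
    rw [h1, Finset.mul_sum]
    refine (norm_sum_le _ _).trans (Finset.sum_le_sum fun v _ => ?_)
    rw [norm_smul]
    gcongr
    split_ifs <;> norm_num
  have h3 : (∑ v, ‖g v‖) ^ 2 ≤ 8 * ∑ v, ‖g v‖ ^ 2 := by
    refine (sq_sum_le_card_mul_sum_sq (s := Finset.univ)).trans ?_
    gcongr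
    exact_mod_cast K.kind.card_vertex_le hd
  calc _ ≤ (1 / 2 * ∑ v, ‖g v‖) ^ 2 := by gcongr
    _ ≤ _ := by rw [mul_pow]; linarith

variable (K) in
open Classical in
/-- The vertices of an element that belong to a given set of points. -/
def vertsIn (Z : Finset (Pt d)) : Finset (K.kind.Vertex d) :=
  Finset.univ.filter fun v => K.vertex v ∈ Z

theorem sum_nodal (Z : Finset (Pt d)) (x : Pt d) :
    ∑ p ∈ Z, K.nodal p x = K.partialSum (K.vertsIn Z) x := by
  classical
  simp only [nodal, partialSum, vertsIn]
  rw [Finset.sum_comm, Finset.sum_filter]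
  exact Finset.sum_congr rfl fun v _ => by simp

/-- `w` is the product of `u` and of a partial sum of Lagrange basis functions. -/
structure IsScaled (A : Finset (K.kind.Vertex d)) (u w : H1 K.openSet) : Prop where
  fn : ∀ᵐ x ∂(volume.restrict K.openSet), H1.fn w x = (K.partialSum A x : ℂ) * H1.fn u x
  grad : ∀ᵐ x ∂(volume.restrict K.openSet), ∀ i, H1.grad w x i
    = (K.partialSum A x : ℂ) * H1.grad u x i + (gradient (K.partialSum A) x i : ℂ) * H1.fn u x

end Cell

namespace Mesh

variable {Ω : Set (Pt d)} {N : ℕ} (T : Mesh Ω N)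

/-- The closed elements cover Ω, and each exceeds its interior by a null set. -/
theorem ae_mem_openSet : ∀ᵐ x ∂(volume.restrict Ω), ∃ k, x ∈ (T.cell k).openSet := by
  have h : volume (⋃ k, (T.cell k).closedSet \ (T.cell k).openSet) = 0 :=
    measure_iUnion_null fun k => (T.cell k).volume_closedSet_diff
  have h2 : ∀ᵐ x ∂(volume.restrict Ω), x ∈ closure Ω := by
    refine ae_restrict_of_ae_restrict_of_subset subset_closure ?_
    exact ae_restrict_mem isClosed_closure.measurableSet
  filter_upwards [h2, ae_restrict_of_ae (measure_eq_zero_iff_ae_notMem.1 h)] with x hx hx2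
  rw [← T.iUnion_eq] at hx
  obtain ⟨k, hk⟩ := mem_iUnion.1 hx
  by_contra! hno
  exact hx2 (mem_iUnion.2 ⟨k, hk, hno k⟩)

open Classical in
/-- The finite element function that is `1` at the points of `Z` and `0` at all other vertices. -/
def cutoff (Z : Finset (Pt d)) (x : Pt d) : ℝ :=
  if h : ∃ k, x ∈ (T.cell k).closedSet then ∑ p ∈ Z, (T.cell h.choose).nodal p x else 0

/-- Conformity makes the value independent of the element that the definition chooses. -/
theorem cutoff_eq (Z : Finset (Pt d)) {k : Fin N} {x : Pt d} (hx : x ∈ (T.cell k).closedSet) :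
    T.cutoff Z x = (T.cell k).partialSum ((T.cell k).vertsIn Z) x := by
  have h : ∃ k, x ∈ (T.cell k).closedSet := ⟨k, hx⟩
  rw [cutoff, dif_pos h, ← Cell.sum_nodal]
  exact Finset.sum_congr rfl fun p _ => T.conforming _ _ x ⟨h.choose_spec, hx⟩ p

/-- The elements are finitely many closed sets, so every y close to x lies only in elements that
contain x too. Then x and y share an element, on which the cutoff is Lipschitz. The bound is local
because Ω need not be convex. -/
theorem exists_cutoff_lipschitz (hΩ : IsOpen Ω) (Z : Finset (Pt d)) :
    ∃ L, ∀ x ∈ Ω, ∀ᶠ y in 𝓝 x, |T.cutoff Z y - T.cutoff Z x| ≤ L * ‖y - x‖ := by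
  choose c hc h using fun k => (T.cell k).exists_partialSum_lipschitz
  refine ⟨∑ k, c k, fun x hx => ?_⟩
  have h1 : ∀ᶠ y in 𝓝 x, ∀ k, x ∉ (T.cell k).closedSet → y ∉ (T.cell k).closedSet := by
    refine eventually_all.2 fun k => ?_
    by_cases hk : x ∈ (T.cell k).closedSet
    · exact Eventually.of_forall fun y h => absurd hk h
    · filter_upwards [(T.cell k).isCompact_closedSet.isClosed.isOpen_compl.mem_nhds hk] with y hy _
      exact hy
  filter_upwards [h1, hΩ.mem_nhds hx] with y hy hyΩ
  obtain ⟨k, hk⟩ := mem_iUnion.1 (T.iUnion_eq.symm ▸ subset_closure hyΩ :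
    y ∈ ⋃ k, (T.cell k).closedSet)
  have hxk : x ∈ (T.cell k).closedSet := by
    by_contra hxk
    exact hy k hxk hk
  rw [T.cutoff_eq Z hk, T.cutoff_eq Z hxk]
  refine (h k _ y hk x hxk).trans ?_
  gcongr
  exact Finset.single_le_sum (fun k _ => hc k) (Finset.mem_univ k)

theorem abs_cutoff_le (Z : Finset (Pt d)) {x : Pt d} (hx : x ∈ Ω) : |T.cutoff Z x| ≤ 1 := by
  obtain ⟨k, hk⟩ := mem_iUnion.1 (T.iUnion_eq.symm ▸ subset_closure hx :
    x ∈ ⋃ k, (T.cell k).closedSet)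
  rw [T.cutoff_eq Z hk, abs_of_nonneg (Cell.partialSum_nonneg _ hk)]
  exact Cell.partialSum_le_one _ hk

theorem cutoff_eventuallyEq (Z : Finset (Pt d)) {k : Fin N} {x : Pt d}
    (hx : x ∈ (T.cell k).openSet) :
    T.cutoff Z =ᶠ[𝓝 x] (T.cell k).partialSum ((T.cell k).vertsIn Z) := by
  filter_upwards [(T.cell k).isOpen_openSet.mem_nhds hx] with y hy
  exact T.cutoff_eq Z ((T.cell k).openSet_subset_closedSet hy)

set_option maxHeartbeats 1000000 in
/-- Multiplication of an `H¹` function by a finite element cutoff function. -/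
theorem exists_isScaled (hΩ : IsOpen Ω) (Z : Finset (Pt d)) (v : H1 Ω) :
    ∃ w : H1 Ω, ∀ k, Cell.IsScaled ((T.cell k).vertsIn Z)
      (H1.res hΩ.measurableSet (T.subset k) v) (H1.res hΩ.measurableSet (T.subset k) w) := by
  obtain ⟨L, hL⟩ := T.exists_cutoff_lipschitz hΩ Z
  have hb := fun x hx => T.abs_cutoff_le Z (x := x) hx
  have hcont : ContinuousOn (T.cutoff Z) Ω := by
    intro x hx
    refine ContinuousAt.continuousWithinAt ?_
    rw [ContinuousAt, tendsto_iff_norm_sub_tendsto_zero]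
    refine squeeze_zero' (Eventually.of_forall fun y => norm_nonneg _) (hL x hx) ?_
    have : Tendsto (fun y => L * ‖y - x‖) (𝓝 x) (𝓝 (L * ‖x - x‖)) :=
      Continuous.tendsto (by fun_prop) x
    simpa using this
  have hm : AEStronglyMeasurable (T.cutoff Z) (volume.restrict Ω) :=
    hcont.aestronglyMeasurable hΩ.measurableSet
  have hd : ∀ᵐ x ∂(volume.restrict Ω), DifferentiableAt ℝ (T.cutoff Z) x := by
    filter_upwards [T.ae_mem_openSet] with x ⟨k, hk⟩
    exact (Cell.differentiableAt_partialSum _ hk).congr_of_eventuallyEq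
      (T.cutoff_eventuallyEq Z hk)
  have hχ : ∀ {f : Pt d → ℂ}, MemLp f 2 (volume.restrict Ω) →
      MemLp (fun x => T.cutoff Z x • f x) 2 (volume.restrict Ω) := fun {f} hf =>
    hf.of_le (hm.smul hf.aestronglyMeasurable) (by
      filter_upwards [ae_restrict_mem hΩ.measurableSet] with x hx
      rw [norm_smul]
      exact mul_le_of_le_one_left (norm_nonneg _) (hb x hx))
  have hχu := hχ (H1.memLp_fn v)
  have hχg : MemLp (fun x => WithLp.toLp 2 fun i : Fin d => T.cutoff Z x • H1.grad v x i
      + fderiv ℝ (T.cutoff Z) x (EuclideanSpace.single i 1) • H1.fn v x) 2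
      (volume.restrict Ω) := by
    refine MemLp.of_eval_piLp fun i => ?_
    refine (hχ (H1.memLp_grad_coord v i)).add ?_
    have hdm : AEStronglyMeasurable (fun x => fderiv ℝ (T.cutoff Z) x (EuclideanSpace.single i 1))
        (volume.restrict Ω) := (measurable_fderiv_apply_const ℝ _ _).aestronglyMeasurable
    refine ((H1.memLp_fn v).const_smul L).of_le
      (hdm.smul (H1.memLp_fn v).aestronglyMeasurable) ?_
    filter_upwards [ae_restrict_mem hΩ.measurableSet] with x hx
    rw [Pi.smul_apply, norm_smul, norm_smul]
    gcongr
    have h1 : ‖fderiv ℝ (T.cutoff Z) x‖ ≤ |L| :=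
      norm_fderiv_le_of_lip' ℝ (abs_nonneg L) ((hL x hx).mono fun y hy =>
        hy.trans (by gcongr; exact le_abs_self L))
    refine ((fderiv ℝ (T.cutoff Z) x).le_opNorm _).trans ?_
    simpa using h1
  refine ⟨H1.mk hχu hχg ((H1.isWeakGradient v).mul hΩ hL hb hd (H1.memLp_fn v) (H1.memLp_grad v)
    hχu hχg), fun k => ⟨?_, ?_⟩⟩
  · filter_upwards [H1.fn_res hΩ.measurableSet (T.subset k) v,
      H1.fn_res hΩ.measurableSet (T.subset k) (H1.mk hχu hχg _),
      H1.ae_restrict_mono (T.subset k) (H1.fn_mk hχu hχg _),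
      ae_restrict_mem (T.measurableSet_openSet k)] with x h1 h2 h3 hx
    rw [h2, h3, h1, T.cutoff_eq Z ((T.cell k).openSet_subset_closedSet hx), Complex.real_smul]
  · filter_upwards [H1.fn_res hΩ.measurableSet (T.subset k) v,
      H1.grad_res hΩ.measurableSet (T.subset k) v,
      H1.grad_res hΩ.measurableSet (T.subset k) (H1.mk hχu hχg _),
      H1.ae_restrict_mono (T.subset k) (H1.grad_mk hχu hχg _),
      ae_restrict_mem (T.measurableSet_openSet k)] with x h1 h2 h3 h4 hx i
    rw [h3, h4, h2, h1, gradient_apply, ← (T.cutoff_eventuallyEq Z hx).fderiv_eq,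
      ← T.cutoff_eq Z ((T.cell k).openSet_subset_closedSet hx)]
    simp only [Complex.real_smul]

end Mesh

end

/-! ### Energy estimates for products with partial sums of basis functions -/

section Pointwise

variable {d : ℕ}

theorem norm_toLp_ofReal (γ : Pt d) :
    ‖(WithLp.toLp 2 fun i => (γ i : ℂ) : EuclideanSpace ℂ (Fin d))‖ = ‖γ‖ := by
  simp [EuclideanSpace.norm_eq]

theorem sum_mul_star_eq_inner (g h : EuclideanSpace ℂ (Fin d)) :
    ∑ i, g i * star (h i) = inner ℂ h g := by
  simp [PiLp.inner_apply]

variable {g h : EuclideanSpace ℂ (Fin d)} {f : ℂ} {γ : Pt d} {b c μ : ℝ}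

theorem eq_smul_add_smul (hh : ∀ i, h i = (b : ℂ) * g i + (γ i : ℂ) * f) :
    h = (b : ℂ) • g + f • (WithLp.toLp 2 fun i => (γ i : ℂ) : EuclideanSpace ℂ (Fin d)) := by
  ext i
  simp [hh i, mul_comm]

/-- Squaring the triangle inequality doubles both terms, and the bound on γ contributes another 2,
whence the 4. -/
theorem mul_norm_sq_scaled_le (hh : ∀ i, h i = (b : ℂ) * g i + (γ i : ℂ) * f) (hb0 : 0 ≤ b)
    (hb1 : b ≤ 1) (hc : 0 ≤ c) (hγ : c * ‖γ‖ ^ 2 ≤ 2 * μ) :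
    c * ‖h‖ ^ 2 ≤ 2 * (c * ‖g‖ ^ 2) + 4 * (μ * ‖f‖ ^ 2) := by
  have h1 : ‖h‖ ≤ ‖g‖ + ‖f‖ * ‖γ‖ := by
    rw [eq_smul_add_smul hh]
    refine (norm_add_le _ _).trans ?_
    rw [norm_smul, norm_smul, norm_toLp_ofReal, Complex.norm_real, Real.norm_of_nonneg hb0]
    gcongr
    exact mul_le_of_le_one_left (norm_nonneg _) hb1
  have h2 : ‖h‖ ^ 2 ≤ 2 * ‖g‖ ^ 2 + 2 * (‖f‖ * ‖γ‖) ^ 2 := by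
    have := pow_le_pow_left₀ (norm_nonneg _) h1 2
    nlinarith [sq_nonneg (‖g‖ - ‖f‖ * ‖γ‖)]
  have h3 := mul_le_mul_of_nonneg_left h2 hc
  have h4 := mul_le_mul_of_nonneg_right hγ (sq_nonneg ‖f‖)
  nlinarith

/-- The term b‖g‖² has the favourable sign. Young's inequality splits the cross term with weights
3/4 and 1/3; the bound on γ turns 1/3 into 2/3 ≤ 3/4. -/
theorem neg_re_inner_scaled_le (hh : ∀ i, h i = (b : ℂ) * g i + (γ i : ℂ) * f) (hb0 : 0 ≤ b)
    (hc : 0 ≤ c) (hγ : c * ‖γ‖ ^ 2 ≤ 2 * μ) {t : ℝ} (ht : 0 < t) :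
    -(c * (∑ i, g i * star (h i)).re) ≤ 3 / 4 * (t * (c * ‖g‖ ^ 2) + μ * ‖f‖ ^ 2 / t) := by
  set cγ : EuclideanSpace ℂ (Fin d) := WithLp.toLp 2 fun i => (γ i : ℂ) with hcγ
  have h1 : (∑ i, g i * star (h i)).re = b * ‖g‖ ^ 2 + (inner ℂ (f • cγ) g).re := by
    rw [sum_mul_star_eq_inner, eq_smul_add_smul hh, inner_add_left, inner_smul_left,
      inner_self_eq_norm_sq_to_K, Complex.conj_ofReal, Complex.add_re, Complex.re_ofReal_mul]
    norm_cast
  have h2 : -(inner ℂ (f • cγ) g).re ≤ ‖f‖ * ‖γ‖ * ‖g‖ := by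
    refine (neg_le_abs _).trans ((Complex.abs_re_le_norm _).trans ((norm_inner_le_norm _ _).trans ?_))
    rw [norm_smul, hcγ, norm_toLp_ofReal]
  have h3 : c * (‖f‖ * ‖γ‖ * ‖g‖)
      ≤ 3 / 4 * (t * (c * ‖g‖ ^ 2)) + 1 / 3 * (c * ‖γ‖ ^ 2 * ‖f‖ ^ 2 / t) := by
    have : 0 ≤ c / t * (3 / 4) * (t * ‖g‖ - 2 / 3 * (‖f‖ * ‖γ‖)) ^ 2 := by positivity
    have h5 : c / t * (3 / 4) * (t * ‖g‖ - 2 / 3 * (‖f‖ * ‖γ‖)) ^ 2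
        = 3 / 4 * (t * (c * ‖g‖ ^ 2)) + 1 / 3 * (c * ‖γ‖ ^ 2 * ‖f‖ ^ 2 / t)
          - c * (‖f‖ * ‖γ‖ * ‖g‖) := by
      field_simp
      ring
    linarith
  have h4 : c * ‖γ‖ ^ 2 * ‖f‖ ^ 2 / t ≤ 2 * (μ * ‖f‖ ^ 2 / t) := by
    rw [← mul_div_assoc, ← mul_assoc]
    gcongr
  have h6 : 0 ≤ μ * ‖f‖ ^ 2 / t := by
    have : 0 ≤ c * ‖γ‖ ^ 2 * ‖f‖ ^ 2 / t := by positivity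
    linarith
  have h7 := mul_le_mul_of_nonneg_left h2 hc
  have h8 : 0 ≤ c * (b * ‖g‖ ^ 2) := by positivity
  rw [h1]
  linarith

end Pointwise

section CellEnergy

variable {d : ℕ} {Ω : Set (Pt d)} {N : ℕ} {T : Mesh Ω N} {ε : ℝ} {V : Pt d → ℝ} {k : Fin N}
  {A : Finset ((T.cell k).kind.Vertex d)} {u w : H1 (T.cell k).openSet}

theorem Mesh.mul_norm_gradient_sq_le_weight (hd : d ≤ 3) {x : Pt d}
    (hx : x ∈ (T.cell k).openSet) :
    ε ^ 2 / 2 * ‖gradient ((T.cell k).partialSum A) x‖ ^ 2 ≤ 2 * T.weight ε x := by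
  rw [T.weight_eq ε hx, ← Finset.mul_sum]
  have := mul_le_mul_of_nonneg_left (Cell.norm_gradient_partialSum_sq_le hd A hx)
    (show 0 ≤ ε ^ 2 / 2 by positivity)
  linarith

theorem Cell.IsScaled.s_le (h : Cell.IsScaled A u w) :
    (sCell T ε k w w).re ≤ (sCell T ε k u u).re := by
  have hμ := T.isWeight_weight ε (T.measurableSet_openSet k)
  rw [IsWeight.sSesq_apply, IsWeight.sSesq_apply, sForm_self_re, sForm_self_re]
  refine integral_mono_ae (hμ.integrable_norm_sq (H1.memLp_fn w))
    (hμ.integrable_norm_sq (H1.memLp_fn u)) ?_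
  filter_upwards [h.fn, ae_restrict_mem (T.measurableSet_openSet k)] with x h1 hx
  have hx' := (T.cell k).openSet_subset_closedSet hx
  rw [h1, norm_mul, Complex.norm_real, Real.norm_of_nonneg (Cell.partialSum_nonneg A hx')]
  refine mul_le_mul_of_nonneg_left (pow_le_pow_left₀ ?_ ?_ 2) (hμ.nonneg x hx)
  · exact mul_nonneg (Cell.partialSum_nonneg A hx') (norm_nonneg _)
  · exact mul_le_of_le_one_left (norm_nonneg _) (Cell.partialSum_le_one A hx')

theorem Cell.IsScaled.a_le (h : Cell.IsScaled A u w) (hd : d ≤ 3)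
    (hV : IsWeight (T.cell k).openSet V) :
    (hV.aSesq ε w w).re ≤ 2 * (hV.aSesq ε u u).re + 4 * (sCell T ε k u u).re := by
  have hμ := T.isWeight_weight ε (T.measurableSet_openSet k)
  rw [IsWeight.sSesq_apply, hV.aSesq_self_re, hV.aSesq_self_re, sForm_self_re,
    ← integral_const_mul, ← integral_const_mul,
    ← integral_add ((hV.integrable_energy ε u).const_mul 2)
      ((hμ.integrable_norm_sq (H1.memLp_fn u)).const_mul 4)]
  refine integral_mono_ae (hV.integrable_energy ε w) (((hV.integrable_energy ε u).const_mul 2).add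
      ((hμ.integrable_norm_sq (H1.memLp_fn u)).const_mul 4)) ?_
  filter_upwards [h.fn, h.grad, ae_restrict_mem (T.measurableSet_openSet k)] with x h1 h2 hx
  have hx' := (T.cell k).openSet_subset_closedSet hx
  have h3 := mul_norm_sq_scaled_le h2 (Cell.partialSum_nonneg A hx') (Cell.partialSum_le_one A hx')
    (show 0 ≤ ε ^ 2 / 2 by positivity) (Mesh.mul_norm_gradient_sq_le_weight hd hx)
  have h4 : ‖H1.fn w x‖ ≤ ‖H1.fn u x‖ := by
    rw [h1, norm_mul, Complex.norm_real, Real.norm_of_nonneg (Cell.partialSum_nonneg A hx')]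
    exact mul_le_of_le_one_left (norm_nonneg _) (Cell.partialSum_le_one A hx')
  have h5 : V x * ‖H1.fn w x‖ ^ 2 ≤ V x * ‖H1.fn u x‖ ^ 2 :=
    mul_le_mul_of_nonneg_left (pow_le_pow_left₀ (norm_nonneg _) h4 2) (hV.nonneg x hx)
  have h6 : 0 ≤ V x * ‖H1.fn u x‖ ^ 2 := mul_nonneg (hV.nonneg x hx) (sq_nonneg _)
  linarith

theorem Cell.IsScaled.neg_re_a_le (h : Cell.IsScaled A u w) (hd : d ≤ 3)
    (hV : IsWeight (T.cell k).openSet V) {t : ℝ} (ht : 0 < t) :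
    -(hV.aSesq ε u w).re ≤ 3 / 4 * (t * (hV.aSesq ε u u).re + (sCell T ε k u u).re / t) := by
  have hμ := T.isWeight_weight ε (T.measurableSet_openSet k)
  have hre : (hV.aSesq ε u w).re = ∫ x in (T.cell k).openSet,
      (((ε ^ 2 / 2 : ℝ) : ℂ) * ∑ i, H1.grad u x i * star (H1.grad w x i)
        + (V x : ℂ) * H1.fn u x * star (H1.fn w x)).re := by
    rw [hV.aSesq_apply, aForm]
    exact (integral_re (hV.integrable_aForm ε u w)).symm
  rw [IsWeight.sSesq_apply, hre, hV.aSesq_self_re, sForm_self_re, ← integral_neg,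
    ← integral_const_mul, ← integral_div,
    ← integral_add ((hV.integrable_energy ε u).const_mul t)
      ((hμ.integrable_norm_sq (H1.memLp_fn u)).div_const t), ← integral_const_mul]
  refine integral_mono_ae (hV.integrable_aForm ε u w).re.neg
    ((((hV.integrable_energy ε u).const_mul t).add
      ((hμ.integrable_norm_sq (H1.memLp_fn u)).div_const t)).const_mul _) ?_
  filter_upwards [h.fn, h.grad, ae_restrict_mem (T.measurableSet_openSet k)] with x h1 h2 hx
  have hx' := (T.cell k).openSet_subset_closedSet hx
  have h3 := neg_re_inner_scaled_le h2 (Cell.partialSum_nonneg A hx')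
    (show 0 ≤ ε ^ 2 / 2 by positivity) (Mesh.mul_norm_gradient_sq_le_weight hd hx) ht
  -- The potential term has the favourable sign, since the cutoff is real and nonnegative; only the
  -- gradient term has to be estimated.
  have h4 : 0 ≤ ((V x : ℂ) * H1.fn u x * star (H1.fn w x)).re := by
    have : (V x : ℂ) * H1.fn u x * star (H1.fn w x)
        = ((V x * ((T.cell k).partialSum A x * ‖H1.fn u x‖ ^ 2) : ℝ) : ℂ) := by
      rw [h1, star_mul', Complex.star_def, Complex.conj_ofReal]
      push_cast
      rw [← Complex.mul_conj']
      ring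
    rw [this, Complex.ofReal_re]
    exact mul_nonneg (hV.nonneg x hx) (mul_nonneg (Cell.partialSum_nonneg A hx') (sq_nonneg _))
  have h6 : 0 ≤ 3 / 4 * (t * (V x * ‖H1.fn u x‖ ^ 2)) := by
    have := hV.nonneg x hx
    positivity
  rw [Complex.add_re, Complex.re_ofReal_mul]
  linarith

theorem Cell.IsScaled.eq_zero (h : Cell.IsScaled A u w) (hA : A = ∅) : w = 0 := by
  subst hA
  have h0 : (T.cell k).partialSum ∅ = fun _ => 0 := funext fun x => by simp [Cell.partialSum]
  refine H1.ext_ae ?_ ?_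
  · filter_upwards [h.fn, Lp.coeFn_zero ℂ 2 (volume.restrict (T.cell k).openSet)] with x h1 h2
    refine Eq.trans ?_ h2.symm
    rw [h1, h0]
    simp
  · filter_upwards [h.grad, Lp.coeFn_zero (EuclideanSpace ℂ (Fin d)) 2
      (volume.restrict (T.cell k).openSet)] with x h1 h2
    refine Eq.trans ?_ h2.symm
    ext i
    rw [h1, h0]
    simp [gradient]

theorem Cell.IsScaled.eq_self (h : Cell.IsScaled A u w) (hA : A = Finset.univ) : w = u := by
  subst hA
  have h0 : (T.cell k).partialSum Finset.univ = fun _ => 1 :=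
    funext fun x => (T.cell k).sum_lagrange x
  refine H1.ext_ae ?_ ?_
  · filter_upwards [h.fn] with x h1
    rw [h1, h0]
    simp
  · filter_upwards [h.grad] with x h1
    ext i
    rw [h1, h0]
    simp [gradient]

open Classical in
theorem Cell.IsScaled.compl (h : Cell.IsScaled A u w) : Cell.IsScaled Aᶜ u (u - w) := by
  refine ⟨?_, ?_⟩
  · filter_upwards [h.fn, H1.fn_sub u w] with x h1 h2
    rw [h2, Pi.sub_apply, h1, Cell.partialSum_compl]
    push_cast
    ring
  · have hg : ∀ x, gradient ((T.cell k).partialSum Aᶜ) x = -gradient ((T.cell k).partialSum A) x := by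
      intro x
      have : (T.cell k).partialSum Aᶜ = fun x => 1 - (T.cell k).partialSum A x :=
        funext (Cell.partialSum_compl A)
      rw [this, gradient, fderiv_const_sub, map_neg, gradient]
    have h3 : H1.grad (u - w) =ᵐ[volume.restrict (T.cell k).openSet] H1.grad u - H1.grad w :=
      Lp.coeFn_sub _ _
    filter_upwards [h.grad, h3] with x h1 h2 i
    rw [h2, Pi.sub_apply, PiLp.sub_apply, h1, hg, Cell.partialSum_compl, PiLp.neg_apply]
    push_cast
    ring

open Classical in
theorem Cell.IsScaled.compl_of_eq (h : Cell.IsScaled A u w) {w' : H1 (T.cell k).openSet}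
    (hw : w' = u - w) : Cell.IsScaled Aᶜ u w' := by
  subst hw
  exact h.compl

end CellEnergy

/-! ### The local form `a_j(u, v) + s_j(π_j u, π_j v)` -/

section Comap

variable {X Y : Type*} [AddCommGroup X] [Module ℂ X] [AddCommGroup Y] [Module ℂ Y]

/-- The pullback of a sesquilinear form under a linear map. -/
def comapSesq (q : Sesq Y) (f : X →ₗ[ℂ] Y) : Sesq X :=
  LinearMap.mk₂'ₛₗ (RingHom.id ℂ) (starRingEnd ℂ) (fun u v => q (f u) (f v))
    (fun u u' v => by simp) (fun c u v => by simp) (fun u v v' => by simp)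
    (fun c u v => by simp)

theorem comapSesq_apply (q : Sesq Y) (f : X →ₗ[ℂ] Y) (u v : X) :
    comapSesq q f u v = q (f u) (f v) := rfl

theorem comapSesq_eq_zero (q : Sesq Y) {f : X →ₗ[ℂ] Y} {v : X} (h : f v = 0) (u : X) :
    comapSesq q f u v = 0 := by
  rw [comapSesq_apply, h, map_zero]

theorem comapSesq_congr_right (q : Sesq Y) {f : X →ₗ[ℂ] Y} {v v' : X} (h : f v = f v') (u : X) :
    comapSesq q f u v = comapSesq q f u v' := by
  rw [comapSesq_apply, h, comapSesq_apply]

theorem sesq_map_eq_zero (q : Sesq Y) (f : X →ₗ[ℂ] Y) {v : X} (h : v = 0) (u : Y) :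
    q u (f v) = 0 := by
  rw [h, map_zero, map_zero]

theorem IsHerm.comap {q : Sesq Y} (h : IsHerm q) (f : X →ₗ[ℂ] Y) : IsHerm (comapSesq q f) :=
  fun u v => h (f u) (f v)

theorem map_sub_eq_zero_of_eq (f : X →ₗ[ℂ] Y) {u v : X} (h : f v = f u) : f (u - v) = 0 := by
  rw [map_sub, h, sub_self]

theorem map_sub_eq_of_eq_zero (f : X →ₗ[ℂ] Y) {u v : X} (h : f v = 0) : f (u - v) = f u := by
  rw [map_sub, h, sub_zero]

theorem IsHerm.re_le {q : Sesq X} (h : IsHerm q) (hpos : ∀ u, 0 ≤ (q u u).re) (u v : X) :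
    (q u v).re ≤ 1 / 4 * (q u u).re + (q v v).re := by
  have h1 := h.neg_re_le hpos (t := 1 / 2) (by norm_num) (-u) v
  simp only [map_neg, LinearMap.neg_apply, Complex.neg_re, neg_neg] at h1
  linarith

theorem IsHerm.add {q q' : Sesq X} (h : IsHerm q) (h' : IsHerm q') : IsHerm (q + q') := by
  intro u v
  simp only [LinearMap.add_apply, star_add, h u v, h' u v]

theorem IsHerm.sum {ι : Type*} [Fintype ι] {B : ι → Sesq X} (h : ∀ k, IsHerm (B k)) :
    IsHerm (∑ k, B k) := by
  intro u v
  simp only [LinearMap.sum_apply, star_sum]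
  exact Finset.sum_congr rfl fun k _ => h k u v

end Comap

/-- Here σ = 1/√Λ. As s ≤ p + σ²a ≤ (1 + σ)²(a + p), the weighted term s/(1 + σ) is at most (1 +
σ)(a + p). It enters with 3/4 + 1/2, so the coefficient of a is 3/4 + 5/4 = 2, and that of p is
smaller. This is the origin of c̃. -/
theorem cross_term_le {σ a p s b q r : ℝ} (hσ : 0 ≤ σ) (ha : 0 ≤ a) (hp : 0 ≤ p)
    (hb : -b ≤ 3 / 4 * ((1 + σ) * a + s / (1 + σ))) (hq : -q ≤ ((1 + σ) * p + r / (1 + σ)) / 2)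
    (hr : r ≤ s) (hs : s ≤ p + σ ^ 2 * a) : -(b + q) ≤ 2 * (1 + σ) * (a + p) := by
  have h8 : r / (1 + σ) ≤ s / (1 + σ) := by gcongr
  have h9 : s / (1 + σ) ≤ (1 + σ) * p + (1 + σ) * a := by
    rw [div_le_iff₀ (by positivity)]
    nlinarith [mul_nonneg hσ ha, mul_nonneg hσ hp, mul_nonneg (sq_nonneg σ) hp]
  have h10 : 0 ≤ (1 + σ) * p := by positivity
  linarith

theorem one_add_one_div_sqrt_pos {Λ : ℝ} : 0 < 1 + 1 / √Λ := by positivity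

theorem add_div_eq_add_sq_mul {Λ p a : ℝ} (hΛ : 0 < Λ) :
    p + a / Λ = p + (1 / √Λ) ^ 2 * a := by
  rw [div_pow, Real.sq_sqrt hΛ.le]
  ring

/-- The left side is at most 2a + 5s, and s is replaced by p + a/Λ. -/
theorem scaled_energy_le {Λ a p s a' p' s' : ℝ} (hΛ : 0 < Λ) (ha : 0 ≤ a) (hp : 0 ≤ p)
    (h1 : a' ≤ 2 * a + 4 * s) (h2 : s' ≤ s) (h3 : p' ≤ s') (h4 : s ≤ p + a / Λ) :
    a' + p' ≤ 5 * (1 + 1 / Λ) * (a + p) := by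
  have h7 : 0 ≤ p / Λ := by positivity
  calc _ ≤ 5 * a + 5 * p + 5 * (a / Λ) + 5 * (p / Λ) := by linarith
    _ = _ := by ring

section LocalForm

variable {d : ℕ} {Ω : Set (Pt d)} {N : ℕ} {T : Mesh Ω N} {ε : ℝ} {V : Pt d → ℝ} {k : Fin N}

/-- The local bilinear form of the problem that defines the multiscale basis functions. -/
def EigenSystem.bSesq (S : EigenSystem T ε V k) (hV : IsWeight (T.cell k).openSet V) (n : ℕ) :
    Sesq (H1 (T.cell k).openSet) :=
  hV.aSesq ε + comapSesq (sCell T ε k) (S.proj n)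

theorem EigenSystem.bSesq_re (S : EigenSystem T ε V k) (hV : IsWeight (T.cell k).openSet V)
    (n : ℕ) (u v : H1 (T.cell k).openSet) : (S.bSesq hV n u v).re
      = (hV.aSesq ε u v).re + (sCell T ε k (S.proj n u) (S.proj n v)).re := rfl

theorem EigenSystem.isHerm_bSesq (S : EigenSystem T ε V k) (hV : IsWeight (T.cell k).openSet V)
    (n : ℕ) : IsHerm (S.bSesq hV n) :=
  (hV.isHerm_aSesq ε).add ((IsWeight.isHerm_sSesq _).comap _)

theorem EigenSystem.proj_le_bSesq (S : EigenSystem T ε V k) (hV : IsWeight (T.cell k).openSet V)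
    (n : ℕ) (u : H1 (T.cell k).openSet) :
    (sCell T ε k (S.proj n u) (S.proj n u)).re ≤ (S.bSesq hV n u u).re := by
  rw [bSesq_re]
  exact le_add_of_nonneg_left (hV.aSesq_self_nonneg ε u)

theorem EigenSystem.bSesq_self_nonneg (S : EigenSystem T ε V k)
    (hV : IsWeight (T.cell k).openSet V) (n : ℕ) (u : H1 (T.cell k).openSet) :
    0 ≤ (S.bSesq hV n u u).re :=
  (sCell_self_nonneg _).trans (S.proj_le_bSesq hV n u)

variable {A : Finset ((T.cell k).kind.Vertex d)} {u w : H1 (T.cell k).openSet}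

set_option maxHeartbeats 1000000 in
theorem EigenSystem.bSesq_self_scaled_le (S : EigenSystem T ε V k) (hd : d ≤ 3) (hε : 0 < ε)
    (hV : IsWeight (T.cell k).openSet V) {m : ℝ} (hm : 0 < m)
    (hVm : ∀ x ∈ (T.cell k).openSet, m ≤ V x) (n : ℕ) {Λ : ℝ} (hΛ : 0 < Λ) (hΛn : Λ ≤ S.eigval n)
    (h : Cell.IsScaled A u w) :
    (S.bSesq hV n w w).re ≤ 5 * (1 + 1 / Λ) * (S.bSesq hV n u u).re := by
  have h1 := h.a_le hd hV (ε := ε)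
  have h2 := h.s_le (ε := ε)
  have h3 := S.proj_le hε hV hm hVm n w
  have h4 := S.le_proj_add hε hV hm hVm n hΛ hΛn u
  have h5 := hV.aSesq_self_nonneg ε u
  have h6 := sCell_self_nonneg (T := T) (ε := ε) (S.proj n u)
  rw [bSesq_re, bSesq_re]
  exact scaled_energy_le hΛ h5 h6 h1 h2 h3 h4

set_option maxHeartbeats 1000000 in
theorem EigenSystem.neg_re_bSesq_scaled_le (S : EigenSystem T ε V k) (hd : d ≤ 3) (hε : 0 < ε)
    (hV : IsWeight (T.cell k).openSet V) {m : ℝ} (hm : 0 < m)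
    (hVm : ∀ x ∈ (T.cell k).openSet, m ≤ V x) (n : ℕ) {Λ : ℝ} (hΛ : 0 < Λ) (hΛn : Λ ≤ S.eigval n)
    (h : Cell.IsScaled A u w) :
    -(S.bSesq hV n u w).re ≤ cTilde Λ * (S.bSesq hV n u u).re := by
  rw [S.bSesq_re, S.bSesq_re]
  exact cross_term_le (by positivity) (hV.aSesq_self_nonneg ε u) (sCell_self_nonneg _)
    (h.neg_re_a_le hd hV one_add_one_div_sqrt_pos)
    (isHerm_sCell.neg_re_le sCell_self_nonneg one_add_one_div_sqrt_pos _ _)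
    ((S.proj_le hε hV hm hVm n w).trans h.s_le)
    ((S.le_proj_add hε hV hm hVm n hΛ hΛn u).trans_eq (add_div_eq_add_sq_mul hΛ))

end LocalForm

/-! ### Exponential decay -/

section Decay

variable {X : Type*} [AddCommGroup X] [Module ℂ X] {ι : Type*} [Fintype ι]

open Classical in
/-- The energy of a vector outside a set of indices. -/
def energyOutside (B : ι → Sesq X) (ψ : X) (I : Set ι) : ℝ :=
  ∑ k, if k ∈ I then 0 else (B k ψ ψ).re

/-- Outside J the test contributes the energy itself, inside I nothing. So the energy outside J is
at most c times the energy of the ring, which is the difference of the two outer energies; solving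
for it gives c/(1 + c). -/
theorem energyOutside_le_mul {B : ι → Sesq X} {ψ w : X} {I J : Set ι} {c : ℝ} (hc : 0 ≤ c)
    (hIJ : I ⊆ J) (hin : ∀ k ∈ I, (B k ψ w).re = 0)
    (hout : ∀ k ∉ J, (B k ψ w).re = (B k ψ ψ).re)
    (hring : ∀ k, -(B k ψ w).re ≤ c * (B k ψ ψ).re) (htest : ∑ k, (B k ψ w).re = 0) :
    energyOutside B ψ J ≤ c / (1 + c) * energyOutside B ψ I := by
  classical
  have key : energyOutside B ψ J - ∑ k, (B k ψ w).re
      ≤ c * (energyOutside B ψ I - energyOutside B ψ J) := by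
    simp only [energyOutside, mul_sub, Finset.mul_sum]
    rw [← Finset.sum_sub_distrib, ← Finset.sum_sub_distrib]
    refine Finset.sum_le_sum fun k _ => ?_
    by_cases hI : k ∈ I
    · simp [hI, hIJ hI, hin k hI]
    · by_cases hJ : k ∈ J
      · simpa [hI, hJ] using hring k
      · simp [hI, hJ, hout k hJ]
  rw [htest, sub_zero] at key
  rw [div_mul_eq_mul_div, le_div_iff₀ (by positivity)]
  linarith

/-- The term p on the right is absorbed by the energy of element j, which is not part of the outside
energy. -/
theorem energyOutside_le_of_test {B : ι → Sesq X} {ψ : X} {I : Set ι} {j : ι} {s p : ℝ}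
    (hj : j ∈ I) (h0 : ∀ k, 0 ≤ (B k ψ ψ).re) (hp : p ≤ (B j ψ ψ).re)
    (htest : ∑ k, (B k ψ ψ).re ≤ s + p) : energyOutside B ψ I ≤ s := by
  classical
  have h1 : energyOutside B ψ I + (B j ψ ψ).re ≤ ∑ k, (B k ψ ψ).re := by
    rw [energyOutside]
    rw [← Finset.add_sum_erase _ _ (Finset.mem_univ j), ← Finset.add_sum_erase _ (fun k =>
      (B k ψ ψ).re) (Finset.mem_univ j), if_pos hj, zero_add, add_comm]
    gcongr with k
    split_ifs
    · exact h0 k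
    · exact le_rfl
  linarith

/-- Galerkin orthogonality bounds the error by the energy of a cutoff of the solution. -/
theorem sum_re_error_le {B : ι → Sesq X} (hB : ∀ k, IsHerm (B k)) (h0 : ∀ k u, 0 ≤ (B k u u).re)
    {ψ ψl w : X} (h : ∑ k, B k ψ (ψl - (ψ - w)) = ∑ k, B k ψl (ψl - (ψ - w))) :
    ∑ k, (B k (ψ - ψl) (ψ - ψl)).re ≤ ∑ k, (B k w w).re := by
  -- Pythagoras: w is the sum of the error ψ - ψl and the test vector ψl - (ψ - w), to which the
  -- error is B-orthogonal.
  have h1 := (IsHerm.sum hB).re_add (ψ - ψl) (ψl - (ψ - w))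
  have h2 : (∑ k, B k) (ψ - ψl) (ψl - (ψ - w)) = 0 := by
    rw [map_sub (∑ k, B k), LinearMap.sub_apply]
    simp only [LinearMap.sum_apply]
    rw [h, sub_self]
  rw [h2, show ψ - ψl + (ψl - (ψ - w)) = w by abel] at h1
  simp only [LinearMap.sum_apply, Complex.re_sum, Complex.zero_re, mul_zero, add_zero] at h1
  rw [h1]
  exact le_add_of_nonneg_right (Finset.sum_nonneg fun k _ => h0 k _)

theorem sum_re_eq {f : ι → ℂ} {c : ℂ} (h : ∑ k, f k = c) : ∑ k, (f k).re = c.re := by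
  rw [← Complex.re_sum, h]

theorem sum_re_le_mul_energyOutside {B : ι → Sesq X} {ψ w : X} {I : Set ι} {C : ℝ}
    (hin : ∀ k ∈ I, (B k w w).re = 0) (hC : ∀ k, (B k w w).re ≤ C * (B k ψ ψ).re) :
    ∑ k, (B k w w).re ≤ C * energyOutside B ψ I := by
  classical
  rw [energyOutside, Finset.mul_sum]
  refine Finset.sum_le_sum fun k _ => ?_
  split_ifs with h
  · rw [hin k h, mul_zero]
  · exact hC k

end Decay

theorem cTilde_pos {Λ : ℝ} : 0 < cTilde Λ := by
  unfold cTilde; positivity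

theorem theta_pos {Λ : ℝ} : 0 < theta Λ := div_pos cTilde_pos (by linarith [cTilde_pos (Λ := Λ)])

theorem theta_lt_one {Λ : ℝ} : theta Λ < 1 := by
  rw [theta, div_lt_one] <;> linarith [cTilde_pos (Λ := Λ)]

/-- Since c̃ ≥ 2, θ is at least 2/3. This makes up for the one layer that the cutoff uses. -/
theorem one_le_mul_theta {Λ : ℝ} : 1 ≤ 3 / 2 * theta Λ := by
  have h : 2 ≤ cTilde Λ := by
    have : 0 ≤ 1 / √Λ := by positivity
    unfold cTilde; linarith
  rw [theta, ← mul_div_assoc, le_div_iff₀ (by linarith)]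
  linarith

/-! ### Decomposition of the global forms into local ones -/

section Global

variable {d : ℕ} {Ω : Set (Pt d)} {N : ℕ} {T : Mesh Ω N} {ε : ℝ} {V : Pt d → ℝ}

theorem Mesh.integral_eq_sum (T : Mesh Ω N) {f : Pt d → ℂ}
    (hf : ∀ k, IntegrableOn f (T.cell k).openSet) :
    ∫ x in Ω, f x = ∑ k, ∫ x in (T.cell k).openSet, f x := by
  have h : volume.restrict Ω = volume.restrict (⋃ k, (T.cell k).openSet) := by
    have h1 : ∀ᵐ x ∂(volume.restrict Ω), x ∈ ⋃ k, (T.cell k).openSet := by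
      filter_upwards [T.ae_mem_openSet] with x hx using mem_iUnion.2 hx
    have h2 := Measure.restrict_eq_self_of_ae_mem h1
    rw [← h2, Measure.restrict_restrict (MeasurableSet.iUnion T.measurableSet_openSet),
      inter_eq_left.2 (iUnion_subset T.subset)]
  rw [h, integral_iUnion_fintype T.measurableSet_openSet (fun j k hjk => T.disjoint j k hjk) hf]

/-- The restriction to an element. -/
def Mesh.res (T : Mesh Ω N) (hΩ : IsOpen Ω) (k : Fin N) : H1 Ω →ₗ[ℂ] H1 (T.cell k).openSet :=
  H1.res hΩ.measurableSet (T.subset k)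

theorem Mesh.fn_res (T : Mesh Ω N) (hΩ : IsOpen Ω) (k : Fin N) (v : H1 Ω) :
    ∀ᵐ x ∂(volume.restrict (T.cell k).openSet), H1.fn (T.res hΩ k v) x = H1.fn v x :=
  H1.fn_res hΩ.measurableSet (T.subset k) v

theorem Mesh.grad_res (T : Mesh Ω N) (hΩ : IsOpen Ω) (k : Fin N) (v : H1 Ω) :
    ∀ᵐ x ∂(volume.restrict (T.cell k).openSet), H1.grad (T.res hΩ k v) x = H1.grad v x :=
  H1.grad_res hΩ.measurableSet (T.subset k) v

theorem aForm_integrand_congr {c V : ℂ} {g g' h h' : EuclideanSpace ℂ (Fin d)} {f f' u u' : ℂ}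
    (hg : g' = g) (hh : h' = h) (hf : f' = f) (hu : u' = u) :
    c * ∑ i, g i * star (h i) + V * f * star u = c * ∑ i, g' i * star (h' i) + V * f' * star u' := by
  rw [hg, hh, hf, hu]

theorem aForm_eq_sum (hΩ : IsOpen Ω) (hV : IsWeight Ω V) (u v : H1 Ω) :
    aForm ε V u v = ∑ k, aForm ε V (T.res hΩ k u) (T.res hΩ k v) :=
  (T.integral_eq_sum fun k => IntegrableOn.mono_set (hV.integrable_aForm ε u v) (T.subset k)).trans
    (Finset.sum_congr rfl fun k _ => integral_congr_ae (by
      filter_upwards [T.fn_res hΩ k u, T.fn_res hΩ k v, T.grad_res hΩ k u, T.grad_res hΩ k v]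
        with x h1 h2 h3 h4 using aForm_integrand_congr h3 h4 h1 h2))

variable (S : ∀ j, EigenSystem T ε V j) (L : Fin N → ℕ)

theorem auxFun_eqOn (k : Fin N) (i : ℕ) :
    EqOn (auxFun S k i) (H1.fn ((S k).eigfun i)) (T.cell k).openSet :=
  fun _ hx => indicator_of_mem hx _

theorem sForm_auxFun_left (hΩ : IsOpen Ω) (k : Fin N) (i : ℕ) (f : Pt d → ℂ) :
    sForm (T.weight ε) Ω (auxFun S k i) f
      = sForm (T.weight ε) (T.cell k).openSet (H1.fn ((S k).eigfun i)) f := by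
  rw [sForm, setIntegral_eq_of_subset_of_forall_sdiff_eq_zero hΩ.measurableSet (T.subset k)]
  · exact setIntegral_congr_fun (T.measurableSet_openSet k) fun x hx => by
      simp only [auxFun_eqOn S k i hx]
  · intro x hx
    simp [auxFun, indicator_of_notMem hx.2]

theorem sForm_auxFun_right (hΩ : IsOpen Ω) (k : Fin N) (i : ℕ) (f : Pt d → ℂ) :
    sForm (T.weight ε) Ω f (auxFun S k i)
      = sForm (T.weight ε) (T.cell k).openSet f (H1.fn ((S k).eigfun i)) := by
  rw [sForm_comm (auxFun S k i) f, sForm_auxFun_left S hΩ, ← sForm_comm]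

theorem sForm_auxFun_self (hΩ : IsOpen Ω) (k : Fin N) (i : ℕ) :
    sForm (T.weight ε) Ω (auxFun S k i) (auxFun S k i)
      = sCell T ε k ((S k).eigfun i) ((S k).eigfun i) := by
  rw [sForm_auxFun_left S hΩ]
  exact setIntegral_congr_fun (T.measurableSet_openSet k) fun x hx => by
    simp only [auxFun_eqOn S k i hx]

theorem sForm_fn_auxFun (hΩ : IsOpen Ω) (k : Fin N) (i : ℕ) (v : H1 Ω) :
    sForm (T.weight ε) Ω (H1.fn v) (auxFun S k i)
      = sCell T ε k (T.res hΩ k v) ((S k).eigfun i) :=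
  (sForm_auxFun_right S hΩ k i _).trans
    (sForm_congr (EventuallyEq.symm (T.fn_res hΩ k v)) (ae_eq_refl _))

theorem H1.fn_sum {U : Set (Pt d)} {n : ℕ} (c : Fin n → ℂ) (φ : Fin n → H1 U) :
    H1.fn (∑ i, c i • φ i) =ᵐ[volume.restrict U] fun x => ∑ i, c i * H1.fn (φ i) x := by
  induction n with
  | zero =>
    filter_upwards [Lp.coeFn_zero ℂ 2 (volume.restrict U)] with x hx
    rw [Finset.univ_eq_empty, Finset.sum_empty, Finset.sum_empty]
    exact hx
  | succ n ih =>
    rw [Fin.sum_univ_succ]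
    filter_upwards [H1.fn_add (c 0 • φ 0) (∑ i : Fin n, c i.succ • φ i.succ),
      H1.fn_smul (c 0) (φ 0), ih (fun i => c i.succ) fun i => φ i.succ] with x h1 h2 h3
    rw [h1, Pi.add_apply, h2, h3, Fin.sum_univ_succ]
    rfl

-- On K_k only the auxiliary functions of that element survive, and the coefficients are integrals
-- over K_k because those functions vanish elsewhere. So π acts element by element.
set_option maxHeartbeats 1000000 in
theorem auxProj_ae_eq (hΩ : IsOpen Ω) (k : Fin N) (v : H1 Ω) :
    auxProj S L (H1.fn v) =ᵐ[volume.restrict (T.cell k).openSet]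
      H1.fn ((S k).proj (L k) (T.res hΩ k v)) := by
  have h1 := H1.fn_sum (fun i : Fin (L k) => sCell T ε k (T.res hΩ k v) ((S k).eigfun i)
    / sCell T ε k ((S k).eigfun i) ((S k).eigfun i)) fun i => (S k).eigfun i
  refine EventuallyEq.trans ?_ h1.symm
  filter_upwards [ae_restrict_mem (T.measurableSet_openSet k)] with x hx
  rw [auxProj, Finset.sum_eq_single k, Finset.sum_range]
  · exact Finset.sum_congr rfl fun i _ => congrArg₂ (· * ·)
      (congrArg₂ (· / ·) (sForm_fn_auxFun S hΩ k i v) (sForm_auxFun_self S hΩ k i))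
      (auxFun_eqOn S k i hx)
  · intro k' _ hk'
    refine Finset.sum_eq_zero fun i _ => ?_
    rw [auxFun, indicator_of_notMem fun h => disjoint_left.1 (T.disjoint k' k hk') h hx, mul_zero]
  · simp

theorem sForm_auxProj_eq_sum (hΩ : IsOpen Ω) (u v : H1 Ω) :
    sForm (T.weight ε) Ω (auxProj S L (H1.fn u)) (auxProj S L (H1.fn v))
      = ∑ k, sCell T ε k ((S k).proj (L k) (T.res hΩ k u)) ((S k).proj (L k) (T.res hΩ k v)) := by
  have h : ∀ k, (fun x => (T.weight ε x : ℂ) * auxProj S L (H1.fn u) x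
      * star (auxProj S L (H1.fn v) x)) =ᵐ[volume.restrict (T.cell k).openSet]
      fun x => (T.weight ε x : ℂ) * H1.fn ((S k).proj (L k) (T.res hΩ k u)) x
        * star (H1.fn ((S k).proj (L k) (T.res hΩ k v)) x) := fun k => by
    filter_upwards [auxProj_ae_eq S L hΩ k u, auxProj_ae_eq S L hΩ k v] with x h1 h2
      using congrArg₂ (fun a b => (T.weight ε x : ℂ) * a * star b) h1 h2
  exact (T.integral_eq_sum fun k => Integrable.congr
    ((T.isWeight_weight ε (T.measurableSet_openSet k)).integrable (H1.memLp_fn _) (H1.memLp_fn _))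
    (h k).symm).trans (Finset.sum_congr rfl fun k _ => integral_congr_ae (h k))

theorem sForm_auxFun_auxProj (hΩ : IsOpen Ω) (k : Fin N) (i : ℕ) (v : H1 Ω) :
    sForm (T.weight ε) Ω (auxFun S k i) (auxProj S L (H1.fn v))
      = sCell T ε k ((S k).eigfun i) ((S k).proj (L k) (T.res hΩ k v)) := by
  rw [sForm_auxFun_left S hΩ]
  exact sForm_congr (ae_eq_refl _) (auxProj_ae_eq S L hΩ k v)

/-- The contribution of an element to the form `a(u, v) + s(π u, π v)`. -/
def localSesq (hΩ : IsOpen Ω) (hV : IsWeight Ω V) (k : Fin N) : Sesq (H1 Ω) :=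
  comapSesq ((S k).bSesq (hV.mono (T.measurableSet_openSet k) (T.subset k)) (L k)) (T.res hΩ k)

theorem isHerm_localSesq (hΩ : IsOpen Ω) (hV : IsWeight Ω V) (k : Fin N) :
    IsHerm (localSesq S L hΩ hV k) := ((S k).isHerm_bSesq _ _).comap _

theorem aForm_add_sForm_eq_sum (hΩ : IsOpen Ω) (hV : IsWeight Ω V) (u v : H1 Ω) :
    aForm ε V u v + sForm (T.weight ε) Ω (auxProj S L (H1.fn u)) (auxProj S L (H1.fn v))
      = ∑ k, localSesq S L hΩ hV k u v :=
  (congrArg₂ (· + ·) (aForm_eq_sum (T := T) hΩ hV u v) (sForm_auxProj_eq_sum S L hΩ u v)).trans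
    (Finset.sum_add_distrib.symm.trans (Finset.sum_congr rfl fun k _ => congrArg (· + _)
      ((hV.mono (T.measurableSet_openSet k) (T.subset k)).aSesq_apply ε _ _).symm))

end Global

/-! ### Cutoff in layers -/

section Layers

variable {d : ℕ} {Ω : Set (Pt d)} {N : ℕ} (T : Mesh Ω N)

theorem RefCell.nonempty_vertex : ∀ k : RefCell, Nonempty (k.Vertex d)
  | .simplex => ⟨(none : Option (Fin d))⟩
  | .cube => ⟨(fun _ => true : Fin d → Bool)⟩

namespace Mesh

/-- Every element has a vertex, so it is nonempty and touches itself. -/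
theorem layerIdx_subset_succ (j : Fin N) (m : ℕ) : T.layerIdx j m ⊆ T.layerIdx j (m + 1) := by
  intro k hk
  obtain ⟨v⟩ := (T.cell k).kind.nonempty_vertex (d := d)
  exact ⟨k, hk, _, (T.cell k).vertex_mem v, (T.cell k).vertex_mem v⟩

theorem mem_layerIdx (j : Fin N) (m : ℕ) : j ∈ T.layerIdx j m := by
  induction m with
  | zero => exact mem_singleton j
  | succ m ih => exact T.layerIdx_subset_succ j m ih

open Classical in
/-- The vertices of the elements of `K_j^m`. -/
def layerVertices (j : Fin N) (m : ℕ) : Finset (Pt d) :=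
  (Finset.univ.filter (· ∈ T.layerIdx j m)).biUnion fun k => Finset.univ.image (T.cell k).vertex

theorem mem_layerVertices {j : Fin N} {m : ℕ} {p : Pt d} :
    p ∈ T.layerVertices j m ↔ ∃ k ∈ T.layerIdx j m, ∃ v, (T.cell k).vertex v = p := by
  simp [layerVertices]

theorem vertsIn_of_mem {j : Fin N} {m : ℕ} {k : Fin N} (hk : k ∈ T.layerIdx j m) :
    (T.cell k).vertsIn (T.layerVertices j m) = Finset.univ := by
  classical
  refine Finset.filter_true_of_mem fun v _ => ?_
  exact (T.mem_layerVertices).2 ⟨k, hk, v, rfl⟩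

/-- An element that shares a vertex with K_j^m touches it and so belongs to the next layer. -/
theorem vertsIn_of_notMem {j : Fin N} {m : ℕ} {k : Fin N} (hk : k ∉ T.layerIdx j (m + 1)) :
    (T.cell k).vertsIn (T.layerVertices j m) = ∅ := by
  classical
  refine Finset.filter_false_of_mem fun v _ hv => hk ?_
  obtain ⟨i, hi, v', hv'⟩ := (T.mem_layerVertices).1 hv
  exact ⟨i, hi, _, hv' ▸ (T.cell i).vertex_mem v', (T.cell k).vertex_mem v⟩

/-- Multiplication by a cutoff function that is `0` on `K_j^m` and `1` outside `K_j^{m+1}`. -/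
theorem exists_cutoff (hΩ : IsOpen Ω) (j : Fin N) (ψ : H1 Ω) (m : ℕ) : ∃ w : H1 Ω,
    (∀ k, ∃ A, Cell.IsScaled A (T.res hΩ k ψ) (T.res hΩ k w)) ∧
    (∀ k ∈ T.layerIdx j m, T.res hΩ k w = 0) ∧
    ∀ k ∉ T.layerIdx j (m + 1), T.res hΩ k w = T.res hΩ k ψ := by
  classical
  obtain ⟨z, hz⟩ := T.exists_isScaled hΩ (T.layerVertices j m) ψ
  have hz' : ∀ k, Cell.IsScaled ((T.cell k).vertsIn (T.layerVertices j m))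
      (T.res hΩ k ψ) (T.res hΩ k z) := hz
  -- Here z = χψ, so the witness is (1 - χ)ψ. By the partition of unity it is again a product with a
  -- partial sum, over the complementary vertices.
  refine ⟨ψ - z, fun k => ⟨((T.cell k).vertsIn (T.layerVertices j m))ᶜ, ?_⟩, fun k hk => ?_, fun k hk => ?_⟩
  · exact (hz' k).compl_of_eq (map_sub _ _ _)
  · exact map_sub_eq_zero_of_eq _ ((hz' k).eq_self (T.vertsIn_of_mem hk))
  · exact map_sub_eq_of_eq_zero _ ((hz' k).eq_zero (T.vertsIn_of_notMem hk))

theorem mem_localSpace (hΩ : IsOpen Ω) {j : Fin N} {m : ℕ} {v : H1 Ω}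
    (h : ∀ k ∉ T.layerIdx j m, T.res hΩ k v = 0) : v ∈ localSpace T j m := by
  have h1 : ∀ k, ∀ᵐ x ∂(volume.restrict Ω), x ∈ (T.cell k).openSet → k ∉ T.layerIdx j m →
      H1.fn v x = 0 := by
    intro k
    by_cases hk : k ∈ T.layerIdx j m
    · exact Eventually.of_forall fun x _ h => absurd hk h
    · have h2 : ∀ᵐ x ∂(volume.restrict (T.cell k).openSet), H1.fn v x = 0 := by
        have h3 := T.fn_res hΩ k v
        rw [h k hk] at h3
        filter_upwards [h3, Lp.coeFn_zero ℂ 2 (volume.restrict (T.cell k).openSet)] with x h4 h5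
        exact h4.symm.trans h5
      filter_upwards [ae_restrict_of_ae ((ae_restrict_iff' (T.measurableSet_openSet k)).1 h2)]
        with x hx hxk _ using hx hxk
  filter_upwards [T.ae_mem_openSet, ae_all_iff.2 h1] with x ⟨k, hk⟩ hx hxl
  refine hx k hk fun hkl => hxl ?_
  exact mem_biUnion hkl ((T.cell k).openSet_subset_closedSet hk)

theorem sub_mem_localSpace {j : Fin N} {m : ℕ} {v w : H1 Ω} (hv : v ∈ localSpace T j m)
    (hw : w ∈ localSpace T j m) : v - w ∈ localSpace T j m := by
  have hv' : ∀ᵐ x ∂(volume.restrict Ω), x ∉ T.layer j m → H1.fn v x = 0 := hv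
  have hw' : ∀ᵐ x ∂(volume.restrict Ω), x ∉ T.layer j m → H1.fn w x = 0 := hw
  filter_upwards [hv', hw', H1.fn_sub v w] with x h1 h2 h3 hx
  rw [h3, Pi.sub_apply, h1 hx, h2 hx, sub_zero]

end Mesh

end Layers

/-! ### Exponential decay of the multiscale basis functions -/

/-- The constants 5 and 1/4 give 5/4; trading θ^m for θ^(m+1) costs 3/2 and gives 15/8, half of the
stated constant. -/
theorem le_of_le_pow_mul {Λ θ s E x : ℝ} {m : ℕ} (hΛ : 0 < Λ) (hθ : 0 < θ)
    (hθ1 : 1 ≤ 3 / 2 * θ) (hs : 0 ≤ s) (hE : E ≤ θ ^ m * (1 / 4 * s))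
    (hx : x ≤ 5 * (1 + 1 / Λ) * E) : x ≤ 15 / 4 * (1 + 1 / Λ) * θ ^ (m + 1) * s := by
  have h0 : 0 ≤ (1 + 1 / Λ) * θ ^ m * s := by positivity
  calc x ≤ 5 * (1 + 1 / Λ) * (θ ^ m * (1 / 4 * s)) := hx.trans (by gcongr)
    _ = 5 / 4 * ((1 + 1 / Λ) * θ ^ m * s) * 1 := by ring
    _ ≤ 5 / 4 * ((1 + 1 / Λ) * θ ^ m * s) * (3 / 2 * θ) := by gcongr
    _ = 15 / 8 * ((1 + 1 / Λ) * θ ^ m * s * θ) := by ring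
    _ ≤ 15 / 4 * ((1 + 1 / Λ) * θ ^ m * s * θ) := by gcongr; norm_num
    _ = _ := by ring

section Main

variable {d : ℕ} {Ω : Set (Pt d)} {N : ℕ} {T : Mesh Ω N} {ε : ℝ} {V : Pt d → ℝ}
  {S : ∀ j, EigenSystem T ε V j} {L : Fin N → ℕ} {hΩ : IsOpen Ω} {hV : IsWeight Ω V}
  {j : Fin N} {i : ℕ} {ψ : H1 Ω}

theorem minLeftOut_le (k : Fin N) : minLeftOut S L ≤ (S k).eigval (L k) :=
  ciInf_le (finite_range _).bddBelow k

theorem minLeftOut_pos (hε : 0 < ε) (hV : IsWeight Ω V) {m : ℝ} (hm : 0 < m)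
    (hVm : ∀ x ∈ Ω, m ≤ V x) (j : Fin N) : 0 < minLeftOut S L := by
  have : Nonempty (Fin N) := ⟨j⟩
  obtain ⟨k, hk⟩ := exists_eq_ciInf_of_finite (f := fun j => (S j).eigval (L j))
  rw [minLeftOut, ← hk]
  exact ((S k).pos hε (hV.mono (T.measurableSet_openSet k) (T.subset k)) hm
    (fun x hx => hVm x (T.subset k hx)) (L k)).1

theorem localSesq_self_nonneg (k : Fin N) (u : H1 Ω) : 0 ≤ (localSesq S L hΩ hV k u u).re :=
  (S k).bSesq_self_nonneg _ _ _

theorem IsGlobalBasis.sum_eq (hψ : IsGlobalBasis S L j i ψ) (hΩ : IsOpen Ω) (hV : IsWeight Ω V)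
    (v : H1 Ω) : ∑ k, localSesq S L hΩ hV k ψ v
      = sCell T ε j ((S j).eigfun i) ((S j).proj (L j) (T.res hΩ j v)) :=
  (aForm_add_sForm_eq_sum S L hΩ hV ψ v).symm.trans
    ((hψ v).trans (sForm_auxFun_auxProj S L hΩ j i v))

theorem IsLocalBasis.sum_eq {m : ℕ} (hψ : IsLocalBasis S L j i m ψ) (hΩ : IsOpen Ω)
    (hV : IsWeight Ω V) {v : H1 Ω} (hv : v ∈ localSpace T j m) :
    ∑ k, localSesq S L hΩ hV k ψ v
      = sCell T ε j ((S j).eigfun i) ((S j).proj (L j) (T.res hΩ j v)) :=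
  (aForm_add_sForm_eq_sum S L hΩ hV ψ v).symm.trans
    ((hψ.2 v hv).trans (sForm_auxFun_auxProj S L hΩ j i v))

/-- Test with ψ itself: the right-hand side s(φ, πψ) is at most ¼ ‖φ‖² plus the part of the energy
of K_j that comes from π. -/
theorem IsGlobalBasis.energyOutside_zero_le (hψ : IsGlobalBasis S L j i ψ) (hΩ : IsOpen Ω)
    (hV : IsWeight Ω V) :
    energyOutside (localSesq S L hΩ hV) ψ (T.layerIdx j 0)
      ≤ 1 / 4 * (sCell T ε j ((S j).eigfun i) ((S j).eigfun i)).re := by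
  refine energyOutside_le_of_test (T.mem_layerIdx j 0) (fun k => localSesq_self_nonneg k ψ)
    ((S j).proj_le_bSesq (hV.mono (T.measurableSet_openSet j) (T.subset j)) (L j)
      (T.res hΩ j ψ)) ?_
  exact (sum_re_eq (hψ.sum_eq hΩ hV ψ)).trans_le
    (isHerm_sCell.re_le sCell_self_nonneg ((S j).eigfun i) ((S j).proj (L j) (T.res hΩ j ψ)))

theorem IsGlobalBasis.energyOutside_succ_le (hψ : IsGlobalBasis S L j i ψ) (hΩ : IsOpen Ω)
    (hd : d ≤ 3) (hε : 0 < ε) (hV : IsWeight Ω V) {c : ℝ} (hc : 0 < c)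
    (hVc : ∀ x ∈ Ω, c ≤ V x) (m : ℕ) :
    energyOutside (localSesq S L hΩ hV) ψ (T.layerIdx j (m + 1))
      ≤ theta (minLeftOut S L) * energyOutside (localSesq S L hΩ hV) ψ (T.layerIdx j m) := by
  obtain ⟨w, hw, hin, hout⟩ := T.exists_cutoff hΩ j ψ m
  refine energyOutside_le_mul (w := w) cTilde_pos.le (T.layerIdx_subset_succ j m)
    (fun k hk => ?_) (fun k hk => ?_) (fun k => ?_) ?_
  · exact congrArg Complex.re (comapSesq_eq_zero _ (hin k hk) ψ)
  · exact congrArg Complex.re (comapSesq_congr_right _ (hout k hk) ψ)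
  · obtain ⟨A, hA⟩ := hw k
    exact (S k).neg_re_bSesq_scaled_le hd hε _ hc (fun x hx => hVc x (T.subset k hx)) (L k)
      (minLeftOut_pos hε hV hc hVc j) (minLeftOut_le k) hA
  -- The source term lives on K_j, where the test function vanishes.
  · exact (sum_re_eq (hψ.sum_eq hΩ hV w)).trans (congrArg Complex.re
      (sesq_map_eq_zero _ _ (hin j (T.mem_layerIdx j m)) _))

theorem IsGlobalBasis.energyOutside_le (hψ : IsGlobalBasis S L j i ψ) (hΩ : IsOpen Ω)
    (hd : d ≤ 3) (hε : 0 < ε) (hV : IsWeight Ω V) {c : ℝ} (hc : 0 < c)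
    (hVc : ∀ x ∈ Ω, c ≤ V x) (m : ℕ) :
    energyOutside (localSesq S L hΩ hV) ψ (T.layerIdx j m)
      ≤ theta (minLeftOut S L) ^ m
        * (1 / 4 * (sCell T ε j ((S j).eigfun i) ((S j).eigfun i)).re) := by
  induction m with
  | zero => simpa using hψ.energyOutside_zero_le hΩ hV
  | succ m ih =>
    refine (hψ.energyOutside_succ_le hΩ hd hε hV hc hVc m).trans ?_
    rw [pow_succ', mul_assoc]
    exact mul_le_mul_of_nonneg_left ih theta_pos.le

-- The comparison function in the local space is χψ, with χ falling from 1 to 0 between layers m and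
-- m + 1; the error is then bounded by the energy of (1 - χ)ψ, which vanishes on K_j^m.
set_option maxHeartbeats 1000000 in
theorem IsLocalBasis.sum_error_le {ψl : H1 Ω} {m : ℕ} (hψl : IsLocalBasis S L j i (m + 1) ψl)
    (hψ : IsGlobalBasis S L j i ψ) (hΩ : IsOpen Ω)
    (hd : d ≤ 3) (hε : 0 < ε) (hV : IsWeight Ω V) {c : ℝ} (hc : 0 < c)
    (hVc : ∀ x ∈ Ω, c ≤ V x) :
    ∑ k, (localSesq S L hΩ hV k (ψ - ψl) (ψ - ψl)).re ≤ 5 * (1 + 1 / minLeftOut S L)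
      * energyOutside (localSesq S L hΩ hV) ψ (T.layerIdx j m) := by
  obtain ⟨w, hw, hin, hout⟩ := T.exists_cutoff hΩ j ψ m
  have hv : ψl - (ψ - w) ∈ localSpace T j (m + 1) :=
    T.sub_mem_localSpace hψl.1 (T.mem_localSpace hΩ fun k hk => map_sub_eq_zero_of_eq _ (hout k hk))
  refine (sum_re_error_le (isHerm_localSesq S L hΩ hV) (fun k u => localSesq_self_nonneg k u)
    ((hψ.sum_eq hΩ hV _).trans (hψl.sum_eq hΩ hV hv).symm)).trans
    (sum_re_le_mul_energyOutside (fun k hk => ?_) fun k => ?_)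
  · exact congrArg Complex.re (comapSesq_eq_zero _ (hin k hk) w)
  · obtain ⟨A, hA⟩ := hw k
    exact (S k).bSesq_self_scaled_le hd hε _ hc (fun x hx => hVc x (T.subset k hx)) (L k)
      (minLeftOut_pos hε hV hc hVc j) (minLeftOut_le k) hA

end Main

end CEM

end

theorem theorem4p5 {d : ℕ} (hd1 : 1 ≤ d) (hd3 : d ≤ 3)
    (Ω : Set (CEM.Pt d)) (hΩ : IsOpen Ω) {N : ℕ} (T : CEM.Mesh Ω N)
    (ε : ℝ) (hε : 0 < ε)
    (V : CEM.Pt d → ℝ) (hV : Measurable V) (Vmin Vmax : ℝ) (hVmin : 0 < Vmin)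
    (hVbd : ∀ x ∈ Ω, Vmin ≤ V x ∧ V x ≤ Vmax)
    (S : ∀ j, CEM.EigenSystem T ε V j) (L : Fin N → ℕ)
    (j : Fin N) (i : ℕ) (hi : i < L j) (l : ℕ) (hl : 1 ≤ l)
    (ψ ψl : CEM.H1 Ω)
    (hψ : CEM.IsGlobalBasis S L j i ψ) (hψl : CEM.IsLocalBasis S L j i l ψl) :
    0 < CEM.minLeftOut S L ∧
    0 < CEM.theta (CEM.minLeftOut S L) ∧ CEM.theta (CEM.minLeftOut S L) < 1 ∧
    CEM.aNormSq ε V (ψ - ψl)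
        + CEM.sNormSq (T.weight ε) Ω (CEM.auxProj S L (CEM.H1.fn (ψ - ψl)))
      ≤ 15 / 4 * (1 + 1 / CEM.minLeftOut S L) * CEM.theta (CEM.minLeftOut S L) ^ l
        * CEM.sNormSq (T.weight ε) Ω (CEM.auxFun S j i) := by
  have hW : CEM.IsWeight Ω V :=
    ⟨hΩ.measurableSet, hV, fun x hx => hVmin.le.trans (hVbd x hx).1, Vmax, fun x hx => (hVbd x hx).2⟩
  have hVm : ∀ x ∈ Ω, Vmin ≤ V x := fun x hx => (hVbd x hx).1
  have hΛ := CEM.minLeftOut_pos (S := S) (L := L) hε hW hVmin hVm j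
  refine ⟨hΛ, CEM.theta_pos, CEM.theta_lt_one, ?_⟩
  -- Here m = l - 1: the cutoff decays in the outermost layer of K_j^l, so only m steps of decay are
  -- available.
  obtain ⟨m, rfl⟩ := Nat.exists_eq_add_of_le' hl
  have hx : CEM.aNormSq ε V (ψ - ψl)
      + CEM.sNormSq (T.weight ε) Ω (CEM.auxProj S L (CEM.H1.fn (ψ - ψl)))
      = ∑ k, (CEM.localSesq S L hΩ hW k (ψ - ψl) (ψ - ψl)).re :=
    (congrArg Complex.re (CEM.aForm_add_sForm_eq_sum S L hΩ hW (ψ - ψl) (ψ - ψl))).trans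
      (Complex.re_sum _ _)
  refine hx.trans_le ((CEM.le_of_le_pow_mul hΛ CEM.theta_pos CEM.one_le_mul_theta
    (CEM.sCell_self_nonneg _) (hψ.energyOutside_le hΩ hd3 hε hW hVmin hVm m)
    (hψl.sum_error_le hψ hΩ hd3 hε hW hVmin hVm)).trans_eq ?_)
  exact congrArg (_ * ·) (congrArg Complex.re (CEM.sForm_auxFun_self S hΩ j i).symm)
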